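/- Let $q\ge 3$, $\Delta\ge 3$ be integers and $0\le B<1$, and consider the antiferromagnetic $q$-state Potts model with parameter $B$ (interaction matrix $M$ with $M_{ii}=B$ and $M_{ij}=1$ for $i\ne j$; proper $q$-colourings are the case $B=0$) on the random $\Delta$-regular bipartite multigraph $G$ with sides $V_1,V_2$, $|V_1|=|V_2|=n$, formed by the union of $\Delta$ independent uniformly random perfect matchings between $V_1$ and $V_2$. A configuration $\sigma:V_1\cup V_2\to[q]$ has weight $w_G(\sigma)=\prod_{uv\in E(G)}M_{\sigma(u)\sigma(v)}$ (edges counted with multiplicity). Let $\triangle_q=\{x\in\mathbb R^q: x_i\ge 0,\ \sum_i x_i=1\}$. For $(\alpha,\beta)\in\triangle_q\times\triangle_q$ let $Z_G^{\alpha,\beta}$ be the sum of $w_G(\sigma)$ over all $\sigma$ with $|\sigma^{-1}(i)\cap V_1|=\hat\alpha_i$ and $|\sigma^{-1}(i)\cap V_2|=\hat\beta_i$ for all $i\in[q]$, where $\hat\alpha,\hat\beta$ are $n\alpha,n\beta$ rounded to non-negative integer vectors of sum $n$, each coordinate being changed by less than $1$, according to some fixed rounding rule. Let $$\Psi_1(\alpha,\beta)=\limsup_{n\to\infty}\frac1n\log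 \mathbf E_G\big[Z_G^{\alpha,\beta}\big]\in[-\infty,\infty]\qquad(\log 0=-\infty).$$ A *dominant phase* is a pair $(\alpha,\beta)$ maximizing $\Psi_1$ over $\triangle_q\times\triangle_q$. It is *Hessian dominant* if moreover, near $(\alpha,\beta)$, $\Psi_1$ is a real-valued $C^2$ function on the affine subspace $\{\sum_i\alpha_i=\sum_i\beta_i=1\}$ (all points of which close to $(\alpha,\beta)$ lie in $\triangle_q\times\triangle_q$), and its Hessian at $(\alpha,\beta)$ on the tangent space $\{(u,v):\sum_i u_i=\sum_i v_i=0\}$ is negative definite. **Theorem.** For every such rounding rule the following holds. 1. If $B\ge\frac{\Delta-q}{\Delta}$, there is a unique dominant phase $(\alpha,\beta)$; it satisfies $\alpha=\beta$, and in fact $\alpha_i=\beta_i=1/q$ for all $i$. 2. If $q$ is even and $B<\frac{\Delta-q}{\Delta}$, there exist real numbers $a\ne b$, depending only on $q,\Delta,B$ (and not on the rounding rule), such that the map sending $T\subseteq[q]$ with $|T|=q/2$ to the pair $(\alpha,\beta)$ given by $$\alpha_i=a,\ \beta_i=b\ \ (i\in T),\qquad \alpha_i=b,\ \beta_i=a\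 \ (i\notin T)$$ is a bijection from the set of $q/2$-element subsets of $[q]$ onto the set of dominant phases. Moreover, every dominant phase is Hessian dominant. In both cases, at all $(\alpha',\beta')\in\triangle_q\times\triangle_q$ in some neighbourhood of a dominant phase, the limsup defining $\Psi_1$ is a limit. -/

import Mathlib

open scoped BigOperators

/-! Spin systems on random regular bipartite multigraphs.

A sample of the random `Δ`-regular bipartite multigraph with sides `V₁ = V₂ = Fin n` is a family
`m : Fin Δ → Equiv.Perm (Fin n)` of `Δ` perfect matchings: its edges, counted with multiplicity,
are the pairs `(u, m k u)` with `u ∈ V₁`, `m k u ∈ V₂`, for `k : Fin Δ`. The matchings are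
independent and uniform, so all families `m` are equally likely. -/

/-- Interaction matrix of the `q`-state Potts model with parameter `B`
(`B = 0`: proper `q`-colourings). -/
def pottsMatrix (q : ℕ) (B : ℝ) : Matrix (Fin q) (Fin q) ℝ :=
  Matrix.of fun i j => if i = j then B else 1

/-- Weight `∏_{(u,v) ∈ E} M (σ u) (τ v)` of the configuration which is `σ` on `V₁` and `τ` on
`V₂`, on the multigraph given by the matchings `m`. -/
def configWeight {q Δ n : ℕ} (M : Matrix (Fin q) (Fin q) ℝ) (m : Fin Δ → Equiv.Perm (Fin n))
    (σ τ : Fin n → Fin q) : ℝ :=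
  ∏ k : Fin Δ, ∏ u : Fin n, M (σ u) (τ (m k u))

/-- Number of vertices of spin `i`. -/
def spinCount {q n : ℕ} (σ : Fin n → Fin q) (i : Fin q) : ℕ :=
  (Finset.univ.filter fun u => σ u = i).card

/-- Total weight of the configurations with exactly `a i` vertices of spin `i` in `V₁` and
exactly `b i` vertices of spin `i` in `V₂`. -/
noncomputable def phaseWeight {q Δ n : ℕ} (M : Matrix (Fin q) (Fin q) ℝ)
    (m : Fin Δ → Equiv.Perm (Fin n)) (a b : Fin q → ℕ) : ℝ :=
  ∑ σ : Fin n → Fin q, ∑ τ : Fin n → Fin q,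
    if spinCount σ = a ∧ spinCount τ = b then configWeight M m σ τ else 0

/-- A rounding scheme: for `α` in the simplex it replaces each of the numbers `n * α i` by one of
its two neighbouring integers (by itself if it is an integer), so that the sum `n` is preserved. -/
def IsRounding {q : ℕ} (ρ : ℕ → (Fin q → ℝ) → Fin q → ℕ) : Prop :=
  ∀ (n : ℕ), ∀ α ∈ stdSimplex ℝ (Fin q),
    ∑ i, ρ n α i = n ∧ ∀ i, |(ρ n α i : ℝ) - n * α i| < 1

/-- Cascade rounding (rounding down the partial sums of `n * α`) is a rounding scheme. -/
theorem exists_isRounding (q : ℕ) : ∃ ρ : ℕ → (Fin q → ℝ) → Fin q → ℕ, IsRounding ρ := by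
  let S : (Fin q → ℝ) → ℕ → ℝ := fun α k => ∑ j ∈ Finset.range k, if h : j < q then α ⟨j, h⟩ else 0
  refine ⟨fun n α i => ⌊n * S α (i + 1)⌋₊ - ⌊n * S α i⌋₊, ?_⟩
  rintro n α ⟨h0, h1⟩
  have hS : ∀ k, S α k ≤ S α (k + 1) := fun k => by
    simp only [S, Finset.sum_range_succ, le_add_iff_nonneg_right]
    split_ifs
    · exact h0 _
    · exact le_rfl
  have hSpos : ∀ k, 0 ≤ S α k := fun k => Finset.sum_nonneg fun j _ => by
    split_ifs
    · exact h0 _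
    · exact le_rfl
  have hmono : Monotone fun k => ⌊n * S α k⌋₊ := monotone_nat_of_le_succ fun k =>
    Nat.floor_mono (mul_le_mul_of_nonneg_left (hS k) (Nat.cast_nonneg n))
  have hSq : S α q = 1 := by
    simp only [S]
    rw [← h1, ← Fin.sum_univ_eq_sum_range (fun j => if h : j < q then α ⟨j, h⟩ else 0) q]
    simp
  constructor
  · rw [Fin.sum_univ_eq_sum_range (fun k => ⌊n * S α (k + 1)⌋₊ - ⌊n * S α k⌋₊) q,
      Finset.sum_range_tsub hmono, hSq]
    simp [S]
  · intro i
    have hi : S α (i + 1) = S α i + α i := by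
      simp [S, Finset.sum_range_succ]
    have e1 := Nat.floor_le (mul_nonneg (Nat.cast_nonneg (α := ℝ) n) (hSpos (i + 1)))
    have e2 := Nat.lt_floor_add_one ((n : ℝ) * S α (i + 1))
    have e3 := Nat.floor_le (mul_nonneg (Nat.cast_nonneg (α := ℝ) n) (hSpos i))
    have e4 := Nat.lt_floor_add_one ((n : ℝ) * S α i)
    have e5 : (n : ℝ) * S α (i + 1) = n * S α i + n * α i := by rw [hi]; ring
    rw [Nat.cast_sub (hmono (Nat.le_succ i)), abs_lt]
    constructor <;> linarith

/-- First moment `E[Z^{α,β}]` over the random `Δ`-regular bipartite multigraph on `n + n`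
vertices. -/
noncomputable def firstMoment {q : ℕ} (Δ : ℕ) (M : Matrix (Fin q) (Fin q) ℝ)
    (ρ : ℕ → (Fin q → ℝ) → Fin q → ℕ) (p : (Fin q → ℝ) × (Fin q → ℝ)) (n : ℕ) : ℝ :=
  𝔼 m : Fin Δ → Equiv.Perm (Fin n), phaseWeight M m (ρ n p.1) (ρ n p.2)

/-- The function `Ψ₁(α, β) = lim (1/n) log E[Z^{α,β}]`, with values in `[-∞, ∞]` (`log 0 = -∞`).
The upper limit is taken, so that it is defined everywhere; it is the limit wherever
`FirstMomentLimitExists` holds. -/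
noncomputable def Psi1 {q : ℕ} (Δ : ℕ) (M : Matrix (Fin q) (Fin q) ℝ)
    (ρ : ℕ → (Fin q → ℝ) → Fin q → ℕ) (p : (Fin q → ℝ) × (Fin q → ℝ)) : EReal :=
  ExpGrowth.expGrowthSup fun n => ENNReal.ofReal (firstMoment Δ M ρ p n)

/-- The sequence `(1/n) log E[Z^{α,β}]` converges (to `Ψ₁(α, β)`) as `n → ∞`. -/
def FirstMomentLimitExists {q : ℕ} (Δ : ℕ) (M : Matrix (Fin q) (Fin q) ℝ)
    (ρ : ℕ → (Fin q → ℝ) → Fin q → ℕ) (p : (Fin q → ℝ) × (Fin q → ℝ)) : Prop :=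
  Filter.Tendsto (fun n : ℕ => ENNReal.log (ENNReal.ofReal (firstMoment Δ M ρ p n)) / (n : EReal))
    Filter.atTop (nhds (Psi1 Δ M ρ p))

/-- The domain `△_q × △_q` of `Ψ₁`. -/
def phaseSpace (q : ℕ) : Set ((Fin q → ℝ) × (Fin q → ℝ)) :=
  stdSimplex ℝ (Fin q) ×ˢ stdSimplex ℝ (Fin q)

/-- `(α, β)` is a dominant phase: it maximizes `Ψ₁` over `△_q × △_q`. -/
def IsDominantPhase {q : ℕ} (Δ : ℕ) (M : Matrix (Fin q) (Fin q) ℝ)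
    (ρ : ℕ → (Fin q → ℝ) → Fin q → ℕ) (p : (Fin q → ℝ) × (Fin q → ℝ)) : Prop :=
  p ∈ phaseSpace q ∧ IsMaxOn (Psi1 Δ M ρ) (phaseSpace q) p

/-- The directions tangent to `△_q × △_q`: pairs of vectors with coordinate sums `0` and `0`. -/
def phaseTangent (q : ℕ) : Submodule ℝ ((Fin q → ℝ) × (Fin q → ℝ)) where
  carrier := {h | ∑ i, h.1 i = 0 ∧ ∑ i, h.2 i = 0}
  zero_mem' := by simp
  add_mem' := by
    rintro x y ⟨hx1, hx2⟩ ⟨hy1, hy2⟩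
    simp [Finset.sum_add_distrib, hx1, hx2, hy1, hy2]
  smul_mem' := by
    rintro c x ⟨hx1, hx2⟩
    simp [← Finset.mul_sum, hx1, hx2]

/-- `(α, β)` is Hessian dominant: it is a dominant phase, near it `Ψ₁` is a real-valued
function of class `C²` (as a function on the affine subspace spanned by `△_q × △_q`), and the
Hessian of that function at `(α, β)` is negative definite. -/
def IsHessianDominant {q : ℕ} (Δ : ℕ) (M : Matrix (Fin q) (Fin q) ℝ)
    (ρ : ℕ → (Fin q → ℝ) → Fin q → ℕ) (p : (Fin q → ℝ) × (Fin q → ℝ)) : Prop :=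
  IsDominantPhase Δ M ρ p ∧
    ∃ F : phaseTangent q → ℝ,
      (∀ᶠ h : phaseTangent q in nhds 0,
        p + (h : (Fin q → ℝ) × (Fin q → ℝ)) ∈ phaseSpace q ∧
        Psi1 Δ M ρ (p + (h : (Fin q → ℝ) × (Fin q → ℝ))) = (F h : EReal)) ∧
      ContDiffAt ℝ 2 F 0 ∧
      ∀ h : phaseTangent q, h ≠ 0 → fderiv ℝ (fderiv ℝ F) 0 h h < 0

/-- The pair `(α, β)` with `α = a` on `T`, `α = b` off `T`, and `β = b` on `T`, `β = a` off
`T`. -/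
def twoValuedPhase {q : ℕ} (a b : ℝ) (T : Finset (Fin q)) : (Fin q → ℝ) × (Fin q → ℝ) :=
  (fun i => if i ∈ T then a else b, fun i => if i ∈ T then b else a)

/-! ### Words of a given type: exact count and entropy bounds. -/

section Counting

/-! Write Δ = d + 1. The first moment depends only on the two type classes A, B of the rounded
phase: it is (|A||B|)^(1-Δ) times the Δ-th power of the total weight over one fixed matching
(`firstMoment_mul`). Tilting by arbitrary weights r, c bounds that total weight by (∑ r_i M_ij
c_j)^n divided by the tilt (`pairWeight_mul_le`), so Ψ₁ has an explicit upper bound for each choice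
of r, c (`Psi1_le`). If some x_i M_ij y_j has margins α, β, rounding this matrix to integer tables
shows that the bound for r = x, c = y is attained (`Psi1_eq_of_scaling`).

With r_i = α_i^(d/(d+1)) and c_i = β_i^(d/(d+1)) the entropies cancel, leaving Ψ₁ ≤ Δ log Z, where
for the Potts matrix Z = (∑ r_i)(∑ c_i) - (1-B) ∑ r_i c_i. This form couples all coordinates.
Rescale the roots of order d+1 of α_i, β_i by a common factor to X_i, Y_i. Then the gap between Z
and its value at a candidate optimum is at least a positive multiple of N ∑ (`pairFun d K X_i Y_i` -
minimum) plus a square, N > 0 being a constant (`IsOptimalPair.le_optimalValue_sub_bilin`).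
Maximizing Ψ₁ thus decouples into minimizing a function of two variables on a quadrant, with K tied
to B by the condition that K ∑ ξ_i^d be 1 - B at the optimum.

Minimizers satisfy X + K Y^d = 1 = Y + K X^d. A solution with Y = tX, t > 1, exists exactly when K =
`cycleParam d t`, and this function is strictly increasing on [1, ∞), by an AM-GM inequality
(`cycleParam_strictMonoOn`). So up to K = `cycleParam d 1` the minimizer is the diagonal one. Past
that value the diagonal fails a second derivative test and the minimizers are one pair and its swap.
The condition on B puts the transition t = 1 at (1-B)/q = 1/Δ. At a dominant phase every coordinate
pair is a minimizer and the square vanishes; past the transition, the vanishing of the square says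
that the pair and its swap are used by equally many colours.

For the Hessian, Ψ₁ is smooth near the optimum because the scaling vectors depend smoothly on the
margins (`exists_local_scaling`), and the decoupled gap grows quadratically (`pairFun_growth`); a
function with quadratic decay has negative definite Hessian. -/

theorem sum_negMulLog_div {ι : Type*} [Fintype ι] {n : ℕ} (hn : 0 < n) {a : ι → ℕ} (ha : ∑ i, a i = n) :
    n * ∑ i, Real.negMulLog ((a i : ℝ) / n) = n * Real.log n - ∑ i, a i * Real.log (a i) := by
  have hn' : (0 : ℝ) < n := by exact_mod_cast hn
  have h : ∀ i, (n : ℝ) * Real.negMulLog ((a i : ℝ) / n)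
      = a i * Real.log n - a i * Real.log (a i) := fun i => by
    rcases Nat.eq_zero_or_pos (a i) with h0 | h0
    · simp [h0]
    · have : (0 : ℝ) < a i := by exact_mod_cast h0
      rw [Real.negMulLog, Real.log_div this.ne' hn'.ne']
      field_simp
      ring
  rw [Finset.mul_sum, Finset.sum_congr rfl fun i _ => h i, Finset.sum_sub_distrib,
    ← Finset.sum_mul, ← Nat.cast_sum, ha]

variable {ι : Type*} [Fintype ι] [DecidableEq ι]

/-- The words of length `n` over `ι` in which the letter `i` occurs exactly `a i` times. -/
def typeClass (n : ℕ) (a : ι → ℕ) : Finset (Fin n → ι) :=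
  Finset.univ.filter fun σ => ∀ i, (Finset.univ.filter fun u => σ u = i).card = a i

theorem mem_typeClass {n : ℕ} {a : ι → ℕ} {σ : Fin n → ι} :
    σ ∈ typeClass n a ↔ ∀ i, (Finset.univ.filter fun u => σ u = i).card = a i := by
  simp [typeClass]

theorem prod_comp_of_mem_typeClass {n : ℕ} {a : ι → ℕ} {σ : Fin n → ι} (hσ : σ ∈ typeClass n a)
    (w : ι → ℝ) : ∏ u, w (σ u) = ∏ i, w i ^ a i := by
  rw [mem_typeClass] at hσ
  rw [← Finset.prod_fiberwise Finset.univ σ]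
  refine Finset.prod_congr rfl fun i _ => ?_
  rw [← hσ i]
  refine Finset.prod_eq_pow_card fun u hu => ?_
  rw [(Finset.mem_filter.1 hu).2]

theorem comp_perm_mem_typeClass {n : ℕ} {a : ι → ℕ} {σ : Fin n → ι} (hσ : σ ∈ typeClass n a)
    (π : Equiv.Perm (Fin n)) : σ ∘ π ∈ typeClass n a := by
  rw [mem_typeClass] at hσ ⊢
  intro i
  rw [← hσ i]
  refine Finset.card_bij (fun u _ => π u) ?_ ?_ ?_
  · intro u hu
    simpa using hu
  · intro u _ v _ h
    exact π.injective h
  · intro u hu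
    exact ⟨π.symm u, by simpa using hu, by simp⟩

theorem exists_perm_of_mem_typeClass {n : ℕ} {a : ι → ℕ} {σ τ : Fin n → ι}
    (hσ : σ ∈ typeClass n a) (hτ : τ ∈ typeClass n a) :
    ∃ π : Equiv.Perm (Fin n), τ = σ ∘ π := by
  rw [mem_typeClass] at hσ hτ
  have e : ∀ i, Nonempty ({u // τ u = i} ≃ {u // σ u = i}) := fun i => by
    refine ⟨Fintype.equivOfCardEq ?_⟩
    rw [Fintype.card_subtype, Fintype.card_subtype, hσ i, hτ i]
  let E : ∀ i, {u // τ u = i} ≃ {u // σ u = i} := fun i => (e i).some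
  refine ⟨(Equiv.sigmaFiberEquiv τ).symm.trans
    ((Equiv.sigmaCongrRight E).trans (Equiv.sigmaFiberEquiv σ)), ?_⟩
  funext u
  exact ((E (τ u)) ⟨u, rfl⟩).2.symm

theorem typeClass_nonempty {n : ℕ} {a : ι → ℕ} (ha : ∑ i, a i = n) :
    (typeClass n a).Nonempty := by
  have e : (Σ i, Fin (a i)) ≃ Fin n := Fintype.equivOfCardEq (by simp [ha])
  refine ⟨fun u => (e.symm u).1, mem_typeClass.2 fun i => ?_⟩
  have hinj : Function.Injective fun k : Fin (a i) => e ⟨i, k⟩ := fun k l h => by simpa using h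
  have : (Finset.univ.filter fun u => (e.symm u).1 = i)
      = Finset.univ.image fun k : Fin (a i) => e ⟨i, k⟩ := by
    ext u
    simp only [Finset.mem_filter, Finset.mem_univ, true_and, Finset.mem_image]
    constructor
    · rintro rfl
      exact ⟨(e.symm u).2, by simp⟩
    · rintro ⟨k, rfl⟩
      simp
  rw [this, Finset.card_image_of_injective _ hinj]
  simp

/-- Orbit-stabilizer: permutations of positions act transitively on the type class, and the
stabilizer of a word is the product of the symmetric groups of its fibres. -/
theorem card_typeClass_mul_prod_factorial {n : ℕ} {a : ι → ℕ} (ha : ∑ i, a i = n) :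
    (typeClass n a).card * ∏ i, (a i).factorial = n.factorial := by
  obtain ⟨σ, hσ⟩ := typeClass_nonempty ha
  have hstab : (Finset.univ.filter fun π : Equiv.Perm (Fin n) => σ ∘ π = σ).card
      = ∏ i, (a i).factorial := by
    rw [← Fintype.card_subtype, DomMulAct.stabilizer_card σ]
    refine Finset.prod_congr rfl fun i _ => ?_
    rw [Fintype.card_subtype, mem_typeClass.1 hσ i]
  have h := Finset.card_eq_sum_card_fiberwise (s := (Finset.univ : Finset (Equiv.Perm (Fin n))))
    (t := typeClass n a) (f := fun π : Equiv.Perm (Fin n) => σ ∘ π) fun π _ => comp_perm_mem_typeClass hσ π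
  rw [Finset.card_univ, Fintype.card_perm, Fintype.card_fin] at h
  rw [h, Finset.sum_const_nat]
  intro τ hτ
  obtain ⟨ρ, rfl⟩ := exists_perm_of_mem_typeClass hσ hτ
  rw [← hstab]
  refine Finset.card_bij (fun π _ => π * ρ⁻¹) ?_ ?_ ?_
  · intro π hπ
    simp only [Finset.mem_filter, Finset.mem_univ, true_and] at hπ ⊢
    funext u
    have := congrFun hπ (ρ⁻¹ u)
    simpa using this
  · intro π _ π' _ h
    simpa using h
  · intro π hπ
    simp only [Finset.mem_filter, Finset.mem_univ, true_and] at hπ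
    refine ⟨π * ρ, ?_, by simp⟩
    simp only [Finset.mem_filter, Finset.mem_univ, true_and]
    funext u
    exact congrFun hπ (ρ u)

theorem sum_typeClass_comp {n : ℕ} (a : ι → ℕ) (f : (Fin n → ι) → ℝ)
    (π : Equiv.Perm (Fin n)) : ∑ τ ∈ typeClass n a, f (τ ∘ π) = ∑ τ ∈ typeClass n a, f τ := by
  refine Finset.sum_bij' (fun τ _ => τ ∘ π) (fun τ _ => τ ∘ π.symm)
    (fun τ h => comp_perm_mem_typeClass h π) (fun τ h => comp_perm_mem_typeClass h π.symm)
    ?_ ?_ (fun _ _ => rfl) <;>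
  · intro τ _
    funext u
    simp

/-- The left side collects some of the nonnegative terms in the expansion of the power on the right.
-/
theorem card_typeClass_mul_prod_pow_le {n : ℕ} (a : ι → ℕ) {w : ι → ℝ} (hw : ∀ i, 0 ≤ w i) :
    ((typeClass n a).card : ℝ) * ∏ i, w i ^ a i ≤ (∑ i, w i) ^ n := by
  have h : ∑ σ ∈ typeClass n a, ∏ u, w (σ u) = (typeClass n a).card * ∏ i, w i ^ a i := by
    rw [Finset.sum_congr rfl fun σ hσ => prod_comp_of_mem_typeClass hσ w]
    simp
  rw [← h, Fintype.sum_pow]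
  exact Finset.sum_le_sum_of_subset_of_nonneg (Finset.subset_univ _)
    fun σ _ _ => Finset.prod_nonneg fun u _ => hw _

theorem log_factorial_le (n : ℕ) :
    Real.log n.factorial ≤ n * Real.log n - n + 1 + Real.log (n + 1) := by
  rcases Nat.eq_zero_or_pos n with rfl | hn
  · simp
  have key : Real.log n.factorial ≤ n * Real.log n - n + 1 + Real.log n := by
    induction n, hn using Nat.le_induction with
    | base => simp
    | succ n hn ih =>
      have hn' : (0 : ℝ) < n := by exact_mod_cast hn
      rw [Nat.factorial_succ, Nat.cast_mul, Real.log_mul (by positivity) (by positivity)]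
      have h1 := Real.one_sub_inv_le_log_of_pos (x := ((n : ℝ) + 1) / n) (by positivity)
      rw [Real.log_div (by positivity) (by positivity)] at h1
      have h2 : (1 : ℝ) - (((n : ℝ) + 1) / n)⁻¹ = 1 / (n + 1) := by field_simp; ring
      rw [h2, div_le_iff₀ (by positivity)] at h1
      push_cast
      nlinarith
  have : Real.log n ≤ Real.log (n + 1) :=
    Real.log_le_log (by exact_mod_cast hn) (by linarith)
  linarith

theorem le_log_factorial (n : ℕ) : n * Real.log n - n ≤ Real.log n.factorial := by
  rcases Nat.eq_zero_or_pos n with rfl | hn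
  · simp
  have h := Stirling.le_log_factorial_stirling hn.ne'
  have h1 : 0 ≤ Real.log n := Real.log_natCast_nonneg n
  have h2 : 0 ≤ Real.log (2 * Real.pi) := Real.log_nonneg (by nlinarith [Real.pi_gt_three])
  linarith

theorem log_card_typeClass_le {n : ℕ} (hn : 0 < n) {a : ι → ℕ} (ha : ∑ i, a i = n) :
    Real.log (typeClass n a).card ≤ n * ∑ i, Real.negMulLog ((a i : ℝ) / n) := by
  have hn' : (0 : ℝ) < n := by exact_mod_cast hn
  have hc : (0 : ℝ) < (typeClass n a).card := by
    exact_mod_cast (typeClass_nonempty ha).card_pos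
  have h := card_typeClass_mul_prod_pow_le (n := n) a (w := fun i => (a i : ℝ))
    fun i => by positivity
  -- An absent letter contributes 0 ^ 0 = 1, so taking `w = a` in the product bound is legitimate
  -- even at zeros.
  have hne : ∀ i, ((a i : ℝ) ^ a i) ≠ 0 := fun i => by
    rcases Nat.eq_zero_or_pos (a i) with h0 | h0
    · simp [h0]
    · positivity
  have hp : 0 < ∏ i, (a i : ℝ) ^ a i :=
    Finset.prod_pos fun i _ => lt_of_le_of_ne (by positivity) (hne i).symm
  have h' := Real.log_le_log (by positivity) h
  rw [Real.log_mul hc.ne' hp.ne', Real.log_prod (fun i _ => hne i), Real.log_pow,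
    ← Nat.cast_sum, ha] at h'
  rw [sum_negMulLog_div hn ha]
  simp only [Real.log_pow] at h'
  linarith

theorem le_log_card_typeClass {n : ℕ} (hn : 0 < n) {a : ι → ℕ} (ha : ∑ i, a i = n) :
    n * ∑ i, Real.negMulLog ((a i : ℝ) / n) - Fintype.card ι * (1 + Real.log (n + 1))
      ≤ Real.log (typeClass n a).card := by
  have hc : (0 : ℝ) < (typeClass n a).card := by
    exact_mod_cast (typeClass_nonempty ha).card_pos
  have h : (((typeClass n a).card : ℝ) * ∏ i, ((a i).factorial : ℝ)) = n.factorial := by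
    exact_mod_cast card_typeClass_mul_prod_factorial ha
  have h' := congrArg Real.log h
  rw [Real.log_mul hc.ne' (Finset.prod_ne_zero_iff.2 fun i _ => by positivity),
    Real.log_prod (fun i _ => by positivity)] at h'
  have h1 := le_log_factorial n
  have h2 : ∑ i, Real.log ((a i).factorial : ℝ)
      ≤ ∑ i, ((a i * Real.log (a i) - a i) + (1 + Real.log (n + 1))) := by
    refine Finset.sum_le_sum fun i _ => ?_
    have h3 := log_factorial_le (a i)
    have h4 : (a i : ℝ) ≤ n := by
      exact_mod_cast ha ▸ Finset.single_le_sum (fun _ _ => Nat.zero_le _) (Finset.mem_univ i)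
    have h5 : Real.log ((a i : ℝ) + 1) ≤ Real.log (n + 1) :=
      Real.log_le_log (by positivity) (by linarith)
    linarith
  rw [Finset.sum_add_distrib, Finset.sum_sub_distrib, ← Nat.cast_sum, ha] at h2
  simp only [Finset.sum_const, Finset.card_univ, nsmul_eq_mul] at h2
  rw [sum_negMulLog_div hn ha]
  linarith

end Counting

/-! ### The first moment in terms of a single matching. -/

section FirstMoment

variable {q n : ℕ}

/-- The total weight of all pairs of words of types `a` and `b`, the matching being fixed. -/
noncomputable def pairWeight (n : ℕ) (M : Matrix (Fin q) (Fin q) ℝ) (a b : Fin q → ℕ) : ℝ :=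
  ∑ σ ∈ typeClass n a, ∑ τ ∈ typeClass n b, ∏ u, M (σ u) (τ u)

theorem spinCount_eq_iff {σ : Fin n → Fin q} {a : Fin q → ℕ} :
    spinCount σ = a ↔ σ ∈ typeClass n a := by
  rw [mem_typeClass, funext_iff]
  rfl

theorem expect_configWeight (Δ : ℕ) (M : Matrix (Fin q) (Fin q) ℝ) (σ τ : Fin n → Fin q) :
    𝔼 m : Fin Δ → Equiv.Perm (Fin n), configWeight M m σ τ
      = (𝔼 π : Equiv.Perm (Fin n), ∏ u, M (σ u) (τ (π u))) ^ Δ := by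
  unfold configWeight
  rw [Fintype.expect_eq_sum_div_card, Fintype.expect_eq_sum_div_card, div_pow, Fintype.sum_pow]
  simp

/-- Multiplying a uniform permutation on both sides leaves it uniform, so the expectation depends
only on the types of the two words. Averaging over the classes, the permutation is absorbed into the
second word. -/
theorem card_mul_card_mul_expect {M : Matrix (Fin q) (Fin q) ℝ} {a b : Fin q → ℕ}
    {σ τ : Fin n → Fin q} (hσ : σ ∈ typeClass n a) (hτ : τ ∈ typeClass n b) :
    ((typeClass n a).card : ℝ) * (typeClass n b).card
      * 𝔼 π : Equiv.Perm (Fin n), ∏ u, M (σ u) (τ (π u)) = pairWeight n M a b := by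
  have hinv : ∀ σ' ∈ typeClass n a, ∀ τ' ∈ typeClass n b,
      𝔼 π : Equiv.Perm (Fin n), ∏ u, M (σ' u) (τ' (π u))
        = 𝔼 π : Equiv.Perm (Fin n), ∏ u, M (σ u) (τ (π u)) := by
    intro σ' hσ' τ' hτ'
    obtain ⟨ρ, rfl⟩ := exists_perm_of_mem_typeClass hσ hσ'
    obtain ⟨κ, rfl⟩ := exists_perm_of_mem_typeClass hτ hτ'
    refine Fintype.expect_equiv ((Equiv.mulLeft κ).trans (Equiv.mulRight ρ⁻¹)) _ _ fun π => ?_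
    conv_rhs => rw [← Equiv.prod_comp ρ]
    simp
  have h1 : ∑ σ' ∈ typeClass n a, ∑ τ' ∈ typeClass n b,
      𝔼 π : Equiv.Perm (Fin n), ∏ u, M (σ' u) (τ' (π u)) = pairWeight n M a b := by
    calc _ = 𝔼 π : Equiv.Perm (Fin n), ∑ σ' ∈ typeClass n a, ∑ τ' ∈ typeClass n b,
          ∏ u, M (σ' u) (τ' (π u)) := by
            simp only [Finset.expect_sum_comm]
      _ = 𝔼 _π : Equiv.Perm (Fin n), pairWeight n M a b := by
            refine Finset.expect_congr rfl fun π _ => ?_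
            refine Finset.sum_congr rfl fun σ' _ => ?_
            exact sum_typeClass_comp b (fun τ' => ∏ u, M (σ' u) (τ' u)) π
      _ = _ := by simp
  rw [← h1, Finset.sum_congr rfl fun σ' hσ' => Finset.sum_congr rfl fun τ' hτ' => hinv σ' hσ' τ' hτ']
  simp [mul_assoc]

/-- By independence each pair of words contributes the Δ-th power of a one-matching expectation, the
same for all pairs. Denominators are cleared because for an arbitrary `ρ` a class may be empty. -/
theorem firstMoment_mul (Δ : ℕ) (M : Matrix (Fin q) (Fin q) ℝ)
    (ρ : ℕ → (Fin q → ℝ) → Fin q → ℕ) (p : (Fin q → ℝ) × (Fin q → ℝ)) (n : ℕ) :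
    firstMoment Δ M ρ p n
        * (((typeClass n (ρ n p.1)).card : ℝ) * (typeClass n (ρ n p.2)).card) ^ Δ
      = (((typeClass n (ρ n p.1)).card : ℝ) * (typeClass n (ρ n p.2)).card)
        * pairWeight n M (ρ n p.1) (ρ n p.2) ^ Δ := by
  set a := ρ n p.1
  set b := ρ n p.2
  have h : firstMoment Δ M ρ p n = ∑ σ ∈ typeClass n a, ∑ τ ∈ typeClass n b,
      (𝔼 π : Equiv.Perm (Fin n), ∏ u, M (σ u) (τ (π u))) ^ Δ := by
    have h1 : ∀ m : Fin Δ → Equiv.Perm (Fin n), phaseWeight M m a b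
        = ∑ σ ∈ typeClass n a, ∑ τ ∈ typeClass n b, configWeight M m σ τ := by
      intro m
      unfold phaseWeight
      simp only [spinCount_eq_iff, ite_and]
      rw [← Finset.sum_subset (Finset.subset_univ (typeClass n a)) fun σ _ hσ => by simp [hσ]]
      refine Finset.sum_congr rfl fun σ hσ => ?_
      rw [← Finset.sum_subset (Finset.subset_univ (typeClass n b)) fun τ _ hτ => by simp [hτ]]
      exact Finset.sum_congr rfl fun τ hτ => by simp [hσ, hτ]
    simp only [← expect_configWeight]
    unfold firstMoment
    simp only [← Finset.expect_sum_comm]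
    exact Finset.expect_congr rfl fun m _ => h1 m
  have h2 : ∀ σ ∈ typeClass n a, ∀ τ ∈ typeClass n b,
      (𝔼 π : Equiv.Perm (Fin n), ∏ u, M (σ u) (τ (π u))) ^ Δ
        * (((typeClass n a).card : ℝ) * (typeClass n b).card) ^ Δ = pairWeight n M a b ^ Δ := by
    intro σ hσ τ hτ
    rw [← card_mul_card_mul_expect hσ hτ]
    ring
  rw [h, Finset.sum_mul]
  simp only [Finset.sum_mul]
  rw [Finset.sum_congr rfl fun σ hσ => Finset.sum_congr rfl fun τ hτ => h2 σ hσ τ hτ]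
  simp [mul_assoc]

end FirstMoment

/-! ### Upper and lower bounds for the one-matching weight. -/

section PairWeight

variable {q n : ℕ}

theorem pairWeight_nonneg {M : Matrix (Fin q) (Fin q) ℝ} (hM : ∀ i j, 0 ≤ M i j)
    (a b : Fin q → ℕ) : 0 ≤ pairWeight n M a b :=
  Finset.sum_nonneg fun _ _ => Finset.sum_nonneg fun _ _ => Finset.prod_nonneg fun _ _ => hM _ _

/-- The tilt multiplies every pair of words of these types by the same factor; dropping the type
constraint then makes the sum over words factor over positions. -/
theorem pairWeight_mul_le {M : Matrix (Fin q) (Fin q) ℝ} (hM : ∀ i j, 0 ≤ M i j)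
    (a b : Fin q → ℕ) {r c : Fin q → ℝ} (hr : ∀ i, 0 ≤ r i) (hc : ∀ i, 0 ≤ c i) :
    pairWeight n M a b * ((∏ i, r i ^ a i) * ∏ j, c j ^ b j)
      ≤ (∑ i, ∑ j, r i * M i j * c j) ^ n := by
  have h1 : pairWeight n M a b * ((∏ i, r i ^ a i) * ∏ j, c j ^ b j)
      = ∑ σ ∈ typeClass n a, ∑ τ ∈ typeClass n b, ∏ u, r (σ u) * M (σ u) (τ u) * c (τ u) := by
    unfold pairWeight
    rw [Finset.sum_mul]
    refine Finset.sum_congr rfl fun σ hσ => ?_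
    rw [Finset.sum_mul]
    refine Finset.sum_congr rfl fun τ hτ => ?_
    rw [← prod_comp_of_mem_typeClass hσ r, ← prod_comp_of_mem_typeClass hτ c,
      Finset.prod_mul_distrib, Finset.prod_mul_distrib]
    ring
  have h2 : (∑ i, ∑ j, r i * M i j * c j) ^ n
      = ∑ σ : Fin n → Fin q, ∑ τ : Fin n → Fin q, ∏ u, r (σ u) * M (σ u) (τ u) * c (τ u) := by
    rw [← Fintype.sum_prod_type' (f := fun i j => r i * M i j * c j), Fintype.sum_pow,
      ← Fintype.sum_prod_type' (f := fun (σ : Fin n → Fin q) (τ : Fin n → Fin q) =>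
        ∏ u, r (σ u) * M (σ u) (τ u) * c (τ u))]
    exact Fintype.sum_equiv (Equiv.arrowProdEquivProdArrow _ _ _) _ _ fun _ => rfl
  have h3 : ∀ σ τ : Fin n → Fin q, 0 ≤ ∏ u, r (σ u) * M (σ u) (τ u) * c (τ u) := fun σ τ =>
    Finset.prod_nonneg fun u _ => mul_nonneg (mul_nonneg (hr _) (hM _ _)) (hc _)
  rw [h1, h2]
  calc _ ≤ ∑ σ ∈ typeClass n a, ∑ τ : Fin n → Fin q, ∏ u, r (σ u) * M (σ u) (τ u) * c (τ u) :=
        Finset.sum_le_sum fun σ _ => Finset.sum_le_sum_of_subset_of_nonneg (Finset.subset_univ _)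
          fun τ _ _ => h3 σ τ
    _ ≤ _ := Finset.sum_le_sum_of_subset_of_nonneg (Finset.subset_univ _)
          fun σ _ _ => Finset.sum_nonneg fun τ _ => h3 σ τ

/-- Words of pairs with joint type `N` split injectively into pairs of words of the marginal types,
so one joint type already gives a lower bound. -/
theorem card_typeClass_mul_le_pairWeight {M : Matrix (Fin q) (Fin q) ℝ} (hM : ∀ i j, 0 ≤ M i j)
    {a b : Fin q → ℕ} {N : Fin q × Fin q → ℕ} (ha : ∀ i, ∑ j, N (i, j) = a i)
    (hb : ∀ j, ∑ i, N (i, j) = b j) :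
    ((typeClass n N).card : ℝ) * ∏ e, M e.1 e.2 ^ N e ≤ pairWeight n M a b := by
  have h1 : ((typeClass n N).card : ℝ) * ∏ e, M e.1 e.2 ^ N e
      = ∑ ω ∈ typeClass n N, ∏ u, M (ω u).1 (ω u).2 := by
    rw [Finset.sum_congr rfl fun ω hω => prod_comp_of_mem_typeClass hω fun e => M e.1 e.2]
    simp
  have h2 : pairWeight n M a b
      = ∑ x ∈ typeClass n a ×ˢ typeClass n b, ∏ u, M (x.1 u) (x.2 u) := by
    rw [Finset.sum_product]
    rfl
  have h3 : ∑ ω ∈ typeClass n N, ∏ u, M (ω u).1 (ω u).2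
      = ∑ x ∈ (typeClass n N).image (Equiv.arrowProdEquivProdArrow (Fin n) (fun _ => Fin q)
          (fun _ => Fin q)), ∏ u, M (x.1 u) (x.2 u) := by
    rw [Finset.sum_image fun _ _ _ _ h => Equiv.injective _ h]
    rfl
  rw [h1, h2, h3]
  refine Finset.sum_le_sum_of_subset_of_nonneg ?_ fun x _ _ => Finset.prod_nonneg fun u _ => hM _ _
  intro x hx
  obtain ⟨ω, hω, rfl⟩ := Finset.mem_image.1 hx
  rw [mem_typeClass] at hω
  rw [Finset.mem_product, mem_typeClass, mem_typeClass]
  constructor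
  · intro i
    rw [← ha i]
    simp only [← hω]
    rw [← Finset.card_biUnion]
    · congr 1
      ext u
      refine Iff.trans Finset.mem_filter (Iff.trans ?_ Finset.mem_biUnion.symm)
      simp [Equiv.arrowProdEquivProdArrow, Prod.ext_iff]
    · intro j _ j' _ hjj
      refine Finset.disjoint_left.2 fun u hu hu' => hjj ?_
      simp only [Finset.mem_filter, Finset.mem_univ, true_and] at hu hu'
      simpa [hu] using hu'
  · intro j
    rw [← hb j]
    simp only [← hω]
    rw [← Finset.card_biUnion]
    · congr 1
      ext u
      refine Iff.trans Finset.mem_filter (Iff.trans ?_ Finset.mem_biUnion.symm)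
      simp [Equiv.arrowProdEquivProdArrow, Prod.ext_iff]
    · intro j _ j' _ hjj
      refine Finset.disjoint_left.2 fun u hu hu' => hjj ?_
      simp only [Finset.mem_filter, Finset.mem_univ, true_and] at hu hu'
      simpa [hu] using hu'

end PairWeight

/-! ### Exponential growth rates and limits of rounded phases. -/

section Growth

open Filter Topology

theorem expGrowthSup_le_of_tendsto {u x : ℕ → ℝ} {l : ℝ} (hx : Tendsto x atTop (𝓝 l))
    (hu : ∀ᶠ n in atTop, u n ≤ Real.exp (n * x n)) :
    ExpGrowth.expGrowthSup (fun n => ENNReal.ofReal (u n)) ≤ (l : EReal) := by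
  have hx' : Tendsto (fun n => (x n : EReal)) atTop (𝓝 (l : EReal)) :=
    (continuous_coe_real_ereal.tendsto l).comp hx
  rw [← hx'.limsup_eq]
  refine limsup_le_limsup ?_
  filter_upwards [hu, eventually_gt_atTop 0] with n hn h0
  refine (EReal.div_le_iff_le_mul (by exact_mod_cast h0) (EReal.natCast_ne_top n)).2 ?_
  refine (ENNReal.log_le_log (ENNReal.ofReal_le_ofReal hn)).trans ?_
  rw [ENNReal.log_ofReal_of_pos (Real.exp_pos _), Real.log_exp]
  push_cast
  rfl

theorem tendsto_log_div_of_tendsto {u x y : ℕ → ℝ} {l : ℝ} (hx : Tendsto x atTop (𝓝 l))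
    (hy : Tendsto y atTop (𝓝 l)) (hu : ∀ᶠ n in atTop, u n ≤ Real.exp (n * x n))
    (hu' : ∀ᶠ n in atTop, Real.exp (n * y n) ≤ u n) :
    Tendsto (fun n : ℕ => ENNReal.log (ENNReal.ofReal (u n)) / (n : EReal)) atTop
      (𝓝 (l : EReal)) := by
  have hlog : Tendsto (fun n : ℕ => Real.log (u n) / n) atTop (𝓝 l) := by
    refine tendsto_of_tendsto_of_tendsto_of_le_of_le' hy hx ?_ ?_
    · filter_upwards [hu', eventually_gt_atTop 0] with n hn h0
      rw [le_div_iff₀ (by exact_mod_cast h0), mul_comm, ← Real.log_exp (n * y n)]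
      exact Real.log_le_log (Real.exp_pos _) hn
    · filter_upwards [hu, hu', eventually_gt_atTop 0] with n hn hn' h0
      rw [div_le_iff₀ (by exact_mod_cast h0), mul_comm, ← Real.log_exp (n * x n)]
      exact Real.log_le_log ((Real.exp_pos _).trans_le hn') hn
  refine ((continuous_coe_real_ereal.tendsto l).comp hlog).congr' ?_
  filter_upwards [hu', eventually_gt_atTop 0] with n hn h0
  rw [ENNReal.log_ofReal_of_pos ((Real.exp_pos _).trans_le hn)]
  simp [EReal.coe_div]

theorem tendsto_log_succ_div (C : ℝ) :
    Tendsto (fun n : ℕ => C * (1 + Real.log ((n : ℝ) + 1)) / n) atTop (𝓝 0) := by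
  have h : Tendsto (fun x : ℝ => C * (1 + Real.log (x + 1)) / x) atTop (𝓝 0) := by
    have h1 : (fun x : ℝ => C * (1 + Real.log (x + 1))) =o[atTop] fun x : ℝ => x := by
      refine Asymptotics.IsLittleO.const_mul_left ?_ C
      refine Asymptotics.IsLittleO.add (Asymptotics.isLittleO_const_id_atTop 1) ?_
      have h2 : (fun x : ℝ => Real.log (x + 1)) =o[atTop] fun x : ℝ => x + 1 :=
        Real.isLittleO_log_id_atTop.comp_tendsto (tendsto_atTop_add_const_right _ 1 tendsto_id)
      refine h2.trans_isBigO (Asymptotics.IsBigO.of_bound 2 ?_)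
      filter_upwards [eventually_ge_atTop 1] with x hx
      rw [Real.norm_of_nonneg (by linarith), Real.norm_of_nonneg (by linarith)]
      linarith
    exact h1.tendsto_div_nhds_zero
  exact h.comp tendsto_natCast_atTop_atTop

theorem IsRounding.tendsto_div {q : ℕ} {ρ : ℕ → (Fin q → ℝ) → Fin q → ℕ} (hρ : IsRounding ρ)
    {α : Fin q → ℝ} (hα : α ∈ stdSimplex ℝ (Fin q)) (i : Fin q) :
    Tendsto (fun n : ℕ => (ρ n α i : ℝ) / n) atTop (𝓝 (α i)) := by
  rw [tendsto_iff_norm_sub_tendsto_zero]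
  refine squeeze_zero' (Eventually.of_forall fun n => norm_nonneg _) ?_
    (tendsto_one_div_atTop_nhds_zero_nat (𝕜 := ℝ))
  filter_upwards [eventually_gt_atTop 0] with n hn
  have hn' : (0 : ℝ) < n := by exact_mod_cast hn
  have h := ((hρ n α hα).2 i).le
  rw [Real.norm_eq_abs, show (ρ n α i : ℝ) / n - α i = (ρ n α i - n * α i) / n by field_simp,
    abs_div, abs_of_pos hn']
  gcongr

/-- The strict bound by 1 in the definition is what preserves zero coordinates; it lets the tilting
weights vanish where the phase does. -/
theorem IsRounding.eq_zero {q : ℕ} {ρ : ℕ → (Fin q → ℝ) → Fin q → ℕ} (hρ : IsRounding ρ)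
    {α : Fin q → ℝ} (hα : α ∈ stdSimplex ℝ (Fin q)) {i : Fin q} (h0 : α i = 0) (n : ℕ) :
    ρ n α i = 0 := by
  have h := (hρ n α hα).2 i
  rw [h0, mul_zero, sub_zero, Nat.abs_cast] at h
  exact_mod_cast Nat.lt_one_iff.1 (by exact_mod_cast h)

/-- The entropy of a vector. -/
noncomputable def entropy {ι : Type*} [Fintype ι] (α : ι → ℝ) : ℝ := ∑ i, Real.negMulLog (α i)

theorem tendsto_entropy {ι : Type*} [Fintype ι] {a : ℕ → ι → ℝ} {α : ι → ℝ}
    (h : ∀ i, Tendsto (fun n => a n i) atTop (𝓝 (α i))) :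
    Tendsto (fun n => entropy (a n)) atTop (𝓝 (entropy α)) :=
  tendsto_finsetSum _ fun i _ => (Real.continuous_negMulLog.tendsto _).comp (h i)

end Growth

/-! ### Integer tables with rounded margins. -/

section Table

open Filter Topology

variable {q : ℕ}

/-- The diagonal must stay untouched because for B = 0 the matrix vanishes there. For a = b the unit
of mass is routed around the diagonal as (a,k) - (l,k) + (l,a) with a, k, l distinct, hence three
colours. -/
theorem exists_zeroDiag_unit_margins (hq : 3 ≤ q) (a b : Fin q) :
    ∃ D : Fin q → Fin q → ℤ, (∀ i, D i i = 0) ∧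
      (∀ i, ∑ j, D i j = if i = a then 1 else 0) ∧ (∀ j, ∑ i, D i j = if j = b then 1 else 0) ∧
      ∀ i j, |D i j| ≤ 3 := by
  let U : Fin q → Fin q → Fin q → Fin q → ℤ := fun k l i j =>
    if i = k then (if j = l then 1 else 0) else 0
  have hU1 : ∀ k l i, ∑ j, U k l i j = if i = k then 1 else 0 := fun k l i => by
    by_cases h : i = k <;> simp [U, h]
  have hU2 : ∀ k l j, ∑ i, U k l i j = if j = l then 1 else 0 := fun k l j => by
    simp [U]
  have hU3 : ∀ k l i j, |U k l i j| ≤ 1 := fun k l i j => by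
    simp only [U]; split_ifs <;> simp
  have hU4 : ∀ k l, k ≠ l → ∀ i, U k l i i = 0 := fun k l h i => by
    simp only [U]; split_ifs with h1 h2
    · exact absurd (h1.symm.trans h2) h
    · rfl
    · rfl
  by_cases hab : a = b
  · subst hab
    obtain ⟨k, hk⟩ : ∃ k : Fin q, k ∉ ({a} : Finset (Fin q)) := by
      by_contra! h
      have := Finset.card_le_card (Finset.subset_iff.2 fun x (_ : x ∈ Finset.univ) => h x)
      simp at this
      omega
    obtain ⟨l, hl⟩ : ∃ l : Fin q, l ∉ ({a, k} : Finset (Fin q)) := by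
      by_contra! h
      have := (Finset.card_le_card (Finset.subset_iff.2 fun x (_ : x ∈ Finset.univ) => h x)).trans
        Finset.card_le_two
      simp at this
      omega
    simp only [Finset.mem_singleton, Finset.mem_insert, not_or] at hk hl
    refine ⟨fun i j => U a k i j - U l k i j + U l a i j, fun i => ?_, fun i => ?_, fun j => ?_,
      fun i j => ?_⟩
    · simp [hU4 a k (Ne.symm hk), hU4 l k hl.2, hU4 l a hl.1]
    · simp [Finset.sum_add_distrib, Finset.sum_sub_distrib, hU1]
    · simp [Finset.sum_add_distrib, Finset.sum_sub_distrib, hU2]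
    · have h1 := abs_le.1 (hU3 a k i j)
      have h2 := abs_le.1 (hU3 l k i j)
      have h3 := abs_le.1 (hU3 l a i j)
      rw [abs_le]
      constructor <;> linarith
  · exact ⟨U a b, hU4 a b hab, hU1 a b, hU2 a b, fun i j => (hU3 a b i j).trans (by norm_num)⟩

theorem exists_zeroDiag_margins (hq : 3 ≤ q) {r c : Fin q → ℤ} {R : ℤ}
    (hrc : ∑ i, r i = ∑ j, c j) (hr : ∀ i, |r i| ≤ R) (hc : ∀ j, |c j| ≤ R) :
    ∃ E : Fin q → Fin q → ℤ, (∀ i, E i i = 0) ∧ (∀ i, ∑ j, E i j = r i) ∧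
      (∀ j, ∑ i, E i j = c j) ∧ ∀ i j, |E i j| ≤ 9 * q * R := by
  choose D hD0 hD1 hD2 hD3 using fun a b => exists_zeroDiag_unit_margins hq a b
  have o : Fin q := ⟨0, by omega⟩
  have hR : ∀ (x y : ℤ), |x| ≤ R → |y| ≤ 3 → |x * y| ≤ R * 3 := fun x y hx hy => by
    rw [abs_mul]
    exact mul_le_mul hx hy (abs_nonneg _) ((abs_nonneg _).trans hx)
  -- Rows are corrected through column `o` and columns through row `o`; both corrections put the
  -- full total on the margin at `o`, and the last term removes it.
  refine ⟨fun i j => ∑ k, r k * D k o i j + ∑ k, c k * D o k i j - (∑ k, r k) * D o o i j,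
    fun i => ?_, fun i => ?_, fun j => ?_, fun i j => ?_⟩
  · simp [hD0]
  · rw [Finset.sum_sub_distrib, Finset.sum_add_distrib, Finset.sum_comm, ← Finset.mul_sum]
    rw [Finset.sum_comm (s := Finset.univ) (t := Finset.univ) (f := fun j k => c k * D o k i j)]
    simp only [← Finset.mul_sum, hD1]
    simp only [← Finset.sum_mul, hrc]
    simp
  · rw [Finset.sum_sub_distrib, Finset.sum_add_distrib, Finset.sum_comm, ← Finset.mul_sum]
    rw [Finset.sum_comm (s := Finset.univ) (t := Finset.univ) (f := fun i k => c k * D o k i j)]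
    simp only [← Finset.mul_sum, hD2]
    simp only [← Finset.sum_mul]
    simp
  · have h1 : |∑ k, r k * D k o i j| ≤ q * (R * 3) := by
      refine (Finset.abs_sum_le_sum_abs _ _).trans ?_
      refine (Finset.sum_le_card_nsmul _ _ (R * 3) fun k _ => hR _ _ (hr k) (hD3 _ _ _ _)).trans ?_
      simp
    have h2 : |∑ k, c k * D o k i j| ≤ q * (R * 3) := by
      refine (Finset.abs_sum_le_sum_abs _ _).trans ?_
      refine (Finset.sum_le_card_nsmul _ _ (R * 3) fun k _ => hR _ _ (hc k) (hD3 _ _ _ _)).trans ?_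
      simp
    have h3 : |(∑ k, r k) * D o o i j| ≤ q * (R * 3) := by
      rw [Finset.sum_mul]
      refine (Finset.abs_sum_le_sum_abs _ _).trans ?_
      refine (Finset.sum_le_card_nsmul _ _ (R * 3) fun k _ => hR _ _ (hr k) (hD3 _ _ _ _)).trans ?_
      simp
    have h1' := abs_le.1 h1
    have h2' := abs_le.1 h2
    have h3' := abs_le.1 h3
    rw [abs_le]
    constructor <;> linarith

/-- A nonnegative matrix whose off-diagonal entries are positive is the limit of the normalized
integer matrices with the rounded margins, with the same zero diagonal entries. -/
theorem exists_table (hq : 3 ≤ q) {ρ : ℕ → (Fin q → ℝ) → Fin q → ℕ} (hρ : IsRounding ρ)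
    {X : Fin q → Fin q → ℝ} (hX0 : ∀ i j, 0 ≤ X i j) (hX : ∀ i j, i ≠ j → 0 < X i j)
    {α β : Fin q → ℝ} (hα : α ∈ stdSimplex ℝ (Fin q)) (hβ : β ∈ stdSimplex ℝ (Fin q))
    (hXα : ∀ i, ∑ j, X i j = α i) (hXβ : ∀ j, ∑ i, X i j = β j) :
    ∃ N : ℕ → Fin q × Fin q → ℕ,
      (∀ᶠ n in atTop, (∀ i, ∑ j, N n (i, j) = ρ n α i) ∧ (∀ j, ∑ i, N n (i, j) = ρ n β j) ∧
        ∀ i, X i i = 0 → N n (i, i) = 0) ∧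
      ∀ e, Tendsto (fun n => (N n e : ℝ) / n) atTop (𝓝 (X e.1 e.2)) := by
  have hfl : ∀ (n : ℕ) i j, |(⌊n * X i j⌋ : ℝ) - n * X i j| ≤ 1 := fun n i j => by
    have h1 := Int.floor_le ((n : ℝ) * X i j)
    have h2 := Int.lt_floor_add_one ((n : ℝ) * X i j)
    rw [abs_le]
    constructor <;> linarith
  -- Flooring costs at most 1 in each of q entries and rounding the margin at most 1, so residual
  -- margins are at most q + 1. The correction is therefore bounded uniformly in n: it disappears
  -- after division by n, and `n * X i j` eventually outweighs it off the diagonal.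
  have hres : ∀ n : ℕ, ∃ E : Fin q → Fin q → ℤ, (∀ i, E i i = 0) ∧
      (∀ i, ∑ j, E i j = ρ n α i - ∑ j, ⌊n * X i j⌋) ∧
      (∀ j, ∑ i, E i j = ρ n β j - ∑ i, ⌊n * X i j⌋) ∧ ∀ i j, |E i j| ≤ 9 * q * (q + 1) := by
    intro n
    refine exists_zeroDiag_margins hq ?_ (fun i => ?_) (fun j => ?_)
    · rw [Finset.sum_sub_distrib, Finset.sum_sub_distrib, Finset.sum_comm]
      rw [← Nat.cast_sum, ← Nat.cast_sum, (hρ n α hα).1, (hρ n β hβ).1]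
    · have h1 := ((hρ n α hα).2 i).le
      have h2 : |∑ j, ((⌊n * X i j⌋ : ℝ) - n * X i j)| ≤ q := by
        refine (Finset.abs_sum_le_sum_abs _ _).trans ?_
        refine (Finset.sum_le_card_nsmul _ _ 1 fun j _ => hfl n i j).trans ?_
        simp
      rw [Finset.sum_sub_distrib, ← Finset.mul_sum, hXα] at h2
      have h1' := abs_le.1 h1
      have h2' := abs_le.1 h2
      have : |(ρ n α i : ℝ) - ∑ j, (⌊n * X i j⌋ : ℝ)| ≤ q + 1 := by
        rw [abs_le]
        constructor <;> linarith
      exact_mod_cast this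
    · have h1 := ((hρ n β hβ).2 j).le
      have h2 : |∑ i, ((⌊n * X i j⌋ : ℝ) - n * X i j)| ≤ q := by
        refine (Finset.abs_sum_le_sum_abs _ _).trans ?_
        refine (Finset.sum_le_card_nsmul _ _ 1 fun i _ => hfl n i j).trans ?_
        simp
      rw [Finset.sum_sub_distrib, ← Finset.mul_sum, hXβ] at h2
      have h1' := abs_le.1 h1
      have h2' := abs_le.1 h2
      have : |(ρ n β j : ℝ) - ∑ i, (⌊n * X i j⌋ : ℝ)| ≤ q + 1 := by
        rw [abs_le]
        constructor <;> linarith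
      exact_mod_cast this
  choose E hE0 hE1 hE2 hE3 using hres
  have hpos : ∀ᶠ n : ℕ in atTop, ∀ i j, 0 ≤ ⌊n * X i j⌋ + E n i j := by
    rw [eventually_all]
    intro i
    rw [eventually_all]
    intro j
    by_cases hij : i = j
    · subst hij
      refine Eventually.of_forall fun n => ?_
      rw [hE0, add_zero]
      exact Int.floor_nonneg.2 (mul_nonneg (Nat.cast_nonneg n) (hX0 i i))
    · have h1 : Tendsto (fun n : ℕ => (n : ℝ) * X i j) atTop atTop :=
        tendsto_natCast_atTop_atTop.atTop_mul_const (hX i j hij)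
      filter_upwards [h1.eventually_ge_atTop (9 * q * (q + 1) : ℤ)] with n hn
      have h2 := Int.le_floor.2 hn
      have h3 := (abs_le.1 (hE3 n i j)).1
      linarith
  have hcast : ∀ᶠ n : ℕ in atTop, ∀ i j,
      (((⌊n * X i j⌋ + E n i j).toNat : ℕ) : ℤ) = ⌊n * X i j⌋ + E n i j := by
    filter_upwards [hpos] with n hn i j
    exact Int.toNat_of_nonneg (hn i j)
  refine ⟨fun n e => (⌊n * X e.1 e.2⌋ + E n e.1 e.2).toNat, ?_, fun e => ?_⟩
  · filter_upwards [hcast] with n hn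
    refine ⟨fun i => ?_, fun j => ?_, fun i hi => ?_⟩
    · zify
      simp only [hn, Finset.sum_add_distrib, hE1]
      ring
    · zify
      simp only [hn, Finset.sum_add_distrib, hE2]
      ring
    · simp [hi, hE0]
  · rw [tendsto_iff_norm_sub_tendsto_zero]
    refine squeeze_zero' (Eventually.of_forall fun n => norm_nonneg _) ?_
      (tendsto_const_div_atTop_nhds_zero_nat (1 + 9 * q * (q + 1) : ℝ))
    filter_upwards [hcast, eventually_gt_atTop 0] with n hn h0
    have h0' : (0 : ℝ) < n := by exact_mod_cast h0
    have h1 : (((⌊n * X e.1 e.2⌋ + E n e.1 e.2).toNat : ℕ) : ℝ)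
        = ⌊n * X e.1 e.2⌋ + E n e.1 e.2 := by exact_mod_cast hn e.1 e.2
    rw [h1, Real.norm_eq_abs, show ((⌊n * X e.1 e.2⌋ : ℝ) + E n e.1 e.2) / n - X e.1 e.2
      = ((⌊n * X e.1 e.2⌋ - n * X e.1 e.2) + E n e.1 e.2) / n by field_simp; ring,
      abs_div, abs_of_pos h0']
    have h2 : |(E n e.1 e.2 : ℝ)| ≤ 9 * q * (q + 1) := by exact_mod_cast hE3 n e.1 e.2
    gcongr
    exact (abs_add_le _ _).trans (add_le_add (hfl n _ _) h2)

end Table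

/-! ### Bounds for Ψ₁ and its value at a scaling of the matrix. -/

section PsiBounds

open Filter Topology

variable {q Δ : ℕ} {M : Matrix (Fin q) (Fin q) ℝ} {ρ : ℕ → (Fin q → ℝ) → Fin q → ℕ}

theorem firstMoment_eq (hρ : IsRounding ρ) {p : (Fin q → ℝ) × (Fin q → ℝ)} (hp : p ∈ phaseSpace q)
    (n : ℕ) : 0 < ((typeClass n (ρ n p.1)).card : ℝ) ∧ 0 < ((typeClass n (ρ n p.2)).card : ℝ) ∧
    firstMoment Δ M ρ p n
      = Real.exp ((1 - Δ) * (Real.log (typeClass n (ρ n p.1)).card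
          + Real.log (typeClass n (ρ n p.2)).card)) * pairWeight n M (ρ n p.1) (ρ n p.2) ^ Δ := by
  have h1 : 0 < ((typeClass n (ρ n p.1)).card : ℝ) := by
    exact_mod_cast (typeClass_nonempty (hρ n p.1 hp.1).1).card_pos
  have h2 : 0 < ((typeClass n (ρ n p.2)).card : ℝ) := by
    exact_mod_cast (typeClass_nonempty (hρ n p.2 hp.2).1).card_pos
  refine ⟨h1, h2, ?_⟩
  have h3 := firstMoment_mul Δ M ρ p n
  rw [← Real.log_mul h1.ne' h2.ne', sub_mul, one_mul, Real.exp_sub, Real.exp_log (by positivity),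
    ← Real.log_pow, Real.exp_log (by positivity), div_mul_eq_mul_div, eq_div_iff (by positivity),
    h3]

/-- Weak duality for the entropy maximization hidden in the pair weight: each choice of tilting
weights gives a bound. The bounding sequence is kept explicit so that it can serve as the upper half
of a squeeze as well as bound the limsup. -/
theorem Psi1_le_and_eventually_le (hρ : IsRounding ρ) (hΔ : 1 ≤ Δ) (hM : ∀ i j, 0 ≤ M i j)
    {p : (Fin q → ℝ) × (Fin q → ℝ)} (hp : p ∈ phaseSpace q) {r c : Fin q → ℝ}
    (hr : ∀ i, 0 ≤ r i) (hc : ∀ i, 0 ≤ c i) (hr0 : ∀ i, r i = 0 → p.1 i = 0)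
    (hc0 : ∀ i, c i = 0 → p.2 i = 0) (hZ : 0 < ∑ i, ∑ j, r i * M i j * c j) :
    ∃ x : ℕ → ℝ, Tendsto x atTop (𝓝 ((1 - Δ) * (entropy p.1 + entropy p.2)
        + Δ * (Real.log (∑ i, ∑ j, r i * M i j * c j)
          - ∑ i, p.1 i * Real.log (r i) - ∑ j, p.2 j * Real.log (c j)))) ∧
      ∀ᶠ n in atTop, firstMoment Δ M ρ p n ≤ Real.exp (n * x n) := by
  set Z := ∑ i, ∑ j, r i * M i j * c j with hZdef
  let a : ℕ → Fin q → ℝ := fun n i => (ρ n p.1 i : ℝ) / n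
  let b : ℕ → Fin q → ℝ := fun n i => (ρ n p.2 i : ℝ) / n
  have ha : ∀ i, Tendsto (fun n => a n i) atTop (𝓝 (p.1 i)) := hρ.tendsto_div hp.1
  have hb : ∀ i, Tendsto (fun n => b n i) atTop (𝓝 (p.2 i)) := hρ.tendsto_div hp.2
  refine ⟨fun n => (1 - Δ) * (entropy (a n) + entropy (b n)
      - (2 * q : ℝ) * (1 + Real.log ((n : ℝ) + 1)) / n)
      + Δ * (Real.log Z - ∑ i, a n i * Real.log (r i) - ∑ j, b n j * Real.log (c j)), ?_, ?_⟩
  · refine Tendsto.add (Tendsto.const_mul _ ?_) (Tendsto.const_mul _ ?_)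
    · simpa using ((tendsto_entropy ha).add (tendsto_entropy hb)).sub (tendsto_log_succ_div (2 * q))
    · exact (tendsto_const_nhds.sub (tendsto_finsetSum _ fun i _ => (ha i).mul_const _)).sub
        (tendsto_finsetSum _ fun i _ => (hb i).mul_const _)
  · filter_upwards [eventually_gt_atTop 0] with n hn
    have hn' : (0 : ℝ) < n := by exact_mod_cast hn
    obtain ⟨-, -, h⟩ := firstMoment_eq (Δ := Δ) (M := M) hρ hp n
    have e1 := le_log_card_typeClass hn (hρ n p.1 hp.1).1
    have e2 := le_log_card_typeClass hn (hρ n p.2 hp.2).1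
    simp only [Fintype.card_fin] at e1 e2
    have hra : ∀ i, 0 < r i ^ ρ n p.1 i := fun i => by
      rcases (hr i).eq_or_lt with h0 | h0
      · simp [hρ.eq_zero hp.1 (hr0 i h0.symm) n]
      · positivity
    have hca : ∀ i, 0 < c i ^ ρ n p.2 i := fun i => by
      rcases (hc i).eq_or_lt with h0 | h0
      · simp [hρ.eq_zero hp.2 (hc0 i h0.symm) n]
      · positivity
    have hpw : pairWeight n M (ρ n p.1) (ρ n p.2)
        ≤ Real.exp (n * (Real.log Z - ∑ i, a n i * Real.log (r i)
          - ∑ j, b n j * Real.log (c j))) := by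
      have h1 := pairWeight_mul_le (n := n) hM (ρ n p.1) (ρ n p.2) hr hc
      rw [← le_div_iff₀ (mul_pos (Finset.prod_pos fun i _ => hra i)
        (Finset.prod_pos fun i _ => hca i))] at h1
      refine h1.trans (le_of_eq ?_)
      have hs : ∀ (k : Fin q → ℕ) (w : Fin q → ℝ), (∀ i, 0 < w i ^ k i) →
          ∏ i, w i ^ k i = Real.exp (n * ∑ i, (k i : ℝ) / n * Real.log (w i)) := by
        intro k w hw
        rw [Finset.mul_sum, Real.exp_sum]
        refine Finset.prod_congr rfl fun i _ => ?_
        rw [← Real.exp_log (hw i), Real.log_pow]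
        congr 1
        field_simp
      rw [hs _ r hra, hs _ c hca, ← hZdef, mul_sub, mul_sub, Real.exp_sub, Real.exp_sub,
        ← Real.log_pow, Real.exp_log (by positivity), div_div]
    rw [h]
    have hpw' := pow_le_pow_left₀ (pairWeight_nonneg hM _ _) hpw Δ
    rw [← Real.exp_nat_mul] at hpw'
    refine (mul_le_mul_of_nonneg_left hpw' (Real.exp_pos _).le).trans ?_
    rw [← Real.exp_add, Real.exp_le_exp]
    -- The class sizes enter with exponent 1 - Δ ≤ 0, so an upper bound for the moment requires the
    -- lower entropy bound for them.
    have hΔ' : (1 : ℝ) ≤ Δ := by exact_mod_cast hΔ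
    have e3 : (n : ℝ) * (entropy (a n) + entropy (b n)
        - (2 * q : ℝ) * (1 + Real.log ((n : ℝ) + 1)) / n)
        ≤ Real.log (typeClass n (ρ n p.1)).card + Real.log (typeClass n (ρ n p.2)).card := by
      have : (n : ℝ) * (entropy (a n) + entropy (b n)
          - (2 * q : ℝ) * (1 + Real.log ((n : ℝ) + 1)) / n)
          = n * entropy (a n) + n * entropy (b n) - 2 * q * (1 + Real.log ((n : ℝ) + 1)) := by
        field_simp
      rw [this]
      simp only [entropy, a, b]
      linarith
    nlinarith [mul_le_mul_of_nonneg_left e3 (sub_nonneg.2 hΔ')]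

theorem Psi1_le (hρ : IsRounding ρ) (hΔ : 1 ≤ Δ) (hM : ∀ i j, 0 ≤ M i j)
    {p : (Fin q → ℝ) × (Fin q → ℝ)} (hp : p ∈ phaseSpace q) {r c : Fin q → ℝ}
    (hr : ∀ i, 0 ≤ r i) (hc : ∀ i, 0 ≤ c i) (hr0 : ∀ i, r i = 0 → p.1 i = 0)
    (hc0 : ∀ i, c i = 0 → p.2 i = 0) (hZ : 0 < ∑ i, ∑ j, r i * M i j * c j) :
    Psi1 Δ M ρ p ≤ (((1 - Δ) * (entropy p.1 + entropy p.2)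
        + Δ * (Real.log (∑ i, ∑ j, r i * M i j * c j)
          - ∑ i, p.1 i * Real.log (r i) - ∑ j, p.2 j * Real.log (c j)) : ℝ) : EReal) := by
  obtain ⟨x, hx, h⟩ := Psi1_le_and_eventually_le hρ hΔ hM hp hr hc hr0 hc0 hZ
  exact expGrowthSup_le_of_tendsto hx h

/-- If `M` can be scaled to have margins `α` and `β`, then the scaling vectors give `Ψ₁`. -/
theorem Psi1_eq_of_scaling (hq : 3 ≤ q) (hρ : IsRounding ρ) (hΔ : 1 ≤ Δ) (hM : ∀ i j, 0 ≤ M i j)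
    (hM' : ∀ i j, i ≠ j → 0 < M i j) {p : (Fin q → ℝ) × (Fin q → ℝ)} (hp : p ∈ phaseSpace q)
    {x y : Fin q → ℝ} (hx : ∀ i, 0 < x i) (hy : ∀ i, 0 < y i)
    (hα : ∀ i, ∑ j, x i * M i j * y j = p.1 i) (hβ : ∀ j, ∑ i, x i * M i j * y j = p.2 j) :
    Psi1 Δ M ρ p = (((1 - Δ) * (entropy p.1 + entropy p.2)
        - Δ * (∑ i, p.1 i * Real.log (x i) + ∑ j, p.2 j * Real.log (y j)) : ℝ) : EReal) ∧
      FirstMomentLimitExists Δ M ρ p := by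
  have hZ : ∑ i, ∑ j, x i * M i j * y j = 1 := by
    simp only [hα]
    exact hp.1.2
  obtain ⟨u, hu, hle⟩ := Psi1_le_and_eventually_le (Δ := Δ) hρ hΔ hM hp (fun i => (hx i).le)
    (fun i => (hy i).le) (fun i h => absurd h (hx i).ne') (fun i h => absurd h (hy i).ne')
    (by rw [hZ]; norm_num)
  have hval : ((1 - Δ) * (entropy p.1 + entropy p.2)
        + Δ * (Real.log (∑ i, ∑ j, x i * M i j * y j)
          - ∑ i, p.1 i * Real.log (x i) - ∑ j, p.2 j * Real.log (y j)) : ℝ)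
      = (1 - Δ) * (entropy p.1 + entropy p.2)
        - Δ * (∑ i, p.1 i * Real.log (x i) + ∑ j, p.2 j * Real.log (y j)) := by
    rw [hZ, Real.log_one]
    ring
  rw [hval] at hu
  -- The scaled matrix itself is the joint type to approximate: its logarithm splits into row,
  -- column and interaction terms, so its entropy plus energy equals the dual bound.
  obtain ⟨N, hN, hNlim⟩ := exists_table hq hρ (X := fun i j => x i * M i j * y j)
    (fun i j => mul_nonneg (mul_nonneg (hx i).le (hM i j)) (hy j).le)
    (fun i j h => mul_pos (mul_pos (hx i) (hM' i j h)) (hy j)) hp.1 hp.2 hα hβ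
  let a : ℕ → Fin q → ℝ := fun n i => (ρ n p.1 i : ℝ) / n
  let b : ℕ → Fin q → ℝ := fun n i => (ρ n p.2 i : ℝ) / n
  let X : ℕ → Fin q × Fin q → ℝ := fun n e => (N n e : ℝ) / n
  have ha : ∀ i, Tendsto (fun n => a n i) atTop (𝓝 (p.1 i)) := hρ.tendsto_div hp.1
  have hb : ∀ i, Tendsto (fun n => b n i) atTop (𝓝 (p.2 i)) := hρ.tendsto_div hp.2
  let v : ℕ → ℝ := fun n => (1 - Δ) * (entropy (a n) + entropy (b n))
      + Δ * (entropy (X n) - ((q * q : ℕ) : ℝ) * (1 + Real.log ((n : ℝ) + 1)) / n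
        + ∑ e, X n e * Real.log (M e.1 e.2))
  have hv : Tendsto v atTop (𝓝 ((1 - Δ) * (entropy p.1 + entropy p.2)
        - Δ * (∑ i, p.1 i * Real.log (x i) + ∑ j, p.2 j * Real.log (y j)))) := by
    have h1 : Tendsto v atTop (𝓝 ((1 - Δ) * (entropy p.1 + entropy p.2)
        + Δ * (entropy (fun e : Fin q × Fin q => x e.1 * M e.1 e.2 * y e.2) - 0
        + ∑ e : Fin q × Fin q, x e.1 * M e.1 e.2 * y e.2 * Real.log (M e.1 e.2)))) := by
      refine Tendsto.add (((tendsto_entropy ha).add (tendsto_entropy hb)).const_mul _)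
        (Tendsto.const_mul _ (Tendsto.add (Tendsto.sub (tendsto_entropy hNlim)
          (tendsto_log_succ_div _)) (tendsto_finsetSum _ fun e _ => (hNlim e).mul_const _)))
    have h2 : entropy (fun e : Fin q × Fin q => x e.1 * M e.1 e.2 * y e.2) - 0
        + ∑ e : Fin q × Fin q, x e.1 * M e.1 e.2 * y e.2 * Real.log (M e.1 e.2)
        = -(∑ i, p.1 i * Real.log (x i) + ∑ j, p.2 j * Real.log (y j)) := by
      have h3 : ∀ e : Fin q × Fin q, Real.negMulLog (x e.1 * M e.1 e.2 * y e.2)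
          + x e.1 * M e.1 e.2 * y e.2 * Real.log (M e.1 e.2)
          = -(x e.1 * M e.1 e.2 * y e.2 * Real.log (x e.1)
            + x e.1 * M e.1 e.2 * y e.2 * Real.log (y e.2)) := by
        intro e
        rcases (hM e.1 e.2).eq_or_lt with h0 | h0
        · simp [← h0]
        · rw [Real.negMulLog, Real.log_mul (mul_pos (hx _) h0).ne' (hy _).ne',
            Real.log_mul (hx _).ne' h0.ne']
          ring
      rw [sub_zero, entropy, ← Finset.sum_add_distrib, Finset.sum_congr rfl fun e _ => h3 e,
        Finset.sum_neg_distrib, Finset.sum_add_distrib, Fintype.sum_prod_type,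
        Fintype.sum_prod_type_right]
      simp only [← Finset.sum_mul, hα, hβ]
    rw [h2] at h1
    convert h1 using 2
    ring
  have hge : ∀ᶠ n in atTop, Real.exp (n * v n) ≤ firstMoment Δ M ρ p n := by
    filter_upwards [hN, eventually_gt_atTop 0] with n hn h0
    obtain ⟨hNa, hNb, hNd⟩ := hn
    have hn' : (0 : ℝ) < n := by exact_mod_cast h0
    have hNsum : ∑ e, N n e = n := by
      rw [Fintype.sum_prod_type]
      simp only [hNa]
      exact (hρ n p.1 hp.1).1
    obtain ⟨-, -, h⟩ := firstMoment_eq (Δ := Δ) (M := M) hρ hp n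
    have e1 := log_card_typeClass_le h0 (hρ n p.1 hp.1).1
    have e2 := log_card_typeClass_le h0 (hρ n p.2 hp.2).1
    have e3 := le_log_card_typeClass h0 hNsum
    rw [Fintype.card_prod, Fintype.card_fin] at e3
    have hMN : ∀ e : Fin q × Fin q, M e.1 e.2 ^ N n e
        = Real.exp (n * (X n e * Real.log (M e.1 e.2))) := by
      intro e
      have hs : (n : ℝ) * (X n e * Real.log (M e.1 e.2)) = Real.log (M e.1 e.2 ^ N n e) := by
        rw [Real.log_pow]
        simp only [X]
        field_simp
      rw [hs, Real.exp_log]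
      -- A vanishing entry of M lies on the diagonal, where the table was kept at zero; the factor
      -- is 0 ^ 0 = 1, in agreement with `Real.log 0 = 0`.
      rcases (hM e.1 e.2).eq_or_lt with hz | hz
      · have hee : e.1 = e.2 := by
          by_contra hne
          exact (hM' _ _ hne).ne hz
        have : N n e = 0 := by
          have := hNd e.1 (by rw [hee] at hz ⊢; simp [← hz])
          rwa [show e = (e.1, e.1) from Prod.ext rfl hee.symm]
        simp [this]
      · positivity
    have hpw := card_typeClass_mul_le_pairWeight (n := n) hM hNa hNb
    have hcard : (0 : ℝ) < (typeClass n (N n)).card := by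
      exact_mod_cast (typeClass_nonempty hNsum).card_pos
    rw [← Real.exp_log hcard, Finset.prod_congr rfl fun e _ => hMN e, ← Real.exp_sum,
      ← Real.exp_add, ← Finset.mul_sum] at hpw
    have hpw' := pow_le_pow_left₀ (Real.exp_pos _).le hpw Δ
    rw [← Real.exp_nat_mul] at hpw'
    rw [h]
    refine le_trans ?_ (mul_le_mul_of_nonneg_left hpw' (Real.exp_pos _).le)
    rw [← Real.exp_add, Real.exp_le_exp]
    have hΔ' : (1 : ℝ) ≤ Δ := by exact_mod_cast hΔ
    have hv' : (n : ℝ) * v n = (1 - Δ) * (n * entropy (a n) + n * entropy (b n))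
        + Δ * ((n * entropy (X n) - ((q * q : ℕ) : ℝ) * (1 + Real.log ((n : ℝ) + 1)))
        + n * ∑ e, X n e * Real.log (M e.1 e.2)) := by
      simp only [v]
      field_simp
    rw [hv']
    have e4 : Real.log (typeClass n (ρ n p.1)).card + Real.log (typeClass n (ρ n p.2)).card
        ≤ n * entropy (a n) + n * entropy (b n) := add_le_add e1 e2
    have e5 : n * entropy (X n) - ((q * q : ℕ) : ℝ) * (1 + Real.log ((n : ℝ) + 1))
        ≤ Real.log (typeClass n (N n)).card := e3
    have e6 := mul_le_mul_of_nonneg_left e4 (sub_nonneg.2 hΔ')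
    have e7 := mul_le_mul_of_nonneg_left e5 (by linarith : (0 : ℝ) ≤ Δ)
    linarith
  have hlim := tendsto_log_div_of_tendsto hu hv hle hge
  have hPsi : Psi1 Δ M ρ p = (((1 - Δ) * (entropy p.1 + entropy p.2)
        - Δ * (∑ i, p.1 i * Real.log (x i) + ∑ j, p.2 j * Real.log (y j)) : ℝ) : EReal) :=
    hlim.limsup_eq
  refine ⟨hPsi, ?_⟩
  unfold FirstMomentLimitExists
  rw [hPsi]
  exact hlim

end PsiBounds

/-! ### Smooth dependence of the scaling on the margins. -/

section LocalScaling

open Filter Topology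

variable {q : ℕ}

/-- The margins of the matrix `x i * M i j * y j`, with a multiple of a normalization of `(x, y)`
added to the first one. -/
noncomputable def scalingMap (M : Matrix (Fin q) (Fin q) ℝ) (κ : ℝ)
    (z : (Fin q → ℝ) × (Fin q → ℝ)) : (Fin q → ℝ) × (Fin q → ℝ) :=
  (fun i => ∑ j, z.1 i * M i j * z.2 j + (∑ k, z.1 k - ∑ k, z.2 k - κ),
    fun j => ∑ i, z.1 i * M i j * z.2 j)

theorem contDiff_scalingMap (M : Matrix (Fin q) (Fin q) ℝ) (κ : ℝ) :
    ContDiff ℝ 2 (scalingMap M κ) := by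
  unfold scalingMap
  fun_prop

theorem fderiv_scalingMap (M : Matrix (Fin q) (Fin q) ℝ) (κ : ℝ)
    (z h : (Fin q → ℝ) × (Fin q → ℝ)) :
    fderiv ℝ (scalingMap M κ) z h
      = (fun i => ∑ j, (h.1 i * M i j * z.2 j + z.1 i * M i j * h.2 j)
            + (∑ k, h.1 k - ∑ k, h.2 k),
        fun j => ∑ i, (h.1 i * M i j * z.2 j + z.1 i * M i j * h.2 j)) := by
  have h1 : HasDerivAt (fun t : ℝ => scalingMap M κ (z + t • h))
      (fderiv ℝ (scalingMap M κ) z h) 0 := by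
    have hd : HasFDerivAt (scalingMap M κ) (fderiv ℝ (scalingMap M κ) z) (z + (0 : ℝ) • h) := by
      rw [zero_smul, add_zero]
      exact ((contDiff_scalingMap M κ).differentiable (by norm_num) z).hasFDerivAt
    have hl : HasDerivAt (fun t : ℝ => z + t • h) h 0 := by
      simpa using ((hasDerivAt_id (0 : ℝ)).smul_const h).const_add z
    exact hd.comp_hasDerivAt 0 hl
  have hx : ∀ i, HasDerivAt (fun t : ℝ => z.1 i + t * h.1 i) (h.1 i) 0 := fun i => by
    simpa using ((hasDerivAt_id (0 : ℝ)).mul_const (h.1 i)).const_add (z.1 i)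
  have hy : ∀ i, HasDerivAt (fun t : ℝ => z.2 i + t * h.2 i) (h.2 i) 0 := fun i => by
    simpa using ((hasDerivAt_id (0 : ℝ)).mul_const (h.2 i)).const_add (z.2 i)
  have hxy : ∀ i j, HasDerivAt (fun t : ℝ => (z.1 i + t * h.1 i) * M i j * (z.2 j + t * h.2 j))
      (h.1 i * M i j * z.2 j + z.1 i * M i j * h.2 j) 0 := fun i j => by
    simpa using ((hx i).mul_const (M i j)).fun_mul (hy j)
  refine Prod.ext (funext fun i => ?_) (funext fun j => ?_)
  · refine (hasDerivAt_pi.1 h1.fst i).unique ?_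
    exact (HasDerivAt.fun_sum fun j _ => hxy i j).add
      (((HasDerivAt.fun_sum fun k _ => hx k).sub (HasDerivAt.fun_sum fun k _ => hy k)).sub_const κ)
  · refine (hasDerivAt_pi.1 h1.snd j).unique ?_
    change HasDerivAt (fun t : ℝ => ∑ i, (z.1 i + t * h.1 i) * M i j * (z.2 j + t * h.2 j)) _ 0
    exact HasDerivAt.fun_sum fun i _ => hxy i j

/-- Row and column totals of a matrix agree, and (λx, y/λ) has the same margins as (x, y); the extra
term in the first component repairs both defects. On the kernel, summing margins kills this term,
and pairing the margin equations with h/x and h'/y makes a weighted sum of the squares (h_i/x_i +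
h'_j/y_j)² vanish. Only the infinitesimal rescaling survives, and the extra term excludes it. -/
theorem fderiv_scalingMap_injective (hq : 3 ≤ q) {M : Matrix (Fin q) (Fin q) ℝ}
    (hM : ∀ i j, 0 ≤ M i j) (hM' : ∀ i j, i ≠ j → 0 < M i j) (κ : ℝ)
    {z : (Fin q → ℝ) × (Fin q → ℝ)} (hx : ∀ i, 0 < z.1 i) (hy : ∀ i, 0 < z.2 i) :
    Function.Injective (fderiv ℝ (scalingMap M κ) z) := by
  rw [injective_iff_map_eq_zero]
  intro h h0
  rw [fderiv_scalingMap, Prod.ext_iff] at h0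
  have e1 : ∀ i, ∑ j, (h.1 i * M i j * z.2 j + z.1 i * M i j * h.2 j)
      + (∑ k, h.1 k - ∑ k, h.2 k) = 0 := fun i => congrFun h0.1 i
  have e2 : ∀ j, ∑ i, (h.1 i * M i j * z.2 j + z.1 i * M i j * h.2 j) = 0 :=
    fun j => congrFun h0.2 j
  have hκ : ∑ k, h.1 k - ∑ k, h.2 k = 0 := by
    have h3 := Finset.sum_congr (rfl : (Finset.univ : Finset (Fin q)) = _) fun i _ => e1 i
    rw [Finset.sum_add_distrib, Finset.sum_comm,
      Finset.sum_congr (rfl : (Finset.univ : Finset (Fin q)) = _) fun j _ => e2 j] at h3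
    simp only [Finset.sum_const_zero, zero_add, Finset.sum_const, Finset.card_univ,
      Fintype.card_fin, nsmul_eq_mul] at h3
    have hq' : (q : ℝ) ≠ 0 := by
      have : q ≠ 0 := by omega
      exact_mod_cast this
    exact (mul_eq_zero.1 h3).resolve_left hq'
  rw [hκ] at e1
  have hsq : ∑ i, ∑ j, z.1 i * M i j * z.2 j * (h.1 i / z.1 i + h.2 j / z.2 j) ^ 2 = 0 := by
    have h4 : ∀ i j, z.1 i * M i j * z.2 j * (h.1 i / z.1 i + h.2 j / z.2 j) ^ 2
        = h.1 i / z.1 i * (h.1 i * M i j * z.2 j + z.1 i * M i j * h.2 j)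
          + h.2 j / z.2 j * (h.1 i * M i j * z.2 j + z.1 i * M i j * h.2 j) := fun i j => by
      have := (hx i).ne'
      have := (hy j).ne'
      field_simp
    simp only [h4, Finset.sum_add_distrib]
    rw [Finset.sum_comm (f := fun i j =>
      h.2 j / z.2 j * (h.1 i * M i j * z.2 j + z.1 i * M i j * h.2 j))]
    simp only [← Finset.mul_sum, e2, mul_zero, Finset.sum_const_zero, add_zero]
    refine Finset.sum_eq_zero fun i _ => ?_
    rw [show ∑ j, (h.1 i * M i j * z.2 j + z.1 i * M i j * h.2 j) = 0 by simpa using e1 i, mul_zero]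
  have hnn : ∀ i j, 0 ≤ z.1 i * M i j * z.2 j * (h.1 i / z.1 i + h.2 j / z.2 j) ^ 2 := fun i j =>
    mul_nonneg (mul_nonneg (mul_nonneg (hx i).le (hM i j)) (hy j).le) (sq_nonneg _)
  have hopp : ∀ i j, i ≠ j → h.1 i / z.1 i = -(h.2 j / z.2 j) := by
    intro i j hij
    have h5 := (Finset.sum_eq_zero_iff_of_nonneg fun i _ =>
      Finset.sum_nonneg fun j _ => hnn i j).1 hsq i (Finset.mem_univ i)
    have h6 := (Finset.sum_eq_zero_iff_of_nonneg fun j _ => hnn i j).1 h5 j (Finset.mem_univ j)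
    have h7 := (mul_eq_zero.1 h6).resolve_left
      (mul_pos (mul_pos (hx i) (hM' i j hij)) (hy j)).ne'
    linarith [pow_eq_zero_iff (two_ne_zero) |>.1 h7]
  -- The relation is available only for i ≠ j; a third index links any two coordinates of the same
  -- side, which again needs q ≥ 3.
  have hthird : ∀ i k : Fin q, ∃ j, j ≠ i ∧ j ≠ k := by
    intro i k
    obtain ⟨l, hl⟩ : ∃ l : Fin q, l ∉ ({i, k} : Finset (Fin q)) := by
      by_contra! hall
      have := (Finset.card_le_card (Finset.subset_iff.2
        fun x (_ : x ∈ Finset.univ) => hall x)).trans Finset.card_le_two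
      simp at this
      omega
    simp only [Finset.mem_singleton, Finset.mem_insert, not_or] at hl
    exact ⟨l, hl⟩
  let o : Fin q := ⟨0, by omega⟩
  set c := h.1 o / z.1 o with hc
  have hδ : ∀ i, h.1 i = c * z.1 i := by
    intro i
    obtain ⟨j, hj1, hj2⟩ := hthird i o
    rw [hc, hopp o j hj2.symm, ← hopp i j hj1.symm, div_mul_cancel₀ _ (hx i).ne']
  have hε : ∀ j, h.2 j = -c * z.2 j := by
    intro j
    obtain ⟨i, hi, -⟩ := hthird j j
    have h8 := hopp i j hi
    rw [hδ i, mul_div_assoc, div_self (hx i).ne', mul_one] at h8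
    rw [h8, neg_neg, div_mul_cancel₀ _ (hy j).ne']
  have hc0 : c = 0 := by
    have h9 : c * (∑ k, z.1 k + ∑ k, z.2 k) = 0 := by
      rw [← hκ]
      simp only [hδ, hε, ← Finset.mul_sum]
      ring
    have : 0 < ∑ k, z.1 k + ∑ k, z.2 k :=
      add_pos (Finset.sum_pos (fun i _ => hx i) ⟨o, Finset.mem_univ o⟩)
        (Finset.sum_pos (fun i _ => hy i) ⟨o, Finset.mem_univ o⟩)
    exact (mul_eq_zero.1 h9).resolve_right this.ne'
  refine Prod.ext (funext fun i => ?_) (funext fun j => ?_)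
  · simp [hδ, hc0]
  · simp [hε, hc0]

/-- The scaling vectors depend smoothly on the margins. -/
theorem exists_local_scaling (hq : 3 ≤ q) {M : Matrix (Fin q) (Fin q) ℝ}
    (hM : ∀ i j, 0 ≤ M i j) (hM' : ∀ i j, i ≠ j → 0 < M i j) {p z : (Fin q → ℝ) × (Fin q → ℝ)}
    (hx : ∀ i, 0 < z.1 i) (hy : ∀ i, 0 < z.2 i)
    (hα : ∀ i, ∑ j, z.1 i * M i j * z.2 j = p.1 i)
    (hβ : ∀ j, ∑ i, z.1 i * M i j * z.2 j = p.2 j) :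
    ∃ f : (Fin q → ℝ) × (Fin q → ℝ) → (Fin q → ℝ) × (Fin q → ℝ),
      ContDiffAt ℝ 2 f p ∧ f p = z ∧ ∀ᶠ p' in 𝓝 p, ∑ i, p'.1 i = ∑ i, p'.2 i →
        (∀ i, 0 < (f p').1 i) ∧ (∀ i, 0 < (f p').2 i) ∧
        (∀ i, ∑ j, (f p').1 i * M i j * (f p').2 j = p'.1 i) ∧
        ∀ j, ∑ i, (f p').1 i * M i j * (f p').2 j = p'.2 j := by
  set κ := ∑ k, z.1 k - ∑ k, z.2 k with hκ
  have hGz : scalingMap M κ z = p := by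
    refine Prod.ext (funext fun i => ?_) (funext fun j => ?_)
    · simp [scalingMap, hα, hκ]
    · simp [scalingMap, hβ]
  have hcd : ContDiffAt ℝ 2 (scalingMap M κ) z := (contDiff_scalingMap M κ).contDiffAt
  have hinj := fderiv_scalingMap_injective hq hM hM' κ hx hy
  let e : ((Fin q → ℝ) × (Fin q → ℝ)) ≃L[ℝ] ((Fin q → ℝ) × (Fin q → ℝ)) :=
    (LinearEquiv.ofInjectiveEndo (fderiv ℝ (scalingMap M κ) z).toLinearMap hinj
      ).toContinuousLinearEquiv
  have he : HasFDerivAt (scalingMap M κ)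
      (e : ((Fin q → ℝ) × (Fin q → ℝ)) →L[ℝ] ((Fin q → ℝ) × (Fin q → ℝ))) z := by
    have : (e : ((Fin q → ℝ) × (Fin q → ℝ)) →L[ℝ] ((Fin q → ℝ) × (Fin q → ℝ)))
        = fderiv ℝ (scalingMap M κ) z :=
      ContinuousLinearMap.ext fun v => rfl
    rw [this]
    exact (hcd.differentiableAt (by norm_num)).hasFDerivAt
  have hs : HasStrictFDerivAt (scalingMap M κ)
      (e : ((Fin q → ℝ) × (Fin q → ℝ)) →L[ℝ] ((Fin q → ℝ) × (Fin q → ℝ))) z :=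
    hcd.hasStrictFDerivAt' he (by norm_num)
  have hfz : hcd.localInverse he (by norm_num) (scalingMap M κ z) = z :=
    hs.localInverse_apply_image
  have hsm := hcd.to_localInverse he (by norm_num)
  have hright : ∀ᶠ p' in 𝓝 (scalingMap M κ z),
      scalingMap M κ (hcd.localInverse he (by norm_num) p') = p' := hs.eventually_right_inverse
  rw [hGz] at hfz hsm hright
  refine ⟨hcd.localInverse he (by norm_num), hsm, hfz, ?_⟩
  have hcont := hsm.continuousAt
  rw [ContinuousAt, hfz] at hcont
  have hpos : ∀ᶠ p' in 𝓝 p, (∀ i, 0 < (hcd.localInverse he (by norm_num) p').1 i) ∧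
      ∀ i, 0 < (hcd.localInverse he (by norm_num) p').2 i := by
    rw [eventually_and, eventually_all, eventually_all]
    refine ⟨fun i => ?_, fun i => ?_⟩
    · exact hcont.eventually ((continuous_apply i).comp continuous_fst |>.tendsto z
        |>.eventually_const_lt (hx i))
    · exact hcont.eventually ((continuous_apply i).comp continuous_snd |>.tendsto z
        |>.eventually_const_lt (hy i))
  filter_upwards [hright, hpos] with p' h1 h2 h3
  set w := hcd.localInverse he (by norm_num) p'
  have h4 : ∀ i, ∑ j, w.1 i * M i j * w.2 j + (∑ k, w.1 k - ∑ k, w.2 k - κ) = p'.1 i :=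
    fun i => congrFun (congrArg Prod.fst h1) i
  have h5 : ∀ j, ∑ i, w.1 i * M i j * w.2 j = p'.2 j :=
    fun j => congrFun (congrArg Prod.snd h1) j
  -- The two margin totals differ by q times this term, so equal totals force it to vanish.
  have h6 : ∑ k, w.1 k - ∑ k, w.2 k - κ = 0 := by
    simp only [← h4, ← h5] at h3
    rw [Finset.sum_add_distrib, Finset.sum_comm] at h3
    simp only [Finset.sum_const, Finset.card_univ, Fintype.card_fin, nsmul_eq_mul] at h3
    have hq' : (q : ℝ) ≠ 0 := by
      have : q ≠ 0 := by omega
      exact_mod_cast this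
    exact (mul_eq_zero.1 (add_eq_left.1 h3)).resolve_left hq'
  exact ⟨h2.1, h2.2, fun i => by rw [← h4 i, h6, add_zero], h5⟩

/-- Near a pair of positive margins of a scaling of `M`, the function `Ψ₁` is smooth. -/
theorem exists_local_formula (hq : 3 ≤ q) {M : Matrix (Fin q) (Fin q) ℝ} {Δ : ℕ} (hΔ : 1 ≤ Δ)
    (hM : ∀ i j, 0 ≤ M i j) (hM' : ∀ i j, i ≠ j → 0 < M i j) {p z : (Fin q → ℝ) × (Fin q → ℝ)}
    (hx : ∀ i, 0 < z.1 i) (hy : ∀ i, 0 < z.2 i) (hp1 : ∀ i, p.1 i ≠ 0) (hp2 : ∀ i, p.2 i ≠ 0)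
    (hα : ∀ i, ∑ j, z.1 i * M i j * z.2 j = p.1 i)
    (hβ : ∀ j, ∑ i, z.1 i * M i j * z.2 j = p.2 j) :
    ∃ F : (Fin q → ℝ) × (Fin q → ℝ) → ℝ, ContDiffAt ℝ 2 F p ∧
      ∀ᶠ p' in 𝓝 p, p' ∈ phaseSpace q → ∀ ρ, IsRounding ρ →
        Psi1 Δ M ρ p' = (F p' : EReal) ∧ FirstMomentLimitExists Δ M ρ p' := by
  obtain ⟨f, hf, hfp, hloc⟩ := exists_local_scaling hq hM hM' hx hy hα hβ
  refine ⟨fun p' => (1 - Δ) * (entropy p'.1 + entropy p'.2)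
        - Δ * (∑ i, p'.1 i * Real.log ((f p').1 i) + ∑ j, p'.2 j * Real.log ((f p').2 j)), ?_, ?_⟩
  · have h1 : ∀ i, ContDiffAt ℝ 2 (fun p' : (Fin q → ℝ) × (Fin q → ℝ) => p'.1 i) p :=
      fun i => by fun_prop
    have h2 : ∀ i, ContDiffAt ℝ 2 (fun p' : (Fin q → ℝ) × (Fin q → ℝ) => p'.2 i) p :=
      fun i => by fun_prop
    have h3 : ∀ i, ContDiffAt ℝ 2 (fun p' => (f p').1 i) p :=
      fun i => (contDiffAt_pi.1 hf.fst) i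
    have h4 : ∀ i, ContDiffAt ℝ 2 (fun p' => (f p').2 i) p :=
      fun i => (contDiffAt_pi.1 hf.snd) i
    have h5 : ∀ {g : (Fin q → ℝ) × (Fin q → ℝ) → ℝ}, ContDiffAt ℝ 2 g p → g p ≠ 0 →
        ContDiffAt ℝ 2 (fun p' => Real.negMulLog (g p')) p := fun hg h0 => by
      unfold Real.negMulLog
      exact hg.neg.mul (hg.log h0)
    refine ContDiffAt.sub (contDiffAt_const.mul (ContDiffAt.add ?_ ?_))
      (contDiffAt_const.mul (ContDiffAt.add ?_ ?_))
    · exact ContDiffAt.sum fun i _ => h5 (h1 i) (hp1 i)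
    · exact ContDiffAt.sum fun i _ => h5 (h2 i) (hp2 i)
    · exact ContDiffAt.sum fun i _ => (h1 i).mul ((h3 i).log (by rw [hfp]; exact (hx i).ne'))
    · exact ContDiffAt.sum fun i _ => (h2 i).mul ((h4 i).log (by rw [hfp]; exact (hy i).ne'))
  · filter_upwards [hloc] with p' h hp' ρ hρ
    obtain ⟨g1, g2, g3, g4⟩ := h (by rw [hp'.1.2, hp'.2.2])
    exact Psi1_eq_of_scaling hq hρ hΔ hM hM' hp' g1 g2 g3 g4

end LocalScaling

/-! ### A second derivative test. -/

section SecondDerivative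

open Filter Topology

/-- The point would be both a local minimum and a local maximum, so the function would be locally
constant with zero second derivative. -/
theorem not_isLocalMin_of_deriv_deriv_neg {f : ℝ → ℝ} {x : ℝ} (h2 : deriv (deriv f) x < 0)
    (h1 : deriv f x = 0) (hc : ContinuousAt f x) : ¬ IsLocalMin f x := by
  intro hmin
  have hmax := isLocalMax_of_deriv_deriv_neg h2 h1 hc
  have heq : f =ᶠ[𝓝 x] fun _ => f x := by
    filter_upwards [hmin, hmax] with y hy hy'
    exact le_antisymm hy' hy
  have h3 : deriv f =ᶠ[𝓝 x] fun _ => 0 := by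
    simpa using heq.deriv
  have h4 := h3.deriv_eq
  simp only [deriv_const] at h4
  exact h2.ne h4

end SecondDerivative

/-! ### Geometric sums and the parameter of asymmetric critical points. -/

section GeomSum

/-- The polynomial `1 + t + ⋯ + t ^ (n - 1)`. -/
noncomputable def gsum (n : ℕ) (t : ℝ) : ℝ := ∑ k ∈ Finset.range n, t ^ k

theorem gsum_succ (n : ℕ) (t : ℝ) : gsum (n + 1) t = gsum n t + t ^ n :=
  Finset.sum_range_succ _ _

theorem gsum_succ' (n : ℕ) (t : ℝ) : gsum (n + 1) t = t * gsum n t + 1 :=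
  geom_sum_succ

theorem gsum_mul (n : ℕ) (t : ℝ) : gsum n t * (t - 1) = t ^ n - 1 :=
  geom_sum_mul t n

theorem gsum_one_right (n : ℕ) : gsum n 1 = n := by simp [gsum]

theorem gsum_nonneg (n : ℕ) {t : ℝ} (ht : 0 ≤ t) : 0 ≤ gsum n t :=
  Finset.sum_nonneg fun _ _ => pow_nonneg ht _

theorem gsum_pos {n : ℕ} (hn : 1 ≤ n) {t : ℝ} (ht : 0 ≤ t) : 0 < gsum n t := by
  obtain ⟨m, rfl⟩ : ∃ m, n = m + 1 := ⟨n - 1, by omega⟩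
  rw [gsum_succ']
  have := mul_nonneg ht (gsum_nonneg m ht)
  linarith

theorem continuous_gsum (n : ℕ) : Continuous (gsum n) := by
  unfold gsum
  fun_prop

/-- Log-concavity in the length: the two sides differ by exactly `t ^ n`. -/
theorem gsum_mul_gsum_le (n : ℕ) {t : ℝ} (ht : 0 ≤ t) :
    gsum n t * gsum (n + 2) t ≤ gsum (n + 1) t ^ 2 := by
  have h1 := gsum_succ' n t
  have h2 := gsum_succ' (n + 1) t
  have h3 := gsum_succ n t
  have h4 := pow_nonneg ht n
  have h5 : gsum n t * gsum (n + 2) t = gsum (n + 1) t ^ 2 - t ^ n := by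
    rw [show n + 2 = n + 1 + 1 from rfl, h2]
    have h6 : t ^ n = t * gsum n t + 1 - gsum n t := by linarith
    rw [h6, h1]
    ring
  linarith

/-- Log-concavity raised to a power carries the induction. The inequality says that `cycleParam`
stays below 1, which keeps minimizers off the boundary of the quadrant. -/
theorem gsum_pow_lt (e : ℕ) {t : ℝ} (ht : 0 < t) :
    gsum (e + 3) t ^ (e + 1) < gsum (e + 2) t ^ (e + 2) := by
  induction e with
  | zero =>
    norm_num [gsum, Finset.sum_range_succ]
    nlinarith
  | succ e ih =>
    have g2 : 0 < gsum (e + 2) t := gsum_pos (by omega) ht.le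
    have g3 : 0 < gsum (e + 3) t := gsum_pos (by omega) ht.le
    have g4 : 0 < gsum (e + 4) t := gsum_pos (by omega) ht.le
    have h1 : (gsum (e + 2) t * gsum (e + 4) t) ^ (e + 2) ≤ (gsum (e + 3) t ^ 2) ^ (e + 2) :=
      pow_le_pow_left₀ (mul_pos g2 g4).le (gsum_mul_gsum_le (e + 2) ht.le) _
    rw [mul_pow] at h1
    have h2 : (gsum (e + 3) t ^ 2) ^ (e + 2)
        = gsum (e + 3) t ^ (e + 3) * gsum (e + 3) t ^ (e + 1) := by ring
    have h3 : gsum (e + 3) t ^ (e + 3) * gsum (e + 3) t ^ (e + 1)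
        < gsum (e + 3) t ^ (e + 3) * gsum (e + 2) t ^ (e + 2) :=
      mul_lt_mul_of_pos_left ih (pow_pos g3 _)
    have h4 : gsum (e + 2) t ^ (e + 2) * gsum (e + 4) t ^ (e + 2)
        < gsum (e + 2) t ^ (e + 2) * gsum (e + 3) t ^ (e + 3) := by linarith
    exact lt_of_mul_lt_mul_left h4 (pow_pos g2 _).le

/-- AM-GM on the pairs k, d-1-k; the square in the argument makes the geometric means honest powers,
and the pair with k = 0 is strict. -/
theorem mul_pow_lt_gsum_sq {d : ℕ} (hd : 2 ≤ d) {s : ℝ} (hs : 1 < s) :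
    d * s ^ (d - 1) < gsum d (s ^ 2) := by
  have h1 : ∑ k ∈ Finset.range d, 2 * s ^ (d - 1)
      < ∑ k ∈ Finset.range d, ((s ^ 2) ^ k + (s ^ 2) ^ (d - 1 - k)) := by
    have hk : ∀ k ∈ Finset.range d, (s ^ 2) ^ k + (s ^ 2) ^ (d - 1 - k) - 2 * s ^ (d - 1)
        = (s ^ k - s ^ (d - 1 - k)) ^ 2 := by
      intro k hk
      rw [Finset.mem_range] at hk
      have : s ^ (d - 1) = s ^ k * s ^ (d - 1 - k) := by
        rw [← pow_add]
        congr 1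
        omega
      rw [this]
      ring
    refine Finset.sum_lt_sum (fun k hk' => ?_) ⟨0, Finset.mem_range.2 (by omega), ?_⟩
    · linarith [hk k hk', sq_nonneg (s ^ k - s ^ (d - 1 - k))]
    · have h0 := hk 0 (Finset.mem_range.2 (by omega))
      have h2 : 1 < s ^ (d - 1 - 0) := one_lt_pow₀ hs (by omega)
      have h3 : 0 < (s ^ 0 - s ^ (d - 1 - 0)) ^ 2 := by
        rw [pow_zero]
        nlinarith
      linarith
  rw [Finset.sum_add_distrib, Finset.sum_range_reflect (fun k => (s ^ 2) ^ k) d] at h1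
  simp only [Finset.sum_const, Finset.card_range, nsmul_eq_mul] at h1
  unfold gsum
  linarith

theorem sq_mul_pow_lt_gsum_sq {d : ℕ} (hd : 2 ≤ d) {t : ℝ} (ht : 1 < t) :
    (d : ℝ) ^ 2 * t ^ (d - 1) < gsum d t ^ 2 := by
  have hs : 1 < √t := Real.lt_sqrt_of_sq_lt (by simpa using ht)
  have hst : √t ^ 2 = t := Real.sq_sqrt (by linarith)
  have h := mul_pow_lt_gsum_sq hd hs
  rw [hst] at h
  have h2 := pow_lt_pow_left₀ h (by positivity) two_ne_zero
  calc (d : ℝ) ^ 2 * t ^ (d - 1) = (d * √t ^ (d - 1)) ^ 2 := by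
        rw [mul_pow, ← pow_mul, mul_comm (d - 1) 2, pow_mul, hst]
    _ < _ := h2

/-- The derivative of `gsum n`. -/
noncomputable def gsumDeriv (n : ℕ) (t : ℝ) : ℝ := ∑ k ∈ Finset.range n, k * t ^ (k - 1)

theorem hasDerivAt_gsum (n : ℕ) (t : ℝ) : HasDerivAt (gsum n) (gsumDeriv n t) t :=
  HasDerivAt.fun_sum fun k _ => hasDerivAt_pow k t

theorem gsumDeriv_mul (n : ℕ) (t : ℝ) :
    gsumDeriv n t * (t - 1) = n * t ^ (n - 1) - gsum n t := by
  induction n with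
  | zero => simp [gsumDeriv, gsum]
  | succ n ih =>
    have h1 : gsumDeriv (n + 1) t = gsumDeriv n t + n * t ^ (n - 1) := Finset.sum_range_succ _ _
    have h2 : (n : ℝ) * t ^ (n - 1) * t = n * t ^ n := by
      rcases n with _ | n
      · simp
      · rw [Nat.add_sub_cancel]
        ring
    rw [h1, add_mul, ih, gsum_succ, Nat.add_sub_cancel]
    push_cast
    linear_combination h2

/-- The parameter `K` for which the two-variable functional has a critical point `(X, t * X)`. -/
noncomputable def cycleParam (d : ℕ) (t : ℝ) : ℝ := gsum (d + 1) t ^ (d - 1) / gsum d t ^ d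

theorem cycleParam_pos {d : ℕ} (hd : 2 ≤ d) {t : ℝ} (ht : 0 ≤ t) : 0 < cycleParam d t :=
  div_pos (pow_pos (gsum_pos (by omega) ht) _) (pow_pos (gsum_pos (by omega) ht) _)

theorem cycleParam_lt_one {d : ℕ} (hd : 2 ≤ d) {t : ℝ} (ht : 0 < t) : cycleParam d t < 1 := by
  obtain ⟨e, rfl⟩ : ∃ e, d = e + 2 := ⟨d - 2, by omega⟩
  unfold cycleParam
  rw [div_lt_one (pow_pos (gsum_pos (by omega) ht.le) _)]
  exact gsum_pow_lt e ht

/-- The logarithmic derivative times (t-1) `gsum d t` `gsum (d+1) t` simplifies to `gsum d t` ^ 2 -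
d² t^(d-1), positive for t > 1 by AM-GM. -/
theorem cycleParam_strictMonoOn {d : ℕ} (hd : 2 ≤ d) :
    StrictMonoOn (cycleParam d) (Set.Ici 1) := by
  have hpos : ∀ t : ℝ, 1 ≤ t → 0 < gsum d t ∧ 0 < gsum (d + 1) t := fun t ht =>
    ⟨gsum_pos (by omega) (by linarith), gsum_pos (by omega) (by linarith)⟩
  have hd' : ((d - 1 : ℕ) : ℝ) = d - 1 := by
    rw [Nat.cast_sub (by omega), Nat.cast_one]
  have hlog : StrictMonoOn (fun t => ((d - 1 : ℕ) : ℝ) * Real.log (gsum (d + 1) t)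
      - d * Real.log (gsum d t)) (Set.Ici 1) := by
    refine strictMonoOn_of_deriv_pos (convex_Ici 1) ?_ ?_
    · refine ContinuousOn.sub (continuousOn_const.mul ?_) (continuousOn_const.mul ?_)
      · exact (continuous_gsum _).continuousOn.log fun t ht => (hpos t ht).2.ne'
      · exact (continuous_gsum _).continuousOn.log fun t ht => (hpos t ht).1.ne'
    · intro t ht
      rw [interior_Ici, Set.mem_Ioi] at ht
      obtain ⟨p1, p2⟩ := hpos t ht.le
      have hder := (((hasDerivAt_gsum (d + 1) t).log p2.ne').const_mul ((d - 1 : ℕ) : ℝ)).sub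
        (((hasDerivAt_gsum d t).log p1.ne').const_mul (d : ℝ))
      have e0 : deriv (fun t => ((d - 1 : ℕ) : ℝ) * Real.log (gsum (d + 1) t)
        - d * Real.log (gsum d t)) t = _ := hder.deriv
      rw [e0, hd']
      have e1 := gsumDeriv_mul (d + 1) t
      have e2 := gsumDeriv_mul d t
      have e3 := gsum_succ d t
      have e4 := gsum_mul d t
      have e5 := sq_mul_pow_lt_gsum_sq hd ht
      have e6 : t ^ d = t ^ (d - 1) * t := by
        rw [← pow_succ]
        congr 1
        omega
      rw [Nat.add_sub_cancel] at e1
      push_cast at e1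
      have key : ((d - 1 : ℝ) * (gsumDeriv (d + 1) t / gsum (d + 1) t)
          - d * (gsumDeriv d t / gsum d t)) * ((t - 1) * gsum d t * gsum (d + 1) t)
          = gsum d t ^ 2 - d ^ 2 * t ^ (d - 1) := by
        have : ((d - 1 : ℝ) * (gsumDeriv (d + 1) t / gsum (d + 1) t)
          - d * (gsumDeriv d t / gsum d t)) * ((t - 1) * gsum d t * gsum (d + 1) t)
          = (d - 1) * (gsumDeriv (d + 1) t * (t - 1)) * gsum d t
            - d * (gsumDeriv d t * (t - 1)) * gsum (d + 1) t := by
          field_simp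
        rw [this, e1, e2, e3, e6]
        rw [e6] at e4
        linear_combination (d : ℝ) ^ 2 * t ^ (d - 1) * e4
      by_contra hneg
      have hq : 0 < (t - 1) * gsum d t * gsum (d + 1) t :=
        mul_pos (mul_pos (by linarith) p1) p2
      have := mul_nonpos_of_nonpos_of_nonneg (not_lt.1 hneg) hq.le
      linarith
  intro s hs t ht hst
  have h := hlog hs ht hst
  have hexp : ∀ t : ℝ, 1 ≤ t → cycleParam d t = Real.exp (((d - 1 : ℕ) : ℝ)
      * Real.log (gsum (d + 1) t) - d * Real.log (gsum d t)) := fun t ht => by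
    obtain ⟨p1, p2⟩ := hpos t ht
    rw [Real.exp_sub, ← Real.log_pow, ← Real.log_pow, Real.exp_log (pow_pos p2 _),
      Real.exp_log (pow_pos p1 _), cycleParam]
  rw [hexp s hs, hexp t ht]
  exact Real.exp_lt_exp.2 h

end GeomSum

/-! ### Minimizers of the two-variable functional. -/

section PairFunctional

open Filter Topology

/-- The functional whose minimizers over the quadrant are the pairs `(x_i, y_i)` at a maximizer of
the bilinear form of the Potts matrix. -/
noncomputable def pairFun (d : ℕ) (K X Y : ℝ) : ℝ :=
  d / (d + 1) * (X ^ (d + 1) + Y ^ (d + 1)) + K * X ^ d * Y ^ d - X ^ d - Y ^ d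

theorem pairFun_comm (d : ℕ) (K X Y : ℝ) : pairFun d K X Y = pairFun d K Y X := by
  unfold pairFun
  ring

theorem bernoulli_pow (d : ℕ) {X : ℝ} (hX : 0 ≤ X) : 0 ≤ d * X ^ (d + 1) - (d + 1) * X ^ d + 1 := by
  induction d with
  | zero => simp
  | succ d ih =>
    have h1 : 0 ≤ (X ^ (d + 1) - 1) * (X - 1) := by
      rcases le_total 1 X with h | h
      · exact mul_nonneg (by linarith [one_le_pow₀ h (n := d + 1)]) (by linarith)
      · exact mul_nonneg_of_nonpos_of_nonpos (by linarith [pow_le_one₀ hX h (n := d + 1)])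
          (by linarith)
    have h2 := mul_nonneg hX ih
    push_cast
    have : ((d : ℝ) + 1) * X ^ (d + 1 + 1) - (d + 1 + 1) * X ^ (d + 1) + 1
      = (X ^ (d + 1) - 1) * (X - 1) + X * (d * X ^ (d + 1) - (d + 1) * X ^ d + 1) := by ring
    linarith

/-- Coercivity: each one-variable part is at least -1 everywhere and at least 1 beyond 3. Outside
the box [0,3]² the functional is thus at least 0, its value at the origin. -/
theorem exists_min_pairFun {d : ℕ} (hd : 1 ≤ d) {K : ℝ} (hK : 0 ≤ K) :
    ∃ X Y : ℝ, 0 ≤ X ∧ 0 ≤ Y ∧ ∀ X' Y' : ℝ, 0 ≤ X' → 0 ≤ Y' →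
      pairFun d K X Y ≤ pairFun d K X' Y' := by
  have hcont : Continuous fun z : ℝ × ℝ => pairFun d K z.1 z.2 := by
    unfold pairFun
    fun_prop
  obtain ⟨z, hz, hmin⟩ := (isCompact_Icc (a := (0 : ℝ)) (b := 3)).prod (isCompact_Icc (a := (0 : ℝ))
    (b := 3)) |>.exists_isMinOn ⟨(0, 0), by simp⟩ hcont.continuousOn
  have hd1 : (1 : ℝ) ≤ d := by exact_mod_cast hd
  have hsmall : ∀ x : ℝ, 0 ≤ x → -1 ≤ d / (d + 1) * x ^ (d + 1) - x ^ d := by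
    intro x hx
    have h := bernoulli_pow d hx
    have h1 : (d : ℝ) / (d + 1) * x ^ (d + 1) - x ^ d + 1 / (d + 1)
        = (d * x ^ (d + 1) - (d + 1) * x ^ d + 1) / (d + 1) := by
      field_simp
    have h2 : 0 ≤ (d * x ^ (d + 1) - (d + 1) * x ^ d + 1) / ((d : ℝ) + 1) := by positivity
    have h3 : 1 / ((d : ℝ) + 1) ≤ 1 := by
      rw [div_le_one (by positivity)]
      linarith
    linarith
  have hlarge : ∀ x : ℝ, 3 ≤ x → 1 ≤ d / (d + 1) * x ^ (d + 1) - x ^ d := by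
    intro x hx
    have h1 : (3 : ℝ) ≤ x ^ d := hx.trans (le_self_pow₀ (by linarith) (by omega))
    have h2 : (1 : ℝ) / 2 ≤ d / (d + 1) := by
      rw [div_le_div_iff₀ (by norm_num) (by positivity)]
      linarith
    have h3 : (d : ℝ) / (d + 1) * x ^ (d + 1) - x ^ d = (d / (d + 1) * x - 1) * x ^ d := by ring
    have h4 : (1 : ℝ) / 2 ≤ d / (d + 1) * x - 1 := by nlinarith
    rw [h3]
    nlinarith
  refine ⟨z.1, z.2, hz.1.1, hz.2.1, fun X' Y' hX' hY' => ?_⟩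
  have h0 : pairFun d K z.1 z.2 ≤ 0 := by
    have h := hmin (show ((0 : ℝ), (0 : ℝ)) ∈ _ by simp)
    have e : d ≠ 0 := by omega
    simpa [pairFun, e] using h
  have hKX : 0 ≤ K * X' ^ d * Y' ^ d := by positivity
  by_cases hX3 : X' ≤ 3
  · by_cases hY3 : Y' ≤ 3
    · exact hmin (show (X', Y') ∈ _ from ⟨⟨hX', hX3⟩, ⟨hY', hY3⟩⟩)
    · refine h0.trans ?_
      unfold pairFun
      linarith [hsmall X' hX', hlarge Y' (not_le.1 hY3).le]
  · refine h0.trans ?_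
    unfold pairFun
    linarith [hsmall Y' hY', hlarge X' (not_le.1 hX3).le]

theorem hasDerivAt_pairFun {d : ℕ} (hd : 1 ≤ d) (K X Y : ℝ) :
    HasDerivAt (fun x => pairFun d K x Y) (d * X ^ (d - 1) * (X + K * Y ^ d - 1)) X := by
  have h1 := hasDerivAt_pow (d + 1) X
  have h2 := hasDerivAt_pow d X
  have h3 := ((((h1.add_const (Y ^ (d + 1))).const_mul ((d : ℝ) / (d + 1))).fun_add
    ((h2.const_mul K).mul_const (Y ^ d))).fun_sub h2).sub_const (Y ^ d)
  refine h3.congr_deriv ?_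
  obtain ⟨e, rfl⟩ : ∃ e, d = e + 1 := ⟨d - 1, by omega⟩
  simp only [Nat.add_sub_cancel]
  push_cast
  field_simp
  ring

theorem pairFun_crit {d : ℕ} (hd : 1 ≤ d) {K X Y : ℝ} (hX : 0 < X)
    (hmin : ∀ X' : ℝ, 0 ≤ X' → pairFun d K X Y ≤ pairFun d K X' Y) : X + K * Y ^ d = 1 := by
  have hloc : IsLocalMin (fun x => pairFun d K x Y) X := by
    filter_upwards [lt_mem_nhds hX] with x hx
    exact hmin x hx.le
  have h := hloc.hasDerivAt_eq_zero (hasDerivAt_pairFun hd K X Y)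
  have hne : (d : ℝ) * X ^ (d - 1) ≠ 0 := by
    have : (d : ℝ) ≠ 0 := by
      have : d ≠ 0 := by omega
      exact_mod_cast this
    positivity
  linarith [(mul_eq_zero.1 h).resolve_left hne]

/-- At the origin, (1, 0) does better. At (0, Y) with Y > 0 criticality gives Y = 1, and moving X to
1 - K, the critical abscissa for Y = 1, lowers the value since K < 1. -/
theorem pairFun_min_pos {d : ℕ} (hd : 1 ≤ d) {K X Y : ℝ} (hK1 : K < 1) (hX : 0 ≤ X) (hY : 0 ≤ Y)
    (hmin : ∀ X' Y' : ℝ, 0 ≤ X' → 0 ≤ Y' → pairFun d K X Y ≤ pairFun d K X' Y') : 0 < X := by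
  have hd0 : d ≠ 0 := by omega
  by_contra hX0
  obtain rfl : X = 0 := le_antisymm (not_lt.1 hX0) hX
  have hd1 : (d : ℝ) / (d + 1) < 1 := by
    rw [div_lt_one (by positivity)]
    linarith
  rcases hY.eq_or_lt with hY0 | hY0
  · have h := hmin 1 0 zero_le_one le_rfl
    rw [← hY0] at h
    simp [pairFun, hd0] at h
    linarith
  · have hY1 : Y = 1 := by
      have h := pairFun_crit (K := K) (X := Y) (Y := 0) hd hY0 fun Y' hY' => by
        rw [pairFun_comm, pairFun_comm d K Y']
        exact hmin 0 Y' le_rfl hY'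
      simpa [hd0] using h
    subst hY1
    have h := hmin (1 - K) 1 (by linarith) zero_le_one
    have e : pairFun d K (1 - K) 1 - pairFun d K 0 1
        = (1 - K) ^ (d + 1) * (d / (d + 1) - 1) := by
      unfold pairFun
      simp [hd0]
      ring
    have hp : 0 < (1 - K) ^ (d + 1) := pow_pos (by linarith) _
    nlinarith

theorem strictMono_add_mul_pow {d : ℕ} {K c c' : ℝ} (hK : 0 ≤ K) (hc : 0 ≤ c)
    (h : c < c') : c + K * c ^ d < c' + K * c' ^ d := by
  have := mul_le_mul_of_nonneg_left (pow_le_pow_left₀ hc h.le d) hK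
  linarith

/-- The ordered asymmetric critical point of the pair functional. -/
theorem crit_eq_cycle {d : ℕ} (hd : 2 ≤ d) {K X Y : ℝ} (hX : 0 < X) (hXY : X < Y)
    (h1 : X + K * Y ^ d = 1) (h2 : Y + K * X ^ d = 1) :
    ∃ t : ℝ, 1 < t ∧ X = gsum d t / gsum (d + 1) t ∧ Y = t * X ∧ K = cycleParam d t := by
  have ht : 1 < Y / X := by rwa [one_lt_div hX]
  have hY : Y = Y / X * X := by field_simp
  set t := Y / X
  rw [hY] at h1 h2
  have g1 : 0 < gsum d t := gsum_pos (by omega) (by linarith)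
  have g2 : 0 < gsum (d + 1) t := gsum_pos (by omega) (by linarith)
  have hXe : X = gsum d t / gsum (d + 1) t := by
    rw [eq_div_iff g2.ne']
    have e1 := gsum_mul d t
    have e2 := gsum_mul (d + 1) t
    have ht1 : t - 1 ≠ 0 := by linarith
    apply mul_right_cancel₀ ht1
    rw [mul_assoc, e1, e2]
    rw [mul_pow] at h1
    -- Eliminating K leaves X (t^(d+1) - 1) = t^d - 1.
    linear_combination t ^ d * h2 - h1
  refine ⟨t, ht, hXe, hY, ?_⟩
  have hK : K * X ^ d = 1 / gsum (d + 1) t := by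
    have e3 := gsum_succ' d t
    have : K * X ^ d = 1 - t * X := by linarith
    rw [this, hXe]
    field_simp
    linarith
  unfold cycleParam
  rw [eq_div_iff (pow_pos g1 d).ne']
  rw [hXe, div_pow] at hK
  obtain ⟨e, rfl⟩ : ∃ e, d = e + 1 := ⟨d - 1, by omega⟩
  have e4 : gsum (e + 1 + 1) t ^ (e + 1) = gsum (e + 1 + 1) t ^ e * gsum (e + 1 + 1) t :=
    pow_succ _ _
  rw [Nat.add_sub_cancel]
  rw [mul_div_assoc', div_eq_div_iff (pow_pos g2 _).ne' g2.ne', e4] at hK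
  apply mul_right_cancel₀ g2.ne'
  linarith

theorem cycle_crit {d : ℕ} (hd : 2 ≤ d) {t : ℝ} (ht : 1 ≤ t) :
    gsum d t / gsum (d + 1) t
        + cycleParam d t * (t * (gsum d t / gsum (d + 1) t)) ^ d = 1 ∧
      t * (gsum d t / gsum (d + 1) t) + cycleParam d t * (gsum d t / gsum (d + 1) t) ^ d = 1 := by
  have g1 : 0 < gsum d t := gsum_pos (by omega) (by linarith)
  have g2 : 0 < gsum (d + 1) t := gsum_pos (by omega) (by linarith)
  have hK : cycleParam d t * (gsum d t / gsum (d + 1) t) ^ d = 1 / gsum (d + 1) t := by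
    obtain ⟨e, rfl⟩ : ∃ e, d = e + 1 := ⟨d - 1, by omega⟩
    unfold cycleParam
    rw [Nat.add_sub_cancel, div_pow, pow_succ (gsum (e + 1 + 1) t)]
    field_simp
  constructor
  · have e3 := gsum_succ d t
    have : cycleParam d t * (t * (gsum d t / gsum (d + 1) t)) ^ d
        = t ^ d * (cycleParam d t * (gsum d t / gsum (d + 1) t) ^ d) := by
      rw [mul_pow]
      ring
    rw [this, hK]
    field_simp
    linarith
  · have e3 := gsum_succ' d t
    rw [hK]
    field_simp
    linarith

/-- Past the critical parameter, the symmetric critical point is not a minimizer. -/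
theorem not_min_diag {d : ℕ} (hd : 2 ≤ d) {K X : ℝ} (hX : 0 < X)
    (hc : X + K * X ^ d = 1) (hlt : (d + 1) * X < d)
    (hmin : ∀ X' Y' : ℝ, 0 ≤ X' → 0 ≤ Y' → pairFun d K X X ≤ pairFun d K X' Y') : False := by
  obtain ⟨e, rfl⟩ : ∃ e, d = e + 2 := ⟨d - 2, by omega⟩
  -- The antidiagonal is the unstable direction: the second derivative of `ψ` at 0 is 2d X^(d-2)
  -- ((d+1)X - d), where d = e + 2.
  let ψ : ℝ → ℝ := fun ε => pairFun (e + 2) K (X + ε) (X - ε)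
  let ψ' : ℝ → ℝ := fun ε => (e + 2) * ((X + ε) ^ (e + 2) - (X - ε) ^ (e + 2))
    - (e + 2) * ((X + ε) ^ (e + 1) - (X - ε) ^ (e + 1))
    - 2 * (e + 2) * K * ε * ((X + ε) ^ (e + 1) * (X - ε) ^ (e + 1))
  have hp : ∀ ε, HasDerivAt (fun ε => X + ε) 1 ε := fun ε => (hasDerivAt_id ε).const_add X
  have hm : ∀ ε, HasDerivAt (fun ε => X - ε) (-1) ε := fun ε => (hasDerivAt_id ε).const_sub X
  have hψ : ∀ ε, HasDerivAt ψ (ψ' ε) ε := by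
    intro ε
    have h := ((((((hp ε).fun_pow (e + 2 + 1)).fun_add ((hm ε).fun_pow (e + 2 + 1))).const_mul
      (((e + 2 : ℕ) : ℝ) / ((e + 2 : ℕ) + 1))).fun_add
      ((((hp ε).fun_pow (e + 2)).const_mul K).fun_mul ((hm ε).fun_pow (e + 2)))).fun_sub
      ((hp ε).fun_pow (e + 2))).fun_sub ((hm ε).fun_pow (e + 2))
    refine h.congr_deriv ?_
    simp only [ψ', Nat.add_sub_cancel, show e + 2 - 1 = e + 1 from rfl]
    push_cast
    field_simp
    ring
  have hψ0 : HasDerivAt ψ' (2 * (e + 2) * X ^ e * ((e + 2 + 1) * X - (e + 2))) 0 := by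
    have h := ((((hp 0).fun_pow (e + 2)).fun_sub ((hm 0).fun_pow (e + 2))).const_mul
      ((e : ℝ) + 2)).fun_sub ((((hp 0).fun_pow (e + 1)).fun_sub ((hm 0).fun_pow (e + 1))).const_mul
      ((e : ℝ) + 2)) |>.fun_sub (((hasDerivAt_id (0 : ℝ)).const_mul (2 * ((e : ℝ) + 2) * K)).fun_mul
      (((hp 0).fun_pow (e + 1)).fun_mul ((hm 0).fun_pow (e + 1))))
    refine h.congr_deriv ?_
    simp only [id_eq, add_zero, sub_zero, mul_zero, zero_mul, Nat.add_sub_cancel,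
      show e + 2 - 1 = e + 1 from rfl]
    push_cast
    have hc' : K * X ^ (e + 2) = 1 - X := by linarith
    linear_combination (-2 * ((e : ℝ) + 2) * X ^ e) * hc'
  have hderiv : deriv ψ = ψ' := funext fun ε => (hψ ε).deriv
  refine not_isLocalMin_of_deriv_deriv_neg (f := ψ) (x := 0) ?_ ?_ (hψ 0).continuousAt ?_
  · rw [hderiv, hψ0.deriv]
    push_cast at hlt
    exact mul_neg_of_pos_of_neg (by positivity) (by linarith)
  · rw [hderiv]
    simp [ψ']
  · have h1 : ∀ᶠ ε : ℝ in 𝓝 0, -X < ε := lt_mem_nhds (by linarith)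
    have h2 : ∀ᶠ ε : ℝ in 𝓝 0, ε < X := gt_mem_nhds hX
    filter_upwards [h1, h2] with ε h1 h2
    simp only [ψ, add_zero, sub_zero]
    exact hmin _ _ (by linarith) (by linarith)

/-- A minimizer is interior, hence critical. An asymmetric one would force K = `cycleParam d t` with
t > 1, which exceeds `cycleParam d 1`; on the diagonal, c + K c^d is strictly increasing and the
root is unique. -/
theorem eq_diag_of_min {d : ℕ} (hd : 2 ≤ d) {K c X Y : ℝ} (hK : 0 < K)
    (hK1 : K ≤ cycleParam d 1) (hc : 0 ≤ c) (hcK : c + K * c ^ d = 1) (hX : 0 ≤ X) (hY : 0 ≤ Y)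
    (hmin : ∀ X' Y' : ℝ, 0 ≤ X' → 0 ≤ Y' → pairFun d K X Y ≤ pairFun d K X' Y') :
    X = c ∧ Y = c := by
  have hKlt : K < 1 := hK1.trans_lt (cycleParam_lt_one hd one_pos)
  have hmin' : ∀ X' Y' : ℝ, 0 ≤ X' → 0 ≤ Y' → pairFun d K Y X ≤ pairFun d K X' Y' :=
    fun X' Y' h1 h2 => by
      rw [pairFun_comm, pairFun_comm d K X']
      exact hmin Y' X' h2 h1
  have hX0 := pairFun_min_pos (by omega) hKlt hX hY hmin
  have hY0 := pairFun_min_pos (by omega) hKlt hY hX hmin'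
  have c1 := pairFun_crit (by omega) hX0 fun X' h => hmin X' Y h hY
  have c2 := pairFun_crit (by omega) hY0 fun Y' h => hmin' Y' X h hX
  have hno : ∀ t : ℝ, 1 < t → K ≠ cycleParam d t := fun t ht h => by
    have := cycleParam_strictMonoOn hd (Set.mem_Ici.2 le_rfl) (Set.mem_Ici.2 ht.le) ht
    linarith
  have heq : X = Y := by
    rcases lt_trichotomy X Y with h | h | h
    · obtain ⟨t, ht, -, -, hKt⟩ := crit_eq_cycle hd hX0 h c1 c2
      exact absurd hKt (hno t ht)
    · exact h
    · obtain ⟨t, ht, -, -, hKt⟩ := crit_eq_cycle hd hY0 h c2 c1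
      exact absurd hKt (hno t ht)
  subst heq
  have hXc : X = c := by
    rcases lt_trichotomy X c with h | h | h
    · linarith [strictMono_add_mul_pow (d := d) hK.le hX0.le h]
    · exact h
    · linarith [strictMono_add_mul_pow (d := d) hK.le hc h]
  exact ⟨hXc, hXc⟩

theorem eq_cycle_of_min {d : ℕ} (hd : 2 ≤ d) {t X Y : ℝ} (ht : 1 < t) (hX : 0 ≤ X) (hY : 0 ≤ Y)
    (hmin : ∀ X' Y' : ℝ, 0 ≤ X' → 0 ≤ Y' →
      pairFun d (cycleParam d t) X Y ≤ pairFun d (cycleParam d t) X' Y') :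
    (X = gsum d t / gsum (d + 1) t ∧ Y = t * (gsum d t / gsum (d + 1) t)) ∨
      (X = t * (gsum d t / gsum (d + 1) t) ∧ Y = gsum d t / gsum (d + 1) t) := by
  have hK := cycleParam_pos hd (t := t) (by linarith)
  have hKlt := cycleParam_lt_one hd (t := t) (by linarith)
  have hmin' : ∀ X' Y' : ℝ, 0 ≤ X' → 0 ≤ Y' →
      pairFun d (cycleParam d t) Y X ≤ pairFun d (cycleParam d t) X' Y' :=
    fun X' Y' h1 h2 => by
      rw [pairFun_comm, pairFun_comm d _ X']
      exact hmin Y' X' h2 h1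
  have hX0 := pairFun_min_pos (by omega) hKlt hX hY hmin
  have hY0 := pairFun_min_pos (by omega) hKlt hY hX hmin'
  have c1 := pairFun_crit (by omega) hX0 fun X' h => hmin X' Y h hY
  have c2 := pairFun_crit (by omega) hY0 fun Y' h => hmin' Y' X h hX
  have hinj : ∀ t' : ℝ, 1 < t' → cycleParam d t = cycleParam d t' → t' = t := fun t' ht' h =>
    ((cycleParam_strictMonoOn hd).injOn (Set.mem_Ici.2 ht.le) (Set.mem_Ici.2 ht'.le) h).symm
  rcases lt_trichotomy X Y with h | h | h
  · obtain ⟨t', ht', e1, e2, hKt⟩ := crit_eq_cycle hd hX0 h c1 c2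
    obtain rfl := hinj t' ht' hKt
    left
    rw [← e1]
    exact ⟨rfl, e2⟩
  · exfalso
    subst h
    refine not_min_diag hd hX0 c1 ?_ hmin
    -- At K = `cycleParam d 1` the diagonal root is d/(d+1); a larger K pushes it strictly lower,
    -- into the unstable range.
    by_contra hge
    have hd0 : (0 : ℝ) < d + 1 := by positivity
    have h1 := (cycle_crit hd (le_refl (1 : ℝ))).1
    rw [one_mul, gsum_one_right, gsum_one_right] at h1
    push_cast at h1
    have h2 : (d : ℝ) / (d + 1) ≤ X := by
      rw [div_le_iff₀ hd0]
      linarith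
    have h3 := cycleParam_strictMonoOn hd (Set.mem_Ici.2 le_rfl) (Set.mem_Ici.2 ht.le) ht
    have h4 : cycleParam d 1 * (d / (d + 1) : ℝ) ^ d < cycleParam d t * X ^ d := by
      have hpos : (0 : ℝ) < (d / (d + 1) : ℝ) ^ d := by
        have : (0 : ℝ) < d := by exact_mod_cast (by omega : 0 < d)
        positivity
      calc _ < cycleParam d t * (d / (d + 1) : ℝ) ^ d := mul_lt_mul_of_pos_right h3 hpos
        _ ≤ _ := mul_le_mul_of_nonneg_left (pow_le_pow_left₀ (by positivity) h2 d) hK.le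
    linarith
  · obtain ⟨t', ht', e1, e2, hKt⟩ := crit_eq_cycle hd hY0 h c2 c1
    obtain rfl := hinj t' ht' hKt
    right
    rw [← e1]
    exact ⟨e2, rfl⟩

/-- Up to the critical parameter, the diagonal critical point is the unique minimizer. -/
theorem pairFun_diag_min {d : ℕ} (hd : 2 ≤ d) {K c : ℝ} (hK : 0 < K)
    (hK1 : K ≤ cycleParam d 1) (hc : 0 ≤ c) (hcK : c + K * c ^ d = 1) {X Y : ℝ} (hX : 0 ≤ X)
    (hY : 0 ≤ Y) : pairFun d K c c ≤ pairFun d K X Y ∧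
      (pairFun d K X Y = pairFun d K c c → X = c ∧ Y = c) := by
  obtain ⟨X₀, Y₀, hX₀, hY₀, hmin⟩ := exists_min_pairFun (d := d) (by omega) hK.le
  obtain ⟨rfl, rfl⟩ := eq_diag_of_min hd hK hK1 hc hcK hX₀ hY₀ hmin
  refine ⟨hmin X Y hX hY, fun h => eq_diag_of_min hd hK hK1 hc hcK hX hY ?_⟩
  rw [h]
  exact hmin

/-- Past the critical parameter, the asymmetric critical points are the only minimizers. -/
theorem pairFun_cycle_min {d : ℕ} (hd : 2 ≤ d) {t X₁ Y₁ : ℝ} (ht : 1 < t)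
    (hX₁ : X₁ = gsum d t / gsum (d + 1) t) (hY₁ : Y₁ = t * X₁) {X Y : ℝ} (hX : 0 ≤ X)
    (hY : 0 ≤ Y) : pairFun d (cycleParam d t) X₁ Y₁ ≤ pairFun d (cycleParam d t) X Y ∧
      (pairFun d (cycleParam d t) X Y = pairFun d (cycleParam d t) X₁ Y₁ →
        (X = X₁ ∧ Y = Y₁) ∨ (X = Y₁ ∧ Y = X₁)) := by
  obtain ⟨X₀, Y₀, hX₀, hY₀, hmin⟩ := exists_min_pairFun (d := d) (by omega)
    (cycleParam_pos hd (t := t) (by linarith)).le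
  have hval : pairFun d (cycleParam d t) X₁ Y₁ = pairFun d (cycleParam d t) X₀ Y₀ := by
    subst hY₁
    subst hX₁
    rcases eq_cycle_of_min hd ht hX₀ hY₀ hmin with ⟨h1, h2⟩ | ⟨h1, h2⟩
    · rw [← h2, ← h1]
    · rw [← h1, ← h2, pairFun_comm]
  rw [hval]
  refine ⟨hmin X Y hX hY, fun h => ?_⟩
  subst hY₁
  subst hX₁
  refine eq_cycle_of_min hd ht hX hY ?_
  rw [h]
  exact hmin

end PairFunctional

/-! ### Quadratic decay and negative definiteness. -/

section Hessian

open Filter Topology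

/-- On the line through h, the function -F - ε‖h‖²t² has a local minimum at 0. Were the Hessian
nonnegative along h, its second derivative would be strictly negative there. -/
theorem fderiv_fderiv_neg_of_quadratic_decay {E : Type*} [NormedAddCommGroup E] [NormedSpace ℝ E]
    {F : E → ℝ} (hF : ContDiffAt ℝ 2 F 0) {ε : ℝ} (hε : 0 < ε)
    (hdecay : ∀ᶠ h in 𝓝 (0 : E), F h ≤ F 0 - ε * ‖h‖ ^ 2) {h : E} (hh : h ≠ 0) :
    fderiv ℝ (fderiv ℝ F) 0 h h < 0 := by
  have hline : ∀ t : ℝ, HasDerivAt (fun t : ℝ => t • h) h t := fun t => by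
    simpa using (hasDerivAt_id t).smul_const h
  have hline0 : Tendsto (fun t : ℝ => t • h) (𝓝 0) (𝓝 0) := by
    simpa using (hline 0).continuousAt.tendsto
  have hdiff : ∀ᶠ x in 𝓝 (0 : E), DifferentiableAt ℝ F x := by
    have h1 := hF.eventually (by simp)
    filter_upwards [h1] with x hx
    exact hx.differentiableAt (by norm_num)
  have hd1 : ∀ᶠ t : ℝ in 𝓝 0, HasDerivAt (fun t : ℝ => F (t • h)) (fderiv ℝ F (t • h) h) t := by
    filter_upwards [hline0.eventually hdiff] with t ht
    exact ht.hasFDerivAt.comp_hasDerivAt t (hline t)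
  have hd2 : HasDerivAt (fun t : ℝ => fderiv ℝ F (t • h) h) (fderiv ℝ (fderiv ℝ F) 0 h h) 0 := by
    have h2 : DifferentiableAt ℝ (fderiv ℝ F) ((0 : ℝ) • h) := by
      rw [zero_smul]
      exact (hF.fderiv_right (m := 1) (by norm_num)).differentiableAt (by norm_num)
    have h3 := h2.hasFDerivAt.comp_hasDerivAt 0 (hline 0)
    rw [zero_smul] at h3
    exact h3.clm_apply (hasDerivAt_const (0 : ℝ) h) |>.congr_deriv (by simp)
  let ψ : ℝ → ℝ := fun t => -F (t • h) - ε * ‖h‖ ^ 2 * t ^ 2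
  have hψ1 : ∀ᶠ t : ℝ in 𝓝 0, HasDerivAt ψ (-fderiv ℝ F (t • h) h - ε * ‖h‖ ^ 2 * (2 * t)) t := by
    filter_upwards [hd1] with t ht
    have h4 := (hasDerivAt_pow 2 t).const_mul (ε * ‖h‖ ^ 2)
    exact (ht.fun_neg.fun_sub h4).congr_deriv (by simp)
  have hψ2 : deriv (deriv ψ) 0 = -fderiv ℝ (fderiv ℝ F) 0 h h - 2 * (ε * ‖h‖ ^ 2) := by
    have h5 : deriv ψ =ᶠ[𝓝 0] fun t => -fderiv ℝ F (t • h) h - ε * ‖h‖ ^ 2 * (2 * t) := by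
      filter_upwards [hψ1] with t ht
      exact ht.deriv
    rw [h5.deriv_eq]
    have h6 := ((hasDerivAt_id (0 : ℝ)).const_mul 2).const_mul (ε * ‖h‖ ^ 2)
    exact ((hd2.fun_neg.fun_sub h6).congr_deriv (by ring)).deriv
  have hmin : IsLocalMin ψ 0 := by
    filter_upwards [hline0.eventually hdecay] with t ht
    rw [norm_smul, mul_pow, Real.norm_eq_abs, sq_abs] at ht
    simp only [ψ, zero_smul]
    linarith
  by_contra hneg
  refine not_isLocalMin_of_deriv_deriv_neg ?_ hmin.deriv_eq_zero
    hψ1.self_of_nhds.continuousAt hmin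
  rw [hψ2]
  have : 0 < ε * ‖h‖ ^ 2 := mul_pos hε (pow_pos (norm_pos_iff.2 hh) 2)
  linarith

end Hessian

/-! ### Quadratic growth of the pair functional. -/

section Growth

open Filter Topology

theorem pow_mul_abs_sub_le (d : ℕ) {a x : ℝ} (ha : 0 ≤ a) (hx : 0 ≤ x) :
    a ^ d * |x - a| ≤ |x ^ (d + 1) - a ^ (d + 1)| := by
  rw [← Commute.geom_sum₂_mul (Commute.all x a), abs_mul]
  refine mul_le_mul_of_nonneg_right ?_ (abs_nonneg _)
  rw [abs_of_nonneg (Finset.sum_nonneg fun k _ => by positivity)]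
  have h := Finset.single_le_sum (s := Finset.range (d + 1))
    (f := fun k => x ^ k * a ^ (d + 1 - 1 - k)) (fun k _ => by positivity)
    (Finset.mem_range.2 (Nat.succ_pos d))
  simpa using h

/-- In the variable x^d the one-variable part has second derivative 1/(d a^(d-1)) at its critical
point, so any l below half of that works. In the application c is K times the d-th power of the
other coordinate. -/
theorem eventually_mul_sq_le {d : ℕ} (hd : 1 ≤ d) {a c l : ℝ} (ha : 0 < a) (hc : a + c = 1)
    (hl : 2 * l * (d * a ^ (d - 1)) < 1) :
    ∀ᶠ x in 𝓝 a, l * (x ^ d - a ^ d) ^ 2 ≤ d / (d + 1) * (x ^ (d + 1) - a ^ (d + 1))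
      - (x ^ d - a ^ d) + c * (x ^ d - a ^ d) := by
  let Φ : ℝ → ℝ := fun x => d / (d + 1) * (x ^ (d + 1) - a ^ (d + 1))
      - (x ^ d - a ^ d) + c * (x ^ d - a ^ d) - l * (x ^ d - a ^ d) ^ 2
  let Φ' : ℝ → ℝ := fun x => d * x ^ (d - 1) * (x - a - 2 * l * (x ^ d - a ^ d))
  have hpow : ∀ x, HasDerivAt (fun x : ℝ => x ^ d - a ^ d) (d * x ^ (d - 1)) x :=
    fun x => (hasDerivAt_pow d x).sub_const _
  have hΦ : ∀ x, HasDerivAt Φ (Φ' x) x := by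
    intro x
    have h := (((((hasDerivAt_pow (d + 1) x).sub_const (a ^ (d + 1))).const_mul
      ((d : ℝ) / (d + 1))).fun_sub (hpow x)).fun_add ((hpow x).const_mul c)).fun_sub
      (((hpow x).fun_pow 2).const_mul l)
    refine h.congr_deriv ?_
    obtain ⟨e, rfl⟩ : ∃ e, d = e + 1 := ⟨d - 1, by omega⟩
    obtain rfl : c = 1 - a := by linarith
    simp only [Φ', Nat.add_sub_cancel]
    push_cast
    field_simp
    ring
  have hΦ2 : HasDerivAt Φ' (d * a ^ (d - 1) * (1 - 2 * l * (d * a ^ (d - 1)))) a := by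
    have h := ((hasDerivAt_pow (d - 1) a).const_mul (d : ℝ)).fun_mul
      (((hasDerivAt_id a).sub_const a).fun_sub ((hpow a).const_mul (2 * l)))
    refine h.congr_deriv ?_
    simp
  have hderiv : deriv Φ = Φ' := funext fun x => (hΦ x).deriv
  have hd0 : (0 : ℝ) < d := by exact_mod_cast hd
  have hmin : IsLocalMin Φ a := by
    refine isLocalMin_of_deriv_deriv_pos ?_ ?_ (hΦ a).continuousAt
    · rw [hderiv, hΦ2.deriv]
      exact mul_pos (by positivity) (by linarith)
    · rw [hderiv]
      simp [Φ']
  filter_upwards [hmin] with x hx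
  simp only [Φ, sub_self, mul_zero, zero_pow two_ne_zero, add_zero] at hx
  linarith

theorem exists_pos_mul_le_quadratic {l m K : ℝ} (hl : 0 < l) (hm : 0 < m)
    (hK : K ^ 2 < 4 * l * m) :
    ∃ ε > 0, ∀ P Q : ℝ, ε * (P ^ 2 + Q ^ 2) ≤ l * P ^ 2 + m * Q ^ 2 + K * P * Q := by
  have hlm : 0 < l + m := by linarith
  -- This ε gives (l-ε)(m-ε) - K²/4 = ε², so completing the square leaves the nonnegative remainder
  -- ε²Q².
  set ε := (4 * l * m - K ^ 2) / (4 * (l + m)) with hε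
  have hε0 : 0 < ε := div_pos (by linarith) (by linarith)
  have he : ε * (l + m) = l * m - K ^ 2 / 4 := by
    rw [hε]
    field_simp
  have hL : 0 < l - ε := by
    by_contra hneg
    nlinarith [sq_nonneg K]
  refine ⟨ε, hε0, fun P Q => ?_⟩
  have h1 : (l - ε) * (l * P ^ 2 + m * Q ^ 2 + K * P * Q - ε * (P ^ 2 + Q ^ 2))
      = ((l - ε) * P + K / 2 * Q) ^ 2 + ε ^ 2 * Q ^ 2 := by
    linear_combination (-Q ^ 2) * he
  have h2 : 0 ≤ (l - ε) * (l * P ^ 2 + m * Q ^ 2 + K * P * Q - ε * (P ^ 2 + Q ^ 2)) := by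
    rw [h1]
    positivity
  linarith [nonneg_of_mul_nonneg_right h2 hL]

/-- Quadratic growth of the pair functional at a nondegenerate critical point. -/
theorem pairFun_growth {d : ℕ} (hd : 1 ≤ d) {K a b : ℝ} (ha : 0 < a) (hb : 0 < b)
    (h1 : a + K * b ^ d = 1) (h2 : b + K * a ^ d = 1)
    (hnd : K ^ 2 * d ^ 2 * (a * b) ^ (d - 1) < 1) :
    ∃ ε > 0, ∀ᶠ z in 𝓝 (a, b), ε * ((z.1 - a) ^ 2 + (z.2 - b) ^ 2)
      ≤ pairFun d K z.1 z.2 - pairFun d K a b := by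
  obtain ⟨e, rfl⟩ : ∃ e, d = e + 1 := ⟨d - 1, by omega⟩
  rw [Nat.add_sub_cancel] at hnd
  set m := K ^ 2 * ((e + 1 : ℕ) : ℝ) ^ 2 * (a * b) ^ e with hm
  have hm0 : 0 ≤ m := by positivity
  -- τ < 1 makes both one-variable bounds available, while m < τ² keeps the cross term K P Q
  -- dominated; P, Q are the increments of the d-th powers, in which the functional is a sum of
  -- one-variable parts plus K P Q.
  set τ := (1 + m) / 2 with hτ
  have hτ0 : 0 < τ := by linarith
  have hτ1 : τ < 1 := by linarith
  have hτm : m < τ ^ 2 := by nlinarith [pow_pos (sub_pos.2 hnd) 2]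
  have hd0 : (0 : ℝ) < ((e + 1 : ℕ) : ℝ) := by positivity
  have hla : 2 * (τ / (2 * ((e + 1 : ℕ) : ℝ) * a ^ e)) * (((e + 1 : ℕ) : ℝ) * a ^ (e + 1 - 1)) < 1 := by
    rw [Nat.add_sub_cancel]
    field_simp
    exact hτ1
  have hlb : 2 * (τ / (2 * ((e + 1 : ℕ) : ℝ) * b ^ e)) * (((e + 1 : ℕ) : ℝ) * b ^ (e + 1 - 1)) < 1 := by
    rw [Nat.add_sub_cancel]
    field_simp
    exact hτ1
  have e1 := eventually_mul_sq_le (by omega) ha h1 hla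
  have e2 := eventually_mul_sq_le (by omega) hb h2 hlb
  obtain ⟨ε, hε, hquad⟩ := exists_pos_mul_le_quadratic
    (l := τ / (2 * ((e + 1 : ℕ) : ℝ) * a ^ e)) (m := τ / (2 * ((e + 1 : ℕ) : ℝ) * b ^ e)) (K := K)
    (by positivity) (by positivity) (by
      have : 4 * (τ / (2 * ((e + 1 : ℕ) : ℝ) * a ^ e)) * (τ / (2 * ((e + 1 : ℕ) : ℝ) * b ^ e))
          = τ ^ 2 / (((e + 1 : ℕ) : ℝ) ^ 2 * (a * b) ^ e) := by
        rw [mul_pow]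
        field_simp
        ring
      rw [this, lt_div_iff₀ (by positivity), ← mul_assoc]
      exact hτm)
  have ha2 : 0 < (a ^ e) ^ 2 := by positivity
  have hb2 : 0 < (b ^ e) ^ 2 := by positivity
  refine ⟨ε * min ((a ^ e) ^ 2) ((b ^ e) ^ 2), mul_pos hε (lt_min ha2 hb2), ?_⟩
  have f1 : ∀ᶠ z in 𝓝 (a, b), 0 < z.1 := continuous_fst.tendsto (a, b) |>.eventually
    (lt_mem_nhds ha)
  have f2 : ∀ᶠ z in 𝓝 (a, b), 0 < z.2 := continuous_snd.tendsto (a, b) |>.eventually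
    (lt_mem_nhds hb)
  filter_upwards [continuous_fst.tendsto (a, b) |>.eventually e1,
    continuous_snd.tendsto (a, b) |>.eventually e2, f1, f2] with z g1 g2 g3 g4
  have k1 : (a ^ e) ^ 2 * (z.1 - a) ^ 2 ≤ (z.1 ^ (e + 1) - a ^ (e + 1)) ^ 2 := by
    rw [← mul_pow, ← sq_abs, ← sq_abs (z.1 ^ (e + 1) - _), abs_mul, abs_of_pos (pow_pos ha e)]
    exact pow_le_pow_left₀ (by positivity) (pow_mul_abs_sub_le e ha.le g3.le) 2
  have k2 : (b ^ e) ^ 2 * (z.2 - b) ^ 2 ≤ (z.2 ^ (e + 1) - b ^ (e + 1)) ^ 2 := by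
    rw [← mul_pow, ← sq_abs, ← sq_abs (z.2 ^ (e + 1) - _), abs_mul, abs_of_pos (pow_pos hb e)]
    exact pow_le_pow_left₀ (by positivity) (pow_mul_abs_sub_le e hb.le g4.le) 2
  have k3 : min ((a ^ e) ^ 2) ((b ^ e) ^ 2) * ((z.1 - a) ^ 2 + (z.2 - b) ^ 2)
      ≤ (z.1 ^ (e + 1) - a ^ (e + 1)) ^ 2 + (z.2 ^ (e + 1) - b ^ (e + 1)) ^ 2 := by
    rw [mul_add]
    exact add_le_add
      ((mul_le_mul_of_nonneg_right (min_le_left _ _) (sq_nonneg _)).trans k1)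
      ((mul_le_mul_of_nonneg_right (min_le_right _ _) (sq_nonneg _)).trans k2)
  calc ε * min ((a ^ e) ^ 2) ((b ^ e) ^ 2) * ((z.1 - a) ^ 2 + (z.2 - b) ^ 2)
      ≤ ε * ((z.1 ^ (e + 1) - a ^ (e + 1)) ^ 2 + (z.2 ^ (e + 1) - b ^ (e + 1)) ^ 2) := by
        rw [mul_assoc]
        exact mul_le_mul_of_nonneg_left k3 hε.le
    _ ≤ _ := hquad _ _
    _ ≤ _ := by
        have : pairFun (e + 1) K z.1 z.2 - pairFun (e + 1) K a b
          = (((e + 1 : ℕ) : ℝ) / (((e + 1 : ℕ) : ℝ) + 1) * (z.1 ^ (e + 1 + 1) - a ^ (e + 1 + 1))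
              - (z.1 ^ (e + 1) - a ^ (e + 1)) + K * b ^ (e + 1) * (z.1 ^ (e + 1) - a ^ (e + 1)))
            + (((e + 1 : ℕ) : ℝ) / (((e + 1 : ℕ) : ℝ) + 1) * (z.2 ^ (e + 1 + 1) - b ^ (e + 1 + 1))
              - (z.2 ^ (e + 1) - b ^ (e + 1)) + K * a ^ (e + 1) * (z.2 ^ (e + 1) - b ^ (e + 1)))
            + K * (z.1 ^ (e + 1) - a ^ (e + 1)) * (z.2 ^ (e + 1) - b ^ (e + 1)) := by
          unfold pairFun
          ring
        rw [this]
        linarith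

end Growth

/-! ### The bilinear form of the Potts matrix and its optimal value. -/

section Bilinear

open Filter Topology

variable {q d : ℕ}

theorem potts_bilin (B : ℝ) (r c : Fin q → ℝ) :
    ∑ i, ∑ j, r i * pottsMatrix q B i j * c j
      = (∑ i, r i) * ∑ j, c j - (1 - B) * ∑ i, r i * c i := by
  have h : ∀ i j, r i * pottsMatrix q B i j * c j
      = r i * c j - (1 - B) * (if i = j then r i * c j else 0) := by
    intro i j
    by_cases hij : i = j <;> simp [pottsMatrix, hij]
    ring
  simp only [h, Finset.sum_sub_distrib, ← Finset.mul_sum, Finset.sum_ite_eq, Finset.mem_univ,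
    if_true, Finset.sum_mul]

theorem pottsMatrix_nonneg {B : ℝ} (hB : 0 ≤ B) (i j : Fin q) : 0 ≤ pottsMatrix q B i j := by
  by_cases hij : i = j <;> simp [pottsMatrix, hij, hB]

theorem pottsMatrix_pos (B : ℝ) (i j : Fin q) (hij : i ≠ j) : 0 < pottsMatrix q B i j := by
  simp [pottsMatrix, hij]

/-- The entropy terms cancel in the first-moment bound given by the weights `α ^ (d / (d + 1))`
and `β ^ (d / (d + 1))`. -/
theorem Psi1_le_of_bilin_le {M : Matrix (Fin q) (Fin q) ℝ} {ρ : ℕ → (Fin q → ℝ) → Fin q → ℕ}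
    (hρ : IsRounding ρ) (hd : 1 ≤ d) (hM : ∀ i j, 0 ≤ M i j) {p : (Fin q → ℝ) × (Fin q → ℝ)}
    (hp : p ∈ phaseSpace q) {r c : Fin q → ℝ} (hr : ∀ i, 0 ≤ r i) (hc : ∀ i, 0 ≤ c i)
    (hrp : ∀ i, r i ^ (d + 1) = p.1 i) (hcp : ∀ i, c i ^ (d + 1) = p.2 i) {l : ℝ}
    (hle : ∑ i, ∑ j, r i ^ d * M i j * c j ^ d ≤ l) :
    Psi1 (d + 1) M ρ p ≤ (((d + 1 : ℝ) * Real.log l : ℝ) : EReal) := by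
  have hd0 : d ≠ 0 := by omega
  have hZ0 : 0 ≤ ∑ i, ∑ j, r i ^ d * M i j * c j ^ d :=
    Finset.sum_nonneg fun i _ => Finset.sum_nonneg fun j _ =>
      mul_nonneg (mul_nonneg (pow_nonneg (hr i) d) (hM i j)) (pow_nonneg (hc j) d)
  have hr0 : ∀ i, r i ^ d = 0 → p.1 i = 0 := fun i h => by
    rw [← hrp, pow_eq_zero_iff hd0 |>.1 h, zero_pow (by omega)]
  have hc0 : ∀ i, c i ^ d = 0 → p.2 i = 0 := fun i h => by
    rw [← hcp, pow_eq_zero_iff hd0 |>.1 h, zero_pow (by omega)]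
  rcases hZ0.eq_or_lt with hZ | hZ
  · refine expGrowthSup_le_of_tendsto (x := fun _ => (d + 1 : ℝ) * Real.log l) tendsto_const_nhds ?_
    filter_upwards [eventually_gt_atTop 0] with n hn
    have h1 := pairWeight_mul_le (n := n) hM (ρ n p.1) (ρ n p.2) (fun i => pow_nonneg (hr i) d)
      fun i => pow_nonneg (hc i) d
    rw [← hZ, zero_pow (by omega)] at h1
    have hpos : 0 < (∏ i, (r i ^ d) ^ ρ n p.1 i) * ∏ j, (c j ^ d) ^ ρ n p.2 j := by
      refine mul_pos (Finset.prod_pos fun i _ => ?_) (Finset.prod_pos fun i _ => ?_)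
      · rcases (pow_nonneg (hr i) d).eq_or_lt with h0 | h0
        · simp [hρ.eq_zero hp.1 (hr0 i h0.symm) n]
        · positivity
      · rcases (pow_nonneg (hc i) d).eq_or_lt with h0 | h0
        · simp [hρ.eq_zero hp.2 (hc0 i h0.symm) n]
        · positivity
    have h2 : pairWeight n M (ρ n p.1) (ρ n p.2) = 0 :=
      le_antisymm (by
        by_contra hneg
        exact absurd h1 (not_le.2 (mul_pos (not_le.1 hneg) hpos))) (pairWeight_nonneg hM _ _)
    obtain ⟨-, -, h3⟩ := firstMoment_eq (Δ := d + 1) (M := M) hρ hp n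
    rw [h3, h2, zero_pow (by omega), mul_zero]
    exact (Real.exp_pos _).le
  · refine (Psi1_le hρ (by omega) hM hp (fun i => pow_nonneg (hr i) d)
      (fun i => pow_nonneg (hc i) d) hr0 hc0 hZ).trans ?_
    rw [EReal.coe_le_coe_iff]
    have e1 : ∀ (a b : Fin q → ℝ), (∀ i, a i ^ (d + 1) = b i) →
        entropy b = -((d + 1 : ℝ) * ∑ i, b i * Real.log (a i)) := by
      intro a b hab
      rw [entropy, Finset.mul_sum, ← Finset.sum_neg_distrib]
      refine Finset.sum_congr rfl fun i _ => ?_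
      rw [Real.negMulLog, ← hab i, Real.log_pow]
      push_cast
      ring
    have e2 : ∀ (a b : Fin q → ℝ), ∑ i, b i * Real.log (a i ^ d)
        = d * ∑ i, b i * Real.log (a i) := by
      intro a b
      rw [Finset.mul_sum]
      refine Finset.sum_congr rfl fun i _ => ?_
      rw [Real.log_pow]
      ring
    rw [e1 r _ hrp, e1 c _ hcp, e2, e2]
    have := Real.log_le_log hZ hle
    push_cast
    have hd' : (0 : ℝ) ≤ d + 1 := by positivity
    nlinarith [mul_le_mul_of_nonneg_left this hd']

/-- Bernoulli with exponent 2d/(d+1) ≥ 1 in the variable ω^(d+1). It reconciles the degree 2d of the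
bilinear form with the degree d+1 of the normalization. -/
theorem one_add_mul_le_pow_two_mul (d : ℕ) (hd : 1 ≤ d) {ω : ℝ} (hω : 0 ≤ ω) :
    1 + 2 * d / (d + 1) * (ω ^ (d + 1) - 1) ≤ ω ^ (2 * d) := by
  have hd1 : (1 : ℝ) ≤ d := by exact_mod_cast hd
  have hp : (1 : ℝ) ≤ 2 * d / (d + 1) := by
    rw [le_div_iff₀ (by positivity)]
    linarith
  have h := one_add_mul_self_le_rpow_one_add (s := ω ^ (d + 1) - 1)
    (by linarith [pow_nonneg hω (d + 1)]) hp
  refine h.trans (le_of_eq ?_)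
  rw [add_sub_cancel, ← Real.rpow_natCast, ← Real.rpow_mul hω, ← Real.rpow_natCast]
  congr 1
  push_cast
  field_simp

/-- Vectors `ξ`, `η` which are critical for the bilinear form of the Potts matrix with parameter
`1 - s`, all pairs of coordinates of which minimize the pair functional. -/
structure IsOptimalPair (d q : ℕ) (s K : ℝ) (ξ η : Fin q → ℝ) : Prop where
  pos_K : 0 < K
  pos_fst : ∀ i, 0 < ξ i
  pos_snd : ∀ i, 0 < η i
  crit_fst : ∀ i, ξ i + K * η i ^ d = 1
  crit_snd : ∀ i, η i + K * ξ i ^ d = 1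
  sum_fst : K * ∑ i, ξ i ^ d = s
  sum_snd : K * ∑ i, η i ^ d = s
  isMin : ∀ i X Y, 0 ≤ X → 0 ≤ Y → pairFun d K (ξ i) (η i) ≤ pairFun d K X Y

/-- The phase with `α`, `β` proportional to the powers `d + 1` of two vectors. -/
noncomputable def powPhase (d : ℕ) (z : (Fin q → ℝ) × (Fin q → ℝ)) : (Fin q → ℝ) × (Fin q → ℝ) :=
  (fun i => z.1 i ^ (d + 1) / ∑ k, z.1 k ^ (d + 1), fun i => z.2 i ^ (d + 1) / ∑ k, z.2 k ^ (d + 1))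

/-- The value of the normalized bilinear form at an optimal pair. -/
noncomputable def optimalValue (d : ℕ) (ξ : Fin q → ℝ) : ℝ :=
  (∑ i, ξ i ^ d) * (∑ i, ξ i ^ (d + 1)) / ((∑ i, ξ i ^ (d + 1)) ^ (((d + 1 : ℕ) : ℝ)⁻¹)) ^ (2 * d)

namespace IsOptimalPair

variable {s K : ℝ} {ξ η : Fin q → ℝ}

theorem sum_pow_eq (h : IsOptimalPair d q s K ξ η) : ∑ i, η i ^ d = ∑ i, ξ i ^ d :=
  mul_left_cancel₀ h.pos_K.ne' (h.sum_snd.trans h.sum_fst.symm)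

theorem sum_pow_succ_fst (h : IsOptimalPair d q s K ξ η) :
    ∑ i, ξ i ^ (d + 1) = ∑ i, ξ i ^ d - K * ∑ i, ξ i ^ d * η i ^ d := by
  rw [Finset.mul_sum, ← Finset.sum_sub_distrib]
  refine Finset.sum_congr rfl fun i _ => ?_
  linear_combination ξ i ^ d * h.crit_fst i

theorem sum_pow_succ_snd (h : IsOptimalPair d q s K ξ η) :
    ∑ i, η i ^ (d + 1) = ∑ i, ξ i ^ d - K * ∑ i, ξ i ^ d * η i ^ d := by
  rw [← h.sum_pow_eq, Finset.mul_sum, ← Finset.sum_sub_distrib]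
  refine Finset.sum_congr rfl fun i _ => ?_
  linear_combination η i ^ d * h.crit_snd i

theorem sum_pow_succ_eq (h : IsOptimalPair d q s K ξ η) :
    ∑ i, η i ^ (d + 1) = ∑ i, ξ i ^ (d + 1) := h.sum_pow_succ_snd.trans h.sum_pow_succ_fst.symm

theorem sum_pos (h : IsOptimalPair d q s K ξ η) (hq : 0 < q) (k : ℕ) : 0 < ∑ i, ξ i ^ k :=
  Finset.sum_pos (fun i _ => pow_pos (h.pos_fst i) k) ⟨⟨0, hq⟩, Finset.mem_univ _⟩

theorem optimalValue_pos (h : IsOptimalPair d q s K ξ η) (hq : 0 < q) :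
    0 < optimalValue d ξ :=
  div_pos (mul_pos (h.sum_pos hq _) (h.sum_pos hq _))
    (pow_pos (Real.rpow_pos_of_pos (h.sum_pos hq _) _) _)

/-- The defect in the bound of the bilinear form by its value at an optimal pair. -/
theorem le_optimalValue_sub_bilin {B : ℝ} (h : IsOptimalPair d q (1 - B) K ξ η) (hq : 0 < q)
    (hd : 1 ≤ d) {r c : Fin q → ℝ} (hr1 : ∑ i, r i ^ (d + 1) = 1)
    (hc1 : ∑ i, c i ^ (d + 1) = 1) {θ : ℝ} (hθ : 0 < θ)
    (hθN : θ ^ d * (∑ i, r i ^ d + ∑ i, c i ^ d) = 2 * ∑ i, ξ i ^ d) :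
    (∑ i, ξ i ^ d) * ∑ i, (pairFun d K (θ * r i) (θ * c i) - pairFun d K (ξ i) (η i))
        + (θ ^ d * ∑ i, r i ^ d - θ ^ d * ∑ i, c i ^ d) ^ 2 / 4
      ≤ θ ^ (2 * d) * (optimalValue d ξ
        - ∑ i, ∑ j, r i ^ d * pottsMatrix q B i j * c j ^ d) := by
  rw [potts_bilin]
  set N := ∑ i, ξ i ^ d with hN
  set W := ∑ i, ξ i ^ (d + 1) with hW
  set V := ∑ i, ξ i ^ d * η i ^ d with hV
  set R := ∑ i, r i ^ d with hR
  set C := ∑ i, c i ^ d with hC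
  set V' := ∑ i, r i ^ d * c i ^ d with hV'
  have hN0 : 0 < N := h.sum_pos hq _
  have hW0 : 0 < W := h.sum_pos hq _
  have hWV : W = N - K * V := h.sum_pow_succ_fst
  have hs : 1 - B = K * N := h.sum_fst.symm
  have e1 : ∑ i, pairFun d K (ξ i) (η i)
      = 2 * d / (d + 1) * W + K * V - 2 * N := by
    simp only [pairFun, Finset.sum_add_distrib, Finset.sum_sub_distrib, ← Finset.mul_sum, mul_assoc]
    rw [h.sum_pow_succ_eq, h.sum_pow_eq]
    ring
  have e2 : ∑ i, pairFun d K (θ * r i) (θ * c i)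
      = 2 * d / (d + 1) * θ ^ (d + 1) + K * θ ^ (2 * d) * V' - 2 * N := by
    simp only [pairFun, Finset.sum_add_distrib, Finset.sum_sub_distrib, ← Finset.mul_sum, mul_pow]
    have : ∑ i, K * (θ ^ d * r i ^ d) * (θ ^ d * c i ^ d) = K * θ ^ (2 * d) * V' := by
      rw [hV', Finset.mul_sum]
      refine Finset.sum_congr rfl fun i _ => ?_
      ring
    rw [this, hr1, hc1]
    linear_combination (-1 : ℝ) * hθN
  set T := W ^ (((d + 1 : ℕ) : ℝ)⁻¹) with hT
  have hT0 : 0 < T := Real.rpow_pos_of_pos hW0 _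
  have hTW : T ^ (d + 1) = W := Real.rpow_inv_natCast_pow hW0.le (by omega)
  -- The only inequality of the argument, sharp when θ = T. Everything else is identity: the product
  -- of sums is a squared mean minus a squared difference, and the choice of θ fixes the mean at N.
  have hB := one_add_mul_le_pow_two_mul d hd (ω := θ / T) (by positivity)
  rw [div_pow, div_pow, hTW] at hB
  have hB' := mul_le_mul_of_nonneg_left hB (mul_pos hN0 hW0).le
  have e3 : N * W * (1 + 2 * d / (d + 1) * (θ ^ (d + 1) / W - 1))
      = N * W + N * (2 * d / (d + 1)) * (θ ^ (d + 1) - W) := by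
    field_simp
  have e4 : N * W * (θ ^ (2 * d) / T ^ (2 * d)) = θ ^ (2 * d) * optimalValue d ξ := by
    rw [optimalValue, ← hN, ← hW, ← hT]
    ring
  rw [e3, e4] at hB'
  rw [Finset.sum_sub_distrib, e1, e2, hs]
  have e5 : θ ^ (2 * d) = θ ^ d * θ ^ d := by
    rw [← pow_add]
    congr 1
    omega
  have e6 : θ ^ (2 * d) * (R * C) = N ^ 2 - (θ ^ d * R - θ ^ d * C) ^ 2 / 4 := by
    rw [e5]
    have : N = θ ^ d * (R + C) / 2 := by linarith
    rw [this]
    ring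
  have hKV : K * V = N - W := by linarith
  rw [hKV]
  have : θ ^ (2 * d) * (optimalValue d ξ - (R * C - K * N * V'))
      = θ ^ (2 * d) * optimalValue d ξ - (N ^ 2 - (θ ^ d * R - θ ^ d * C) ^ 2 / 4)
        + N * (K * θ ^ (2 * d) * V') := by
    rw [← e6]
    ring
  rw [this]
  nlinarith

theorem powPhase_mem (h : IsOptimalPair d q s K ξ η) (hq : 0 < q) :
    powPhase d (ξ, η) ∈ phaseSpace q ∧ (∀ i, 0 < (powPhase d (ξ, η)).1 i) ∧
      ∀ i, 0 < (powPhase d (ξ, η)).2 i := by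
  have hW := h.sum_pos hq (d + 1)
  have hW' : 0 < ∑ i, η i ^ (d + 1) := by rwa [h.sum_pow_succ_eq]
  have h1 : ∀ i, 0 < (powPhase d (ξ, η)).1 i := fun i => div_pos (pow_pos (h.pos_fst i) _) hW
  have h2 : ∀ i, 0 < (powPhase d (ξ, η)).2 i := fun i => div_pos (pow_pos (h.pos_snd i) _) hW'
  refine ⟨⟨⟨fun i => (h1 i).le, ?_⟩, ⟨fun i => (h2 i).le, ?_⟩⟩, h1, h2⟩
  · simp only [powPhase, ← Finset.sum_div]
    exact div_self hW.ne'
  · simp only [powPhase, ← Finset.sum_div]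
    exact div_self hW'.ne'

/-- Since 1 - B = K N with N = ∑ ξ^d, the matrix sends η^d to N (1 - K η_i^d), which the critical
equation turns into N ξ_i; multiplying by ξ_i^d produces the power d+1. Columns are symmetric. -/
theorem powPhase_margins {B : ℝ} (h : IsOptimalPair d q (1 - B) K ξ η) (hq : 0 < q) :
    (∀ i, ∑ j, ξ i ^ d / ((∑ k, ξ k ^ d) * ∑ k, ξ k ^ (d + 1)) * pottsMatrix q B i j * η j ^ d
      = (powPhase d (ξ, η)).1 i) ∧
    ∀ j, ∑ i, ξ i ^ d / ((∑ k, ξ k ^ d) * ∑ k, ξ k ^ (d + 1)) * pottsMatrix q B i j * η j ^ d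
      = (powPhase d (ξ, η)).2 j := by
  have hN := h.sum_pos hq d
  have hW := h.sum_pos hq (d + 1)
  have hs := h.sum_fst
  have hη := h.sum_pow_eq
  have hη' := h.sum_pow_succ_eq
  have hrow : ∀ (y : Fin q → ℝ) i, ∑ j, pottsMatrix q B i j * y j = ∑ j, y j - (1 - B) * y i := by
    intro y i
    have h1 : ∀ j, pottsMatrix q B i j * y j = y j - (1 - B) * (if i = j then y j else 0) := by
      intro j
      by_cases hij : i = j <;> simp [pottsMatrix, hij]
      ring
    simp only [h1, Finset.sum_sub_distrib, ← Finset.mul_sum, Finset.sum_ite_eq, Finset.mem_univ,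
      if_true]
  have hsymm : ∀ i j, pottsMatrix q B i j = pottsMatrix q B j i := fun i j => by
    simp [pottsMatrix, eq_comm]
  constructor
  · intro i
    simp only [mul_assoc, ← Finset.mul_sum]
    rw [hrow (fun j => η j ^ d), hη, ← hs]
    have hc : ∑ k, ξ k ^ d - K * (∑ k, ξ k ^ d) * η i ^ d = (∑ k, ξ k ^ d) * ξ i := by
      linear_combination (-(∑ k, ξ k ^ d)) * h.crit_fst i
    rw [hc]
    simp only [powPhase]
    field_simp
    ring
  · intro j
    have h2 : ∀ i, ξ i ^ d / ((∑ k, ξ k ^ d) * ∑ k, ξ k ^ (d + 1)) * pottsMatrix q B i j * η j ^ d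
        = η j ^ d / ((∑ k, ξ k ^ d) * ∑ k, ξ k ^ (d + 1)) * (pottsMatrix q B j i * ξ i ^ d) := by
      intro i
      rw [hsymm]
      ring
    simp only [h2, ← Finset.mul_sum]
    rw [hrow (fun j => ξ j ^ d), ← hs]
    have hc : ∑ k, ξ k ^ d - K * (∑ k, ξ k ^ d) * ξ j ^ d = (∑ k, ξ k ^ d) * η j := by
      linear_combination (-(∑ k, ξ k ^ d)) * h.crit_snd j
    rw [hc]
    simp only [powPhase, hη']
    field_simp
    ring

/-- The explicit scaling gives the exact value, equal to the bound coming from the bilinear form: no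
duality gap remains at an optimal pair. -/
theorem Psi1_powPhase {B : ℝ} (h : IsOptimalPair d q (1 - B) K ξ η) (hq : 3 ≤ q) (hB : 0 ≤ B)
    {ρ : ℕ → (Fin q → ℝ) → Fin q → ℕ} (hρ : IsRounding ρ) :
    Psi1 (d + 1) (pottsMatrix q B) ρ (powPhase d (ξ, η))
      = (((d + 1 : ℝ) * Real.log (optimalValue d ξ) : ℝ) : EReal) := by
  have hN := h.sum_pos (by omega) d
  have hW := h.sum_pos (by omega) (d + 1)
  obtain ⟨hmem, hp1, hp2⟩ := h.powPhase_mem (by omega)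
  obtain ⟨hm1, hm2⟩ := h.powPhase_margins (by omega)
  rw [(Psi1_eq_of_scaling hq hρ (by omega) (pottsMatrix_nonneg hB) (pottsMatrix_pos B) hmem
    (x := fun i => ξ i ^ d / ((∑ k, ξ k ^ d) * ∑ k, ξ k ^ (d + 1))) (y := fun j => η j ^ d)
    (fun i => div_pos (pow_pos (h.pos_fst i) d) (mul_pos hN hW))
    (fun i => pow_pos (h.pos_snd i) d) hm1 hm2).1, EReal.coe_eq_coe_iff]
  set N := ∑ i, ξ i ^ d
  set W := ∑ i, ξ i ^ (d + 1) with hWdef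
  set p := powPhase d (ξ, η) with hp
  have hent : ∀ (a b : Fin q → ℝ), (∀ i, 0 < a i) → (∀ i, b i = a i ^ (d + 1) / W) →
      ∑ i, b i = 1 → entropy b = Real.log W - (d + 1) * ∑ i, b i * Real.log (a i) := by
    intro a b ha hb hb1
    have : ∀ i, Real.negMulLog (b i) = b i * Real.log W - (d + 1) * (b i * Real.log (a i)) := by
      intro i
      rw [Real.negMulLog]
      conv_lhs => rw [hb i, Real.log_div (pow_pos (ha i) _).ne' hW.ne', Real.log_pow, ← hb i]
      push_cast
      ring
    rw [entropy, Finset.sum_congr rfl fun i _ => this i, Finset.sum_sub_distrib, ← Finset.sum_mul,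
      ← Finset.mul_sum, hb1, one_mul]
  have e1 := hent ξ p.1 h.pos_fst (fun i => rfl) hmem.1.2
  have e2 := hent η p.2 h.pos_snd (fun i => by
    simp only [hp, powPhase, h.sum_pow_succ_eq, hWdef]) hmem.2.2
  have e3 : ∑ i, p.1 i * Real.log (ξ i ^ d / (N * W))
      = d * (∑ i, p.1 i * Real.log (ξ i)) - (Real.log N + Real.log W) := by
    have : ∀ i, p.1 i * Real.log (ξ i ^ d / (N * W))
        = d * (p.1 i * Real.log (ξ i)) - p.1 i * (Real.log N + Real.log W) := by
      intro i
      rw [Real.log_div (pow_pos (h.pos_fst i) _).ne' (mul_pos hN hW).ne', Real.log_pow,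
        Real.log_mul hN.ne' hW.ne']
      ring
    rw [Finset.sum_congr rfl fun i _ => this i, Finset.sum_sub_distrib, ← Finset.sum_mul,
      ← Finset.mul_sum, hmem.1.2, one_mul]
  have e4 : ∑ i, p.2 i * Real.log (η i ^ d) = d * ∑ i, p.2 i * Real.log (η i) := by
    rw [Finset.mul_sum]
    refine Finset.sum_congr rfl fun i _ => ?_
    rw [Real.log_pow]
    ring
  rw [e1, e2, e3, e4, optimalValue, Real.log_div (mul_pos hN hW).ne'
    (pow_pos (Real.rpow_pos_of_pos hW _) _).ne', Real.log_mul hN.ne' hW.ne', Real.log_pow,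
    Real.log_rpow hW]
  push_cast
  field_simp
  ring

theorem exists_local_formula {B : ℝ} (h : IsOptimalPair d q (1 - B) K ξ η) (hq : 3 ≤ q)
    (hB : 0 ≤ B) : ∃ F : (Fin q → ℝ) × (Fin q → ℝ) → ℝ, ContDiffAt ℝ 2 F (powPhase d (ξ, η)) ∧
      ∀ᶠ p' in 𝓝 (powPhase d (ξ, η)), p' ∈ phaseSpace q → ∀ ρ, IsRounding ρ →
        Psi1 (d + 1) (pottsMatrix q B) ρ p' = (F p' : EReal) ∧
          FirstMomentLimitExists (d + 1) (pottsMatrix q B) ρ p' := by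
  have hN := h.sum_pos (by omega) d
  have hW := h.sum_pos (by omega) (d + 1)
  obtain ⟨-, hp1, hp2⟩ := h.powPhase_mem (by omega)
  obtain ⟨hm1, hm2⟩ := h.powPhase_margins (by omega)
  exact _root_.exists_local_formula hq (by omega) (pottsMatrix_nonneg hB) (pottsMatrix_pos B)
    (z := (fun i => ξ i ^ d / ((∑ k, ξ k ^ d) * ∑ k, ξ k ^ (d + 1)), fun j => η j ^ d))
    (fun i => div_pos (pow_pos (h.pos_fst i) d) (mul_pos hN hW))
    (fun i => pow_pos (h.pos_snd i) d) (fun i => (hp1 i).ne') (fun i => (hp2 i).ne') hm1 hm2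

end IsOptimalPair

end Bilinear

/-! ### From optimal pairs to dominant and Hessian dominant phases. -/

section Dominance

open Filter Topology

variable {q d : ℕ}

/-- The coordinatewise root of order `d + 1`. -/
noncomputable def rootVec (d : ℕ) (x : Fin q → ℝ) (i : Fin q) : ℝ :=
  x i ^ (((d + 1 : ℕ) : ℝ)⁻¹)

theorem rootVec_nonneg {x : Fin q → ℝ} (hx : ∀ i, 0 ≤ x i) (i : Fin q) : 0 ≤ rootVec d x i :=
  Real.rpow_nonneg (hx i) _

theorem rootVec_pow {x : Fin q → ℝ} (hx : ∀ i, 0 ≤ x i) (i : Fin q) :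
    rootVec d x i ^ (d + 1) = x i :=
  Real.rpow_inv_natCast_pow (hx i) (by omega)

/-- The factor by which the roots of the coordinates of a phase are multiplied in order that the
sum of their powers `d` be `2 * N`. -/
noncomputable def liftScale (d : ℕ) (N : ℝ) (p : (Fin q → ℝ) × (Fin q → ℝ)) : ℝ :=
  (2 * N / (∑ i, rootVec d p.1 i ^ d + ∑ i, rootVec d p.2 i ^ d)) ^ ((d : ℝ)⁻¹)

/-- The rescaled roots of the coordinates of a phase. -/
noncomputable def liftPair (d : ℕ) (N : ℝ) (p : (Fin q → ℝ) × (Fin q → ℝ)) :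
    (Fin q → ℝ) × (Fin q → ℝ) :=
  (fun i => liftScale d N p * rootVec d p.1 i, fun i => liftScale d N p * rootVec d p.2 i)

theorem sum_rootVec_pow_pos (d : ℕ) {x : Fin q → ℝ} (hx : x ∈ stdSimplex ℝ (Fin q)) :
    0 < ∑ i, rootVec d x i ^ d := by
  obtain ⟨i, -, hi⟩ : ∃ i ∈ Finset.univ, x i ≠ 0 := by
    refine Finset.exists_ne_zero_of_sum_ne_zero ?_
    rw [hx.2]
    exact one_ne_zero
  refine Finset.sum_pos' (fun j _ => pow_nonneg (rootVec_nonneg hx.1 j) d) ⟨i, Finset.mem_univ i, ?_⟩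
  exact pow_pos (Real.rpow_pos_of_pos (lt_of_le_of_ne (hx.1 i) hi.symm) _) d

theorem liftScale_spec (hd : 1 ≤ d) {N : ℝ} (hN : 0 < N) {p : (Fin q → ℝ) × (Fin q → ℝ)}
    (hp : p ∈ phaseSpace q) : 0 < liftScale d N p ∧
      liftScale d N p ^ d * (∑ i, rootVec d p.1 i ^ d + ∑ i, rootVec d p.2 i ^ d) = 2 * N := by
  have h := add_pos (sum_rootVec_pow_pos d hp.1) (sum_rootVec_pow_pos d hp.2)
  refine ⟨Real.rpow_pos_of_pos (by positivity) _, ?_⟩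
  rw [liftScale, Real.rpow_inv_natCast_pow (by positivity) (by omega)]
  field_simp

theorem powPhase_liftPair (hd : 1 ≤ d) {N : ℝ} (hN : 0 < N) {p : (Fin q → ℝ) × (Fin q → ℝ)}
    (hp : p ∈ phaseSpace q) : powPhase d (liftPair d N p) = p := by
  have hθ := (liftScale_spec hd hN hp).1
  have hθ' : liftScale d N p ^ (d + 1) ≠ 0 := (pow_pos hθ _).ne'
  refine Prod.ext (funext fun i => ?_) (funext fun i => ?_)
  · simp only [powPhase, liftPair, mul_pow, rootVec_pow hp.1.1, ← Finset.mul_sum, hp.1.2]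
    field_simp
  · simp only [powPhase, liftPair, mul_pow, rootVec_pow hp.2.1, ← Finset.mul_sum, hp.2.2]
    field_simp

theorem continuousAt_liftScale (hd : 1 ≤ d) (N : ℝ) {p : (Fin q → ℝ) × (Fin q → ℝ)}
    (hp : p ∈ phaseSpace q) : ContinuousAt (liftScale d N) p := by
  have h := add_pos (sum_rootVec_pow_pos d hp.1) (sum_rootVec_pow_pos d hp.2)
  have hd' : 0 ≤ (d : ℝ)⁻¹ := by positivity
  have hd'' : 0 ≤ ((d + 1 : ℕ) : ℝ)⁻¹ := by positivity
  have h1 : ∀ i, Continuous fun p : (Fin q → ℝ) × (Fin q → ℝ) => rootVec d p.1 i := fun i =>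
    (continuous_apply i |>.comp continuous_fst).rpow_const fun _ => Or.inr hd''
  have h2 : ∀ i, Continuous fun p : (Fin q → ℝ) × (Fin q → ℝ) => rootVec d p.2 i := fun i =>
    (continuous_apply i |>.comp continuous_snd).rpow_const fun _ => Or.inr hd''
  have h3 : Continuous fun p : (Fin q → ℝ) × (Fin q → ℝ) =>
      ∑ i, rootVec d p.1 i ^ d + ∑ i, rootVec d p.2 i ^ d :=
    (continuous_finsetSum _ fun i _ => (h1 i).pow d).add
      (continuous_finsetSum _ fun i _ => (h2 i).pow d)
  exact (continuousAt_const.div h3.continuousAt h.ne').rpow_const (Or.inr hd')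

theorem continuousAt_liftPair (hd : 1 ≤ d) (N : ℝ) {p : (Fin q → ℝ) × (Fin q → ℝ)}
    (hp : p ∈ phaseSpace q) : ContinuousAt (liftPair d N) p := by
  have hd'' : 0 ≤ ((d + 1 : ℕ) : ℝ)⁻¹ := by positivity
  have h := continuousAt_liftScale hd N hp
  refine ContinuousAt.prodMk (continuousAt_pi.2 fun i => h.mul ?_)
    (continuousAt_pi.2 fun i => h.mul ?_)
  · exact ((continuous_apply i |>.comp continuous_fst).rpow_const
      fun _ => Or.inr hd'').continuousAt
  · exact ((continuous_apply i |>.comp continuous_snd).rpow_const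
      fun _ => Or.inr hd'').continuousAt

namespace IsOptimalPair

variable {B K : ℝ} {ξ η : Fin q → ℝ}

/-- The difference between the value at an optimal pair and the bound for `Ψ₁` at a phase is at
least a multiple of this quantity. -/
noncomputable def defect (d : ℕ) (K : ℝ) (ξ η : Fin q → ℝ) (z : (Fin q → ℝ) × (Fin q → ℝ)) : ℝ :=
  (∑ i, ξ i ^ d) * ∑ i, (pairFun d K (z.1 i) (z.2 i) - pairFun d K (ξ i) (η i))
    + (∑ i, z.1 i ^ d - ∑ i, z.2 i ^ d) ^ 2 / 4

theorem Psi1_le_sub_defect (h : IsOptimalPair d q (1 - B) K ξ η) (hq : 3 ≤ q) (hd : 1 ≤ d)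
    (hB : 0 ≤ B) {ρ : ℕ → (Fin q → ℝ) → Fin q → ℕ} (hρ : IsRounding ρ)
    {p : (Fin q → ℝ) × (Fin q → ℝ)} (hp : p ∈ phaseSpace q) :
    Psi1 (d + 1) (pottsMatrix q B) ρ p ≤ (((d + 1 : ℝ) * Real.log (optimalValue d ξ)
      - (d + 1 : ℝ) / optimalValue d ξ * (defect d K ξ η (liftPair d (∑ i, ξ i ^ d) p)
        / liftScale d (∑ i, ξ i ^ d) p ^ (2 * d)) : ℝ) : EReal) := by
  have hN := h.sum_pos (by omega) d
  have hΛ := h.optimalValue_pos (by omega)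
  obtain ⟨hθ, hθN⟩ := liftScale_spec hd hN hp
  have hdef := h.le_optimalValue_sub_bilin (by omega) hd
    (r := rootVec d p.1) (c := rootVec d p.2)
    (by simp only [rootVec_pow hp.1.1, hp.1.2]) (by simp only [rootVec_pow hp.2.1, hp.2.2]) hθ hθN
  set θ := liftScale d (∑ i, ξ i ^ d) p with hθdef
  set Λ := optimalValue d ξ
  set Z := ∑ i, ∑ j, rootVec d p.1 i ^ d * pottsMatrix q B i j * rootVec d p.2 j ^ d
  have e1 : defect d K ξ η (liftPair d (∑ i, ξ i ^ d) p)
      = (∑ i, ξ i ^ d) * ∑ i, (pairFun d K (θ * rootVec d p.1 i) (θ * rootVec d p.2 i)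
          - pairFun d K (ξ i) (η i))
        + (θ ^ d * ∑ i, rootVec d p.1 i ^ d - θ ^ d * ∑ i, rootVec d p.2 i ^ d) ^ 2 / 4 := by
    simp only [defect, liftPair, ← hθdef, mul_pow, ← Finset.mul_sum]
  rw [← e1] at hdef
  -- The tangent line bound for the logarithm at Λ, in exponential form so that it also covers Z =
  -- 0; it makes the deficit of Ψ₁ linear in Λ - Z.
  have hle : Z ≤ Λ * Real.exp ((Z - Λ) / Λ) := by
    have h1 := Real.add_one_le_exp ((Z - Λ) / Λ)
    have h2 := mul_le_mul_of_nonneg_left h1 hΛ.le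
    have h3 : Λ * ((Z - Λ) / Λ + 1) = Z := by
      field_simp
      ring
    linarith
  refine (Psi1_le_of_bilin_le hρ hd (pottsMatrix_nonneg hB) hp (rootVec_nonneg hp.1.1)
    (rootVec_nonneg hp.2.1) (rootVec_pow hp.1.1) (rootVec_pow hp.2.1) hle).trans ?_
  rw [EReal.coe_le_coe_iff, Real.log_mul hΛ.ne' (Real.exp_pos _).ne', Real.log_exp, mul_add]
  have h4 : defect d K ξ η (liftPair d (∑ i, ξ i ^ d) p) / θ ^ (2 * d) ≤ Λ - Z := by
    rw [div_le_iff₀ (pow_pos hθ _)]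
    linarith
  have h5 : (d + 1 : ℝ) / Λ * (defect d K ξ η (liftPair d (∑ i, ξ i ^ d) p) / θ ^ (2 * d))
      ≤ (d + 1 : ℝ) / Λ * (Λ - Z) := mul_le_mul_of_nonneg_left h4 (by positivity)
  have h6 : (d + 1 : ℝ) * ((Z - Λ) / Λ) = -((d + 1 : ℝ) / Λ * (Λ - Z)) := by ring
  linarith

theorem defect_nonneg (h : IsOptimalPair d q (1 - B) K ξ η) (hq : 0 < q)
    {z : (Fin q → ℝ) × (Fin q → ℝ)} (hz1 : ∀ i, 0 ≤ z.1 i) (hz2 : ∀ i, 0 ≤ z.2 i) :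
    0 ≤ defect d K ξ η z := by
  refine add_nonneg (mul_nonneg (h.sum_pos hq _).le (Finset.sum_nonneg fun i _ => ?_)) (by positivity)
  exact sub_nonneg.2 (h.isMin i _ _ (hz1 i) (hz2 i))

theorem liftPair_nonneg (h : IsOptimalPair d q (1 - B) K ξ η) (hq : 0 < q) (hd : 1 ≤ d)
    {p : (Fin q → ℝ) × (Fin q → ℝ)} (hp : p ∈ phaseSpace q) :
    (∀ i, 0 ≤ (liftPair d (∑ i, ξ i ^ d) p).1 i) ∧ ∀ i, 0 ≤ (liftPair d (∑ i, ξ i ^ d) p).2 i := by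
  have hθ := (liftScale_spec hd (h.sum_pos hq d) hp).1.le
  exact ⟨fun i => mul_nonneg hθ (rootVec_nonneg hp.1.1 i),
    fun i => mul_nonneg hθ (rootVec_nonneg hp.2.1 i)⟩

theorem isDominantPhase (h : IsOptimalPair d q (1 - B) K ξ η) (hq : 3 ≤ q) (hd : 1 ≤ d)
    (hB : 0 ≤ B) {ρ : ℕ → (Fin q → ℝ) → Fin q → ℕ} (hρ : IsRounding ρ) :
    IsDominantPhase (d + 1) (pottsMatrix q B) ρ (powPhase d (ξ, η)) := by
  refine ⟨(h.powPhase_mem (by omega)).1, fun p hp => ?_⟩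
  change Psi1 (d + 1) (pottsMatrix q B) ρ p ≤ Psi1 (d + 1) (pottsMatrix q B) ρ (powPhase d (ξ, η))
  rw [h.Psi1_powPhase hq hB hρ]
  refine (h.Psi1_le_sub_defect hq hd hB hρ hp).trans ?_
  rw [EReal.coe_le_coe_iff]
  obtain ⟨h1, h2⟩ := h.liftPair_nonneg (by omega) hd hp
  have h3 := h.defect_nonneg (by omega) h1 h2
  have h4 := (liftScale_spec hd (h.sum_pos (by omega) d) hp).1
  have h5 := h.optimalValue_pos (by omega)
  have : 0 ≤ (d + 1 : ℝ) / optimalValue d ξ * (defect d K ξ η (liftPair d (∑ i, ξ i ^ d) p)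
        / liftScale d (∑ i, ξ i ^ d) p ^ (2 * d)) := by positivity
  linarith

/-- A dominant phase comes from vectors all pairs of coordinates of which minimize the pair
functional. -/
theorem exists_of_isDominantPhase (h : IsOptimalPair d q (1 - B) K ξ η) (hq : 3 ≤ q) (hd : 1 ≤ d)
    (hB : 0 ≤ B) {ρ : ℕ → (Fin q → ℝ) → Fin q → ℕ} (hρ : IsRounding ρ)
    {p : (Fin q → ℝ) × (Fin q → ℝ)} (hp : IsDominantPhase (d + 1) (pottsMatrix q B) ρ p) :
    ∃ z : (Fin q → ℝ) × (Fin q → ℝ), (∀ i, 0 ≤ z.1 i) ∧ (∀ i, 0 ≤ z.2 i) ∧ powPhase d z = p ∧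
      (∀ i, pairFun d K (z.1 i) (z.2 i) = pairFun d K (ξ i) (η i)) ∧
      ∑ i, z.1 i ^ d = ∑ i, z.2 i ^ d := by
  obtain ⟨hmem, hmax⟩ := hp
  have hN := h.sum_pos (by omega) d
  obtain ⟨h1, h2⟩ := h.liftPair_nonneg (by omega) hd hmem
  refine ⟨liftPair d (∑ i, ξ i ^ d) p, h1, h2, powPhase_liftPair hd hN hmem, ?_⟩
  set z := liftPair d (∑ i, ξ i ^ d) p
  have h3 : Psi1 (d + 1) (pottsMatrix q B) ρ (powPhase d (ξ, η))
      ≤ Psi1 (d + 1) (pottsMatrix q B) ρ p := hmax (h.powPhase_mem (by omega)).1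
  rw [h.Psi1_powPhase hq hB hρ] at h3
  have h4 := h3.trans (h.Psi1_le_sub_defect hq hd hB hρ hmem)
  rw [EReal.coe_le_coe_iff] at h4
  have h5 := h.defect_nonneg (by omega) h1 h2
  have hθ := (liftScale_spec hd hN hmem).1
  have hΛ := h.optimalValue_pos (by omega)
  have h6 : defect d K ξ η z = 0 := by
    refine le_antisymm ?_ h5
    by_contra hneg
    have : 0 < (d + 1 : ℝ) / optimalValue d ξ * (defect d K ξ η z
        / liftScale d (∑ i, ξ i ^ d) p ^ (2 * d)) := by
      have := not_le.1 hneg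
      positivity
    linarith
  have h7 : ∀ i ∈ Finset.univ, 0 ≤ pairFun d K (z.1 i) (z.2 i) - pairFun d K (ξ i) (η i) :=
    fun i _ => sub_nonneg.2 (h.isMin i _ _ (h1 i) (h2 i))
  have h8 := (add_eq_zero_iff_of_nonneg (mul_nonneg hN.le (Finset.sum_nonneg h7))
    (by positivity)).1 h6
  constructor
  · intro i
    have h9 := (Finset.sum_eq_zero_iff_of_nonneg h7).1
      ((mul_eq_zero.1 h8.1).resolve_left hN.ne') i (Finset.mem_univ i)
    linarith
  · have h9 : (∑ i, z.1 i ^ d - ∑ i, z.2 i ^ d) ^ 2 = 0 := by linarith [h8.2]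
    linarith [pow_eq_zero_iff two_ne_zero |>.1 h9]

theorem eventually_firstMomentLimitExists (h : IsOptimalPair d q (1 - B) K ξ η) (hq : 3 ≤ q)
    (hB : 0 ≤ B) {ρ : ℕ → (Fin q → ℝ) → Fin q → ℕ} (hρ : IsRounding ρ) :
    ∀ᶠ p' in nhdsWithin (powPhase d (ξ, η)) (phaseSpace q),
      FirstMomentLimitExists (d + 1) (pottsMatrix q B) ρ p' := by
  obtain ⟨F, -, hF⟩ := h.exists_local_formula hq hB
  rw [eventually_nhdsWithin_iff]
  filter_upwards [hF] with p' hp' hmem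
  exact (hp' hmem ρ hρ).2

/-- Root extraction divides both vectors by the same T, and the normalization of the d-th powers
restores it; so neighbourhoods of the phase lift to neighbourhoods of the optimal pair. -/
theorem liftPair_powPhase (h : IsOptimalPair d q (1 - B) K ξ η) (hq : 0 < q) (hd : 1 ≤ d) :
    liftPair d (∑ i, ξ i ^ d) (powPhase d (ξ, η)) = (ξ, η) := by
  have hN := h.sum_pos hq d
  have hW := h.sum_pos hq (d + 1)
  set W := ∑ i, ξ i ^ (d + 1) with hWdef
  set T := W ^ (((d + 1 : ℕ) : ℝ)⁻¹) with hT
  have hT0 : 0 < T := Real.rpow_pos_of_pos hW _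
  have hroot : ∀ (a : Fin q → ℝ), (∀ i, 0 < a i) →
      ∀ i, (a i ^ (d + 1) / W) ^ (((d + 1 : ℕ) : ℝ)⁻¹) = a i / T := by
    intro a ha i
    rw [Real.div_rpow (pow_pos (ha i) _).le hW.le, Real.pow_rpow_inv_natCast (ha i).le (by omega)]
  have h1 : ∀ i, rootVec d (powPhase d (ξ, η)).1 i = ξ i / T := hroot ξ h.pos_fst
  have h2 : ∀ i, rootVec d (powPhase d (ξ, η)).2 i = η i / T := fun i => by
    simp only [rootVec, powPhase, h.sum_pow_succ_eq]
    exact hroot η h.pos_snd i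
  have h3 : liftScale d (∑ i, ξ i ^ d) (powPhase d (ξ, η)) = T := by
    simp only [liftScale, h1, h2, div_pow, ← Finset.sum_div, h.sum_pow_eq]
    rw [← add_div, ← two_mul, div_div_eq_mul_div, mul_div_cancel_left₀ _ (by positivity),
      Real.pow_rpow_inv_natCast hT0.le (by omega)]
  refine Prod.ext (funext fun i => ?_) (funext fun i => ?_)
  · simp only [liftPair, h3, h1]
    field_simp
  · simp only [liftPair, h3, h2]
    field_simp

/-- Because `powPhase` undoes `liftPair`, this converts growth in the lifted variables into growth
in the phase; continuity of the lift suffices, not its smoothness. -/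
theorem exists_lipschitz_powPhase (h : IsOptimalPair d q (1 - B) K ξ η) (hq : 0 < q) :
    ∃ C > 0, ∀ᶠ z in 𝓝 (ξ, η),
      ‖powPhase d z - powPhase d (ξ, η)‖ ≤ C * ‖z - (ξ, η)‖ := by
  have hW := h.sum_pos hq (d + 1)
  have hW' : 0 < ∑ i, η i ^ (d + 1) := by rwa [h.sum_pow_succ_eq]
  have hcd : ContDiffAt ℝ 1 (powPhase (q := q) d) (ξ, η) := by
    have h1 : ∀ i, ContDiffAt ℝ 1 (fun z : (Fin q → ℝ) × (Fin q → ℝ) => z.1 i ^ (d + 1)) (ξ, η) :=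
      fun i => by fun_prop
    have h2 : ∀ i, ContDiffAt ℝ 1 (fun z : (Fin q → ℝ) × (Fin q → ℝ) => z.2 i ^ (d + 1)) (ξ, η) :=
      fun i => by fun_prop
    exact ContDiffAt.prodMk
      (contDiffAt_pi.2 fun i => (h1 i).div (ContDiffAt.sum fun k _ => h1 k) hW.ne')
      (contDiffAt_pi.2 fun i => (h2 i).div (ContDiffAt.sum fun k _ => h2 k) hW'.ne')
  obtain ⟨C, t, ht, hC⟩ := hcd.exists_lipschitzOnWith
  refine ⟨C + 1, by positivity, ?_⟩
  filter_upwards [ht] with z hz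
  have h3 := hC.norm_sub_le hz (mem_of_mem_nhds ht)
  refine h3.trans ?_
  gcongr
  linarith

/-- The coordinatewise growth estimates add up, with the smallest constant; the square in the defect
is not needed. -/
theorem exists_defect_growth (h : IsOptimalPair d q (1 - B) K ξ η) (hq : 0 < q) (hd : 1 ≤ d)
    (hnd : ∀ i, K ^ 2 * d ^ 2 * (ξ i * η i) ^ (d - 1) < 1) :
    ∃ ε > 0, ∀ᶠ z in 𝓝 (ξ, η), ε * ‖z - (ξ, η)‖ ^ 2 ≤ defect d K ξ η z := by
  have hN := h.sum_pos hq d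
  choose ε hε hgrow using fun i => pairFun_growth hd (h.pos_fst i) (h.pos_snd i) (h.crit_fst i)
    (h.crit_snd i) (hnd i)
  have hne : (Finset.univ : Finset (Fin q)).Nonempty := ⟨⟨0, hq⟩, Finset.mem_univ _⟩
  set δ := Finset.univ.inf' hne ε with hδ
  have hδ0 : 0 < δ := (Finset.lt_inf'_iff hne).2 fun i _ => hε i
  have hev : ∀ᶠ z in 𝓝 (ξ, η), ∀ i, ε i * ((z.1 i - ξ i) ^ 2 + (z.2 i - η i) ^ 2)
      ≤ pairFun d K (z.1 i) (z.2 i) - pairFun d K (ξ i) (η i) := by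
    rw [eventually_all]
    intro i
    have hc : Tendsto (fun z : (Fin q → ℝ) × (Fin q → ℝ) => (z.1 i, z.2 i)) (𝓝 (ξ, η))
        (𝓝 (ξ i, η i)) := by
      have : Continuous fun z : (Fin q → ℝ) × (Fin q → ℝ) => (z.1 i, z.2 i) := by fun_prop
      exact this.tendsto (ξ, η)
    exact hc.eventually (hgrow i)
  refine ⟨(∑ i, ξ i ^ d) * δ, mul_pos hN hδ0, ?_⟩
  filter_upwards [hev] with z hz
  have hz' : ∀ i, δ * ((z.1 i - ξ i) ^ 2 + (z.2 i - η i) ^ 2)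
      ≤ pairFun d K (z.1 i) (z.2 i) - pairFun d K (ξ i) (η i) := fun i =>
    (mul_le_mul_of_nonneg_right (Finset.inf'_le ε (Finset.mem_univ i)) (by positivity)).trans (hz i)
  set S := ∑ i, ((z.1 i - ξ i) ^ 2 + (z.2 i - η i) ^ 2) with hS
  have hS0 : 0 ≤ S := Finset.sum_nonneg fun i _ => by positivity
  have hterm : ∀ i, (z.1 i - ξ i) ^ 2 + (z.2 i - η i) ^ 2 ≤ S := fun i =>
    Finset.single_le_sum (f := fun i => (z.1 i - ξ i) ^ 2 + (z.2 i - η i) ^ 2)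
      (fun i _ => by positivity) (Finset.mem_univ i)
  have hnorm : ‖z - (ξ, η)‖ ≤ √S := by
    refine norm_prod_le_iff.2 ⟨?_, ?_⟩
    · refine (pi_norm_le_iff_of_nonneg (Real.sqrt_nonneg _)).2 fun i => ?_
      refine Real.le_sqrt_of_sq_le ?_
      rw [Real.norm_eq_abs, sq_abs]
      have := hterm i
      simp only [Prod.fst_sub, Pi.sub_apply]
      linarith [sq_nonneg (z.2 i - η i)]
    · refine (pi_norm_le_iff_of_nonneg (Real.sqrt_nonneg _)).2 fun i => ?_
      refine Real.le_sqrt_of_sq_le ?_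
      rw [Real.norm_eq_abs, sq_abs]
      have := hterm i
      simp only [Prod.snd_sub, Pi.sub_apply]
      linarith [sq_nonneg (z.1 i - ξ i)]
  have hsq : ‖z - (ξ, η)‖ ^ 2 ≤ S := by
    rw [← Real.sq_sqrt hS0]
    exact pow_le_pow_left₀ (norm_nonneg _) hnorm 2
  have hsum : δ * S ≤ ∑ i, (pairFun d K (z.1 i) (z.2 i) - pairFun d K (ξ i) (η i)) := by
    rw [hS, Finset.mul_sum]
    exact Finset.sum_le_sum fun i _ => hz' i
  have h1 : δ * ‖z - (ξ, η)‖ ^ 2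
      ≤ ∑ i, (pairFun d K (z.1 i) (z.2 i) - pairFun d K (ξ i) (η i)) :=
    (mul_le_mul_of_nonneg_left hsq hδ0.le).trans hsum
  have h2 := mul_le_mul_of_nonneg_left h1 hN.le
  unfold defect
  have h3 : 0 ≤ (∑ i, z.1 i ^ d - ∑ i, z.2 i ^ d) ^ 2 / 4 := by positivity
  linarith

theorem isHessianDominant (h : IsOptimalPair d q (1 - B) K ξ η) (hq : 3 ≤ q) (hd : 1 ≤ d)
    (hB : 0 ≤ B) (hnd : ∀ i, K ^ 2 * d ^ 2 * (ξ i * η i) ^ (d - 1) < 1)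
    {ρ : ℕ → (Fin q → ℝ) → Fin q → ℕ} (hρ : IsRounding ρ) :
    IsHessianDominant (d + 1) (pottsMatrix q B) ρ (powPhase d (ξ, η)) := by
  refine ⟨h.isDominantPhase hq hd hB hρ, ?_⟩
  obtain ⟨hmem, hpos1, hpos2⟩ := h.powPhase_mem (by omega)
  obtain ⟨F, hFsm, hF⟩ := h.exists_local_formula hq hB
  set p := powPhase d (ξ, η) with hp
  have hN := h.sum_pos (by omega) d
  have hΛ := h.optimalValue_pos (by omega)
  have hFp : F p = (d + 1 : ℝ) * Real.log (optimalValue d ξ) := by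
    have h1 := (hF.self_of_nhds hmem ρ hρ).1
    rw [hp, h.Psi1_powPhase hq hB hρ, EReal.coe_eq_coe_iff, ← hp] at h1
    exact h1.symm
  have hshift : Tendsto (fun v : phaseTangent q => p + (v : (Fin q → ℝ) × (Fin q → ℝ))) (𝓝 0)
      (𝓝 p) := by
    have : Continuous fun v : phaseTangent q => p + (v : (Fin q → ℝ) × (Fin q → ℝ)) := by fun_prop
    simpa using this.tendsto 0
  have hin : ∀ᶠ v : phaseTangent q in 𝓝 0,
      p + (v : (Fin q → ℝ) × (Fin q → ℝ)) ∈ phaseSpace q := by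
    have e1 : ∀ᶠ p' in 𝓝 p, (∀ i, 0 < p'.1 i) ∧ ∀ i, 0 < p'.2 i := by
      rw [eventually_and, eventually_all, eventually_all]
      refine ⟨fun i => ?_, fun i => ?_⟩
      · exact ((continuous_apply i).comp continuous_fst).tendsto p |>.eventually_const_lt (hpos1 i)
      · exact ((continuous_apply i).comp continuous_snd).tendsto p |>.eventually_const_lt (hpos2 i)
    filter_upwards [hshift.eventually e1] with v hv
    refine ⟨⟨fun i => (hv.1 i).le, ?_⟩, ⟨fun i => (hv.2 i).le, ?_⟩⟩
    · simp only [Prod.fst_add, Pi.add_apply, Finset.sum_add_distrib, hmem.1.2, v.2.1, add_zero]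
    · simp only [Prod.snd_add, Pi.add_apply, Finset.sum_add_distrib, hmem.2.2, v.2.2, add_zero]
  -- The defect bound, quadratic growth upstairs and the Lipschitz projection combine; the varying
  -- scale in the denominator is bounded by its limit plus one.
  have hdecay : ∃ ε > 0, ∀ᶠ p' in 𝓝 p, p' ∈ phaseSpace q → F p' ≤ F p - ε * ‖p' - p‖ ^ 2 := by
    obtain ⟨ε, hε, hgrow⟩ := h.exists_defect_growth (by omega) hd hnd
    obtain ⟨C, hC, hlip⟩ := h.exists_lipschitz_powPhase (by omega)
    have hlift : Tendsto (liftPair d (∑ i, ξ i ^ d)) (𝓝 p) (𝓝 (ξ, η)) := by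
      have := continuousAt_liftPair hd (∑ i, ξ i ^ d) hmem
      rwa [ContinuousAt, hp, h.liftPair_powPhase (by omega) hd] at this
    set T := liftScale d (∑ i, ξ i ^ d) p ^ (2 * d) with hT
    have hT0 : 0 < T := pow_pos (liftScale_spec hd hN hmem).1 _
    have hscale : ∀ᶠ p' in 𝓝 p, liftScale d (∑ i, ξ i ^ d) p' ^ (2 * d) < T + 1 :=
      ((continuousAt_liftScale hd (∑ i, ξ i ^ d) hmem).pow (2 * d)).eventually_lt_const
        (lt_add_one T)
    refine ⟨(d + 1 : ℝ) / optimalValue d ξ * (ε / C ^ 2 / (T + 1)), by positivity, ?_⟩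
    filter_upwards [hF, hlift.eventually hgrow, hlift.eventually hlip, hscale] with p' g1 g2 g3 g4 g5
    rw [powPhase_liftPair hd hN g5] at g3
    have k1 := h.Psi1_le_sub_defect hq hd hB hρ g5
    rw [(g1 g5 ρ hρ).1, EReal.coe_le_coe_iff] at k1
    have k2 : ε / C ^ 2 * ‖p' - p‖ ^ 2 ≤ defect d K ξ η (liftPair d (∑ i, ξ i ^ d) p') := by
      refine le_trans ?_ g2
      have := pow_le_pow_left₀ (norm_nonneg _) g3 2
      rw [mul_pow] at this
      rw [div_mul_eq_mul_div, div_le_iff₀ (by positivity)]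
      calc ε * ‖p' - p‖ ^ 2 ≤ ε * (C ^ 2 * ‖liftPair d (∑ i, ξ i ^ d) p' - (ξ, η)‖ ^ 2) :=
            mul_le_mul_of_nonneg_left this hε.le
        _ = _ := by ring
    have k3 := pow_pos (liftScale_spec hd hN g5).1 (2 * d)
    have k4 : ε / C ^ 2 / (T + 1) * ‖p' - p‖ ^ 2 ≤
        defect d K ξ η (liftPair d (∑ i, ξ i ^ d) p')
          / liftScale d (∑ i, ξ i ^ d) p' ^ (2 * d) := by
      rw [div_mul_eq_mul_div]
      exact div_le_div₀ ((by positivity : 0 ≤ ε / C ^ 2 * ‖p' - p‖ ^ 2).trans k2) k2 k3 g4.le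
    have k5 := mul_le_mul_of_nonneg_left k4
      (by positivity : 0 ≤ (d + 1 : ℝ) / optimalValue d ξ)
    rw [hFp, mul_assoc]
    linarith
  obtain ⟨ε, hε, hdec⟩ := hdecay
  have hsm : ContDiffAt ℝ 2 (fun v : phaseTangent q => F (p + (v : (Fin q → ℝ) × (Fin q → ℝ)))) 0 := by
    have h1 : ContDiffAt ℝ 2 (fun v : phaseTangent q => p + (v : (Fin q → ℝ) × (Fin q → ℝ))) 0 :=
      contDiffAt_const.add (phaseTangent q).subtypeL.contDiff.contDiffAt
    refine ContDiffAt.comp (0 : phaseTangent q) ?_ h1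
    simpa using hFsm
  refine ⟨fun v => F (p + (v : (Fin q → ℝ) × (Fin q → ℝ))), ?_, hsm, fun v hv => ?_⟩
  · filter_upwards [hin, hshift.eventually hF] with v h1 h2
    exact ⟨h1, (h2 h1 ρ hρ).1⟩
  · refine fderiv_fderiv_neg_of_quadratic_decay hsm hε ?_ hv
    filter_upwards [hin, hshift.eventually hdec] with v h1 h2
    have h3 := h2 h1
    rw [add_sub_cancel_left] at h3
    simpa using h3

end IsOptimalPair

end Dominance

/-! ### The uniform and the two-valued optimal pairs. -/

section Phases

variable {q d : ℕ} {B : ℝ}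

/-- With σ = (1-B)/q, the sum condition and the critical equation force the value 1 - σ. The
hypothesis says 1 - σ ≥ d/(d+1), the diagonal root at the transition, which is what K ≤ `cycleParam
d 1` requires. -/
theorem isOptimalPair_const (hq : 3 ≤ q) (hd : 2 ≤ d) (hB : B < 1)
    (hle : (1 - B) / q ≤ 1 / (d + 1)) :
    IsOptimalPair d q (1 - B) ((1 - B) / q / (1 - (1 - B) / q) ^ d)
        (fun _ => 1 - (1 - B) / q) (fun _ => 1 - (1 - B) / q) ∧
      (1 - B) / q / (1 - (1 - B) / q) ^ d ≤ cycleParam d 1 := by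
  have hq0 : (0 : ℝ) < q := by exact_mod_cast (by omega : 0 < q)
  have hd0 : (0 : ℝ) < d := by exact_mod_cast (by omega : 0 < d)
  set σ := (1 - B) / q with hσ
  have hσ0 : 0 < σ := div_pos (by linarith) hq0
  have hσq : q * σ = 1 - B := by
    rw [hσ]
    field_simp
  have hc : (d : ℝ) / (d + 1) ≤ 1 - σ := by
    have : (d : ℝ) / (d + 1) = 1 - 1 / (d + 1) := by
      field_simp
      ring
    linarith
  have hc0 : 0 < 1 - σ := lt_of_lt_of_le (by positivity) hc
  have hK0 : 0 < σ / (1 - σ) ^ d := by positivity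
  have hcrit : 1 - σ + σ / (1 - σ) ^ d * (1 - σ) ^ d = 1 := by
    field_simp
    ring
  have hle' : σ / (1 - σ) ^ d ≤ cycleParam d 1 := by
    have h1 := (cycle_crit hd (le_refl (1 : ℝ))).1
    rw [one_mul, gsum_one_right, gsum_one_right] at h1
    push_cast at h1
    rw [div_le_iff₀ (by positivity)]
    have h2 : cycleParam d 1 * ((d : ℝ) / (d + 1)) ^ d ≤ cycleParam d 1 * (1 - σ) ^ d :=
      mul_le_mul_of_nonneg_left (pow_le_pow_left₀ (by positivity) hc d)
        (cycleParam_pos hd zero_le_one).le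
    have h3 : 1 / ((d : ℝ) + 1) = 1 - d / (d + 1) := by
      field_simp
      ring
    linarith
  have hsum : σ / (1 - σ) ^ d * ∑ _i : Fin q, (1 - σ) ^ d = 1 - B := by
    rw [Finset.sum_const, Finset.card_univ, Fintype.card_fin, nsmul_eq_mul, ← hσq]
    field_simp
  exact ⟨⟨hK0, fun _ => hc0, fun _ => hc0, fun _ => hcrit, fun _ => hcrit, hsum, hsum,
    fun _ X Y hX hY => (pairFun_diag_min hd hK0 hle' hc0.le hcrit hX hY).1⟩, hle'⟩

theorem sum_ite_mem {T : Finset (Fin q)} (x y : ℝ) :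
    ∑ i, (if i ∈ T then x else y) = T.card * x + (q - T.card) * y := by
  have h1 : ∀ i, (if i ∈ T then x else y) = (if i ∈ T then x - y else 0) + y := fun i => by
    split_ifs <;> ring
  simp only [h1, Finset.sum_add_distrib, Finset.sum_ite_mem, Finset.univ_inter, Finset.sum_const,
    Finset.card_univ, Fintype.card_fin, nsmul_eq_mul]
  ring

/-- Intermediate values on [1, 3]: at t = 1 the lower bound on σ decides the sign, and at t = 3 the
right side is σ(3^(d+1) - 1) ≤ 3^d - 1/3. -/
theorem exists_cycle_ratio (hd : 2 ≤ d) {σ : ℝ} (h1 : 1 / ((d : ℝ) + 1) < σ) (h2 : σ ≤ 1 / 3) :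
    ∃ t : ℝ, 1 < t ∧ 1 + t ^ d = 2 * σ * gsum (d + 1) t := by
  have hcont : ContinuousOn (fun t => 1 + t ^ d - 2 * σ * gsum (d + 1) t) (Set.Icc 1 3) :=
    ((continuous_const.add (continuous_pow d)).sub
      (continuous_const.mul (continuous_gsum _))).continuousOn
  have hd0 : (0 : ℝ) < d + 1 := by positivity
  have e1 : (1 : ℝ) + 1 ^ d - 2 * σ * gsum (d + 1) 1 < 0 := by
    rw [gsum_one_right, one_pow]
    push_cast
    rw [div_lt_iff₀ hd0] at h1
    linarith
  have e3 : (0 : ℝ) ≤ 1 + 3 ^ d - 2 * σ * gsum (d + 1) 3 := by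
    have h3 := gsum_mul d 3
    have h4 := gsum_succ d 3
    have h5 := gsum_nonneg (d + 1) (t := 3) (by norm_num)
    nlinarith
  obtain ⟨t, ht, h0⟩ := intermediate_value_Icc (by norm_num : (1 : ℝ) ≤ 3) hcont ⟨e1.le, e3⟩
  refine ⟨t, lt_of_le_of_ne ht.1 ?_, by simp only at h0; linarith⟩
  rintro rfl
  exact e1.ne h0

/-- With half of the coordinates at each value, both sum conditions read K (X^d + Y^d) = 2σ, σ =
(1-B)/q. By the critical equations the left side is 2 - X - Y = (1 + t^d) / `gsum (d+1) t`, which is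
how t was chosen. -/
theorem isOptimalPair_cycle (hd : 2 ≤ d) {t : ℝ} (ht : 1 < t)
    (hσ : 1 + t ^ d = 2 * ((1 - B) / q) * gsum (d + 1) t) {X Y : ℝ}
    (hX : X = gsum d t / gsum (d + 1) t) (hY : Y = t * X) {T : Finset (Fin q)}
    (hT : 2 * T.card = q) (hq : 0 < q) :
    IsOptimalPair d q (1 - B) (cycleParam d t) (fun i => if i ∈ T then X else Y)
      (fun i => if i ∈ T then Y else X) := by
  have g1 : 0 < gsum d t := gsum_pos (by omega) (by linarith)
  have g2 : 0 < gsum (d + 1) t := gsum_pos (by omega) (by linarith)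
  have hX0 : 0 < X := by
    rw [hX]
    positivity
  have hY0 : 0 < Y := by
    rw [hY]
    exact mul_pos (by linarith) hX0
  obtain ⟨c1, c2⟩ := cycle_crit hd ht.le
  rw [← hX, ← hY] at c1 c2
  have hmin : ∀ X' Y' : ℝ, 0 ≤ X' → 0 ≤ Y' →
      pairFun d (cycleParam d t) X Y ≤ pairFun d (cycleParam d t) X' Y' :=
    fun X' Y' h1 h2 => (pairFun_cycle_min hd ht hX hY h1 h2).1
  have hT' : (T.card : ℝ) = q / 2 := by
    have : (2 : ℝ) * T.card = q := by exact_mod_cast hT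
    linarith
  have hq0 : (0 : ℝ) < q := by exact_mod_cast hq
  have hsum : cycleParam d t * (q / 2 * X ^ d + q / 2 * Y ^ d) = 1 - B := by
    have e1 : cycleParam d t * (X ^ d + Y ^ d) = 2 - X - Y := by linarith
    have e2 : 2 - X - Y = 2 * ((1 - B) / q) := by
      have e3 := gsum_succ d t
      have e4 := gsum_succ' d t
      rw [hY, hX]
      apply mul_right_cancel₀ g2.ne'
      rw [← hσ]
      field_simp
      linarith
    rw [show cycleParam d t * (q / 2 * X ^ d + q / 2 * Y ^ d)
      = q / 2 * (cycleParam d t * (X ^ d + Y ^ d)) by ring, e1, e2]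
    field_simp
  refine ⟨cycleParam_pos hd (by linarith), fun i => ?_, fun i => ?_, fun i => ?_, fun i => ?_,
    ?_, ?_, fun i X' Y' h1 h2 => ?_⟩
  · split_ifs <;> assumption
  · split_ifs <;> assumption
  · split_ifs <;> assumption
  · split_ifs <;> assumption
  · simp only [ite_pow, sum_ite_mem, hT']
    rw [← hsum]
    ring
  · simp only [ite_pow, sum_ite_mem, hT']
    rw [← hsum]
    ring
  · split_ifs
    · exact hmin X' Y' h1 h2
    · rw [pairFun_comm]
      exact hmin X' Y' h1 h2

/-- Multiplying the critical equations gives K²(XY)^d = (1-X)(1-Y); after inserting the closed forms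
the claim is d² t^(d-1) < `gsum d t` ^ 2, the inequality behind the monotonicity of `cycleParam`. -/
theorem cycle_nondegenerate (hd : 2 ≤ d) {t : ℝ} (ht : 1 < t) {X Y : ℝ}
    (hX : X = gsum d t / gsum (d + 1) t) (hY : Y = t * X) :
    cycleParam d t ^ 2 * d ^ 2 * (X * Y) ^ (d - 1) < 1 := by
  have g1 : 0 < gsum d t := gsum_pos (by omega) (by linarith)
  have g2 : 0 < gsum (d + 1) t := gsum_pos (by omega) (by linarith)
  have hX0 : 0 < X := by
    rw [hX]
    positivity
  have hY0 : 0 < Y := by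
    rw [hY]
    exact mul_pos (by linarith) hX0
  obtain ⟨c1, c2⟩ := cycle_crit hd ht.le
  rw [← hX, ← hY] at c1 c2
  have hamgm := sq_mul_pow_lt_gsum_sq hd ht
  obtain ⟨e, rfl⟩ : ∃ e, d = e + 1 := ⟨d - 1, by omega⟩
  rw [Nat.add_sub_cancel] at hamgm ⊢
  have h1 : 1 - X = t ^ (e + 1) / gsum (e + 1 + 1) t := by
    rw [hX, eq_div_iff g2.ne', sub_mul, div_mul_cancel₀ _ g2.ne', gsum_succ (e + 1)]
    ring
  have h2 : 1 - Y = 1 / gsum (e + 1 + 1) t := by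
    rw [hY, hX, eq_div_iff g2.ne', sub_mul, mul_assoc, div_mul_cancel₀ _ g2.ne', gsum_succ' (e + 1)]
    ring
  have h3 : cycleParam (e + 1) t ^ 2 * (X * Y) ^ (e + 1) = (1 - X) * (1 - Y) := by
    rw [mul_pow]
    have k1 : cycleParam (e + 1) t * Y ^ (e + 1) = 1 - X := by linarith
    have k2 : cycleParam (e + 1) t * X ^ (e + 1) = 1 - Y := by linarith
    rw [← k1, ← k2]
    ring
  have hXY : 0 < X * Y := mul_pos hX0 hY0
  have h4 : cycleParam (e + 1) t ^ 2 * ((e + 1 : ℕ) : ℝ) ^ 2 * (X * Y) ^ e * (X * Y) < 1 * (X * Y) := by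
    have : cycleParam (e + 1) t ^ 2 * ((e + 1 : ℕ) : ℝ) ^ 2 * (X * Y) ^ e * (X * Y)
        = ((e + 1 : ℕ) : ℝ) ^ 2 * ((1 - X) * (1 - Y)) := by
      rw [← h3]
      ring
    rw [this, h1, h2, hY, hX, one_mul]
    have e1 : ((e + 1 : ℕ) : ℝ) ^ 2 * (t ^ (e + 1) / gsum (e + 1 + 1) t
        * (1 / gsum (e + 1 + 1) t))
        = t * (((e + 1 : ℕ) : ℝ) ^ 2 * t ^ e) / gsum (e + 1 + 1) t ^ 2 := by
      field_simp
      ring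
    have e2 : gsum (e + 1) t / gsum (e + 1 + 1) t * (t * (gsum (e + 1) t / gsum (e + 1 + 1) t))
        = t * gsum (e + 1) t ^ 2 / gsum (e + 1 + 1) t ^ 2 := by
      field_simp
    rw [e1, e2]
    have ht0 : 0 < t := by linarith
    gcongr
  exact lt_of_mul_lt_mul_right h4 hXY.le

/-- The phase given by a two-valued pair of vectors. -/
theorem powPhase_twoValued {T : Finset (Fin q)} (hT : 2 * T.card = q) (X Y : ℝ) :
    powPhase d (fun i => if i ∈ T then X else Y, fun i => if i ∈ T then Y else X)
      = twoValuedPhase (X ^ (d + 1) / (q / 2 * (X ^ (d + 1) + Y ^ (d + 1))))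
          (Y ^ (d + 1) / (q / 2 * (X ^ (d + 1) + Y ^ (d + 1)))) T := by
  have hT' : (T.card : ℝ) = q / 2 := by
    have : (2 : ℝ) * T.card = q := by exact_mod_cast hT
    linarith
  have e1 : (q : ℝ) / 2 * X ^ (d + 1) + (q - q / 2) * Y ^ (d + 1)
      = q / 2 * (X ^ (d + 1) + Y ^ (d + 1)) := by ring
  have e2 : (q : ℝ) / 2 * Y ^ (d + 1) + (q - q / 2) * X ^ (d + 1)
      = q / 2 * (X ^ (d + 1) + Y ^ (d + 1)) := by ring
  refine Prod.ext (funext fun i => ?_) (funext fun i => ?_)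
  · simp only [powPhase, twoValuedPhase, ite_pow, sum_ite_mem, hT', e1]
    split_ifs <;> rfl
  · simp only [powPhase, twoValuedPhase, ite_pow, sum_ite_mem, hT', e2]
    split_ifs <;> rfl

theorem twoValuedPhase_injective {a b : ℝ} (hab : a ≠ b) :
    Function.Injective (twoValuedPhase (q := q) a b) := by
  intro T T' h
  ext i
  have h1 : (if i ∈ T then a else b) = if i ∈ T' then a else b := congrFun (congrArg Prod.fst h) i
  by_cases hi : i ∈ T <;> by_cases hi' : i ∈ T' <;> simp_all [eq_comm]

end Phases

/-! ### The two regimes. -/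

theorem mainTheorem5 (q Δ : ℕ) (hq : 3 ≤ q) (hΔ : 3 ≤ Δ) (B : ℝ) (hB0 : 0 ≤ B) (hB1 : B < 1) :
    (((Δ : ℝ) - q) / Δ ≤ B →
      ∀ ρ : ℕ → (Fin q → ℝ) → Fin q → ℕ, IsRounding ρ →
        ∃ p : (Fin q → ℝ) × (Fin q → ℝ),
          (∀ p', IsDominantPhase Δ (pottsMatrix q B) ρ p' ↔ p' = p) ∧
          p.1 = p.2 ∧ (∀ i, p.1 i = 1 / (q : ℝ)) ∧
          ∀ᶠ p' in nhdsWithin p (phaseSpace q),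
            FirstMomentLimitExists Δ (pottsMatrix q B) ρ p') ∧
    (Even q → B < ((Δ : ℝ) - q) / Δ →
      ∃ a b : ℝ, a ≠ b ∧
        ∀ ρ : ℕ → (Fin q → ℝ) → Fin q → ℕ, IsRounding ρ →
          Set.BijOn (twoValuedPhase a b) {T : Finset (Fin q) | T.card = q / 2}
            {p | IsDominantPhase Δ (pottsMatrix q B) ρ p} ∧
          ∀ p, IsDominantPhase Δ (pottsMatrix q B) ρ p →
            IsHessianDominant Δ (pottsMatrix q B) ρ p ∧
            ∀ᶠ p' in nhdsWithin p (phaseSpace q),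
              FirstMomentLimitExists Δ (pottsMatrix q B) ρ p') := by
  obtain ⟨d, rfl⟩ : ∃ d, Δ = d + 1 := ⟨Δ - 1, by omega⟩
  have hd : 2 ≤ d := by omega
  have hq0 : (0 : ℝ) < q := by exact_mod_cast (by omega : 0 < q)
  have hd0 : (0 : ℝ) < d + 1 := by positivity
  constructor
  · intro hB ρ hρ
    -- The threshold on B, restated as the position of (1-B)/q relative to the transition value 1/Δ.
    have hσ : (1 - B) / q ≤ 1 / ((d : ℝ) + 1) := by
      push_cast at hB
      rw [div_le_iff₀ hd0] at hB
      rw [div_le_div_iff₀ hq0 hd0]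
      linarith
    obtain ⟨h, hK⟩ := isOptimalPair_const (B := B) hq hd hB1 hσ
    set c := 1 - (1 - B) / (q : ℝ) with hc
    have hc0 : 0 < c := h.pos_fst ⟨0, by omega⟩
    have hval : ∀ i : Fin q, c ^ (d + 1) / ∑ _k : Fin q, c ^ (d + 1) = 1 / (q : ℝ) := fun i => by
      rw [Finset.sum_const, Finset.card_univ, Fintype.card_fin, nsmul_eq_mul]
      field_simp
    refine ⟨powPhase d (fun _ => c, fun _ => c), fun p' => ⟨fun hp' => ?_, ?_⟩, rfl, hval,
      h.eventually_firstMomentLimitExists hq hB0 hρ⟩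
    · obtain ⟨z, hz1, hz2, hzp, hz, -⟩ := h.exists_of_isDominantPhase hq (by omega) hB0 hρ hp'
      have hzc : ∀ i, z.1 i = c ∧ z.2 i = c := fun i =>
        (pairFun_diag_min hd h.pos_K hK hc0.le (h.crit_fst i) (hz1 i) (hz2 i)).2 (hz i)
      rw [← hzp, show z = (fun _ => c, fun _ => c) from
        Prod.ext (funext fun i => (hzc i).1) (funext fun i => (hzc i).2)]
    · rintro rfl
      exact h.isDominantPhase hq (by omega) hB0 hρ
  · intro heven hB
    have hσ1 : 1 / ((d : ℝ) + 1) < (1 - B) / q := by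
      push_cast at hB
      rw [lt_div_iff₀ hd0] at hB
      rw [div_lt_div_iff₀ hd0 hq0]
      linarith
    have hσ2 : (1 - B) / q ≤ 1 / 3 := by
      have : (3 : ℝ) ≤ q := by exact_mod_cast hq
      rw [div_le_div_iff₀ hq0 (by norm_num)]
      linarith
    obtain ⟨t, ht, hσ⟩ := exists_cycle_ratio hd hσ1 hσ2
    obtain ⟨X, hX⟩ : ∃ X, X = gsum d t / gsum (d + 1) t := ⟨_, rfl⟩
    obtain ⟨Y, hY⟩ : ∃ Y, Y = t * X := ⟨_, rfl⟩
    have hX0 : 0 < X := by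
      rw [hX]
      exact div_pos (gsum_pos (by omega) (by linarith)) (gsum_pos (by omega) (by linarith))
    have hXY : X < Y := by
      rw [hY]
      exact lt_mul_of_one_lt_left hX0 ht
    have hY0 := hX0.trans hXY
    have hq2 : ∀ T : Finset (Fin q), T.card = q / 2 → 2 * T.card = q := fun T hT => by
      obtain ⟨k, hk⟩ := heven
      omega
    have hopt := fun (T : Finset (Fin q)) (hT : T.card = q / 2) =>
      isOptimalPair_cycle (B := B) hd ht hσ hX hY (hq2 T hT) (by omega)
    have hphase := fun (T : Finset (Fin q)) (hT : T.card = q / 2) =>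
      powPhase_twoValued (d := d) (hq2 T hT) X Y
    set a := X ^ (d + 1) / (q / 2 * (X ^ (d + 1) + Y ^ (d + 1))) with ha
    set b := Y ^ (d + 1) / (q / 2 * (X ^ (d + 1) + Y ^ (d + 1))) with hb
    have hab : a ≠ b := by
      refine ne_of_lt ?_
      rw [ha, hb]
      have := pow_lt_pow_left₀ hXY hX0.le (Nat.succ_ne_zero d)
      gcongr
    obtain ⟨T₀, -, hT₀⟩ := Finset.exists_subset_card_eq (s := (Finset.univ : Finset (Fin q)))
      (n := q / 2) (by rw [Finset.card_univ, Fintype.card_fin]; omega)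
    refine ⟨a, b, hab, fun ρ hρ => ?_⟩
    have hsurj : ∀ p, IsDominantPhase (d + 1) (pottsMatrix q B) ρ p →
        ∃ T : Finset (Fin q), T.card = q / 2 ∧ twoValuedPhase a b T = p := by
      intro p hp
      obtain ⟨z, hz1, hz2, hzp, hz, hzs⟩ :=
        (hopt T₀ hT₀).exists_of_isDominantPhase hq (by omega) hB0 hρ hp
      have hzz : ∀ i, (z.1 i = X ∧ z.2 i = Y) ∨ (z.1 i = Y ∧ z.2 i = X) := by
        intro i
        refine (pairFun_cycle_min hd ht hX hY (hz1 i) (hz2 i)).2 ?_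
        rw [hz i]
        split_ifs
        · rfl
        · exact pairFun_comm _ _ _ _
      set T := Finset.univ.filter fun i => z.1 i = X with hTdef
      have e1 : z.1 = fun i => if i ∈ T then X else Y := by
        funext i
        by_cases hi : z.1 i = X
        · simp [hTdef, hi]
        · simpa [hTdef, hi] using ((hzz i).resolve_left fun h => hi h.1).1
      have e2 : z.2 = fun i => if i ∈ T then Y else X := by
        funext i
        by_cases hi : z.1 i = X
        · have := (hzz i).resolve_right fun h => hXY.ne (hi.symm.trans h.1)
          simpa [hTdef, hi] using this.2
        · simpa [hTdef, hi] using ((hzz i).resolve_left fun h => hi h.1).2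
      -- Minimality constrains each colour separately; equality of the two sums of d-th powers is
      -- what balances T against its complement.
      have hcard : 2 * T.card = q := by
        rw [e1, e2] at hzs
        simp only [ite_pow, sum_ite_mem] at hzs
        have h1 : ((2 : ℝ) * T.card - q) * (Y ^ d - X ^ d) = 0 := by linarith
        have h2 : Y ^ d - X ^ d ≠ 0 :=
          (sub_pos.2 (pow_lt_pow_left₀ hXY hX0.le (by omega))).ne'
        have h3 := (mul_eq_zero.1 h1).resolve_right h2
        have h4 : (2 : ℝ) * T.card = q := by linarith
        exact_mod_cast h4
      have hT : T.card = q / 2 := by omega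
      refine ⟨T, hT, ?_⟩
      rw [← hphase T hT, ← hzp, ← e1, ← e2]
    have hnd : ∀ (T : Finset (Fin q)) (i : Fin q), cycleParam d t ^ 2 * d ^ 2
        * ((if i ∈ T then X else Y) * (if i ∈ T then Y else X)) ^ (d - 1) < 1 := by
      intro T i
      have := cycle_nondegenerate hd ht hX hY
      split_ifs
      · exact this
      · rwa [mul_comm Y X]
    refine ⟨⟨fun T hT => ?_, (twoValuedPhase_injective hab).injOn, fun p hp => hsurj p hp⟩,
      fun p hp => ?_⟩
    · change IsDominantPhase (d + 1) (pottsMatrix q B) ρ (twoValuedPhase a b T)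
      rw [← hphase T hT]
      exact (hopt T hT).isDominantPhase hq (by omega) hB0 hρ
    · obtain ⟨T, hT, rfl⟩ := hsurj p hp
      rw [← hphase T hT]
      exact ⟨(hopt T hT).isHessianDominant hq (by omega) hB0 (hnd T) hρ,
        (hopt T hT).eventually_firstMomentLimitExists hq hB0 hρ⟩
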